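/- Strong comparison principle. Let $N\ge 1$, let $\Omega\subset\mathbb R^N$ be a bounded domain (open and connected), $d_\Omega(x)=\operatorname{dist}(x,\partial\Omega)$, and let $0<s_2<s_1<1$, $1<q<p$. Let $W_0^{s,p}(\Omega)$ be the set of $u\in L^p(\Omega)$, extended by $u=0$ a.e. outside $\Omega$, with $\iint_{\mathbb R^{2N}}\frac{|u(x)-u(y)|^p}{|x-y|^{N+sp}}\,dx\,dy<\infty$. Let $C^0_{s_1}(\overline\Omega)$ be the set of $u\in C^0(\overline\Omega)$ such that $u/d_\Omega^{s_1}$ has a continuous extension to $\overline\Omega$, and let $$\operatorname{int} C^0_{s_1}(\overline\Omega)_+=\Big\{u\in C^0_{s_1}(\overline\Omega):\ u>0\text{ in }\Omega,\ \inf_\Omega \frac{u}{d_\Omega^{s_1}}>0\Big\}.$$ For $r>1$ put $J_r(t)=|t|^{r-2}t$ and $\langle A_{s,r}(u),\varphi\rangle=\iint_{\mathbb R^{2N}}\frac{J_r(u(x)-u(y))(\varphi(x)-\varphi(y))}{|x-y|^{N+sr}}\,dx\,dy$. Let $g:\mathbb R\to\mathbb R$ be continuous and of locally bounded variation, let $K>0$,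 and let $u,v\in W_0^{s_1,p}(\Omega)\cap C^0_{s_1}(\overline\Omega)$ satisfy $u\ne v$ in $\Omega$, $0<u\le v$ in $\Omega$ and $$(-\Delta_p)^{s_1}u+(-\Delta_q)^{s_2}u+g(u)\ \le\ (-\Delta_p)^{s_1}v+(-\Delta_q)^{s_2}v+g(v)\ \le\ K\qquad\text{weakly in }\Omega,$$ that is, for every $\varphi\in W_0^{s_1,p}(\Omega)$ with $\varphi\ge0$, $$\langle A_{s_1,p}(u)+A_{s_2,q}(u),\varphi\rangle+\int_\Omega g(u)\varphi\,dx\ \le\ \langle A_{s_1,p}(v)+A_{s_2,q}(v),\varphi\rangle+\int_\Omega g(v)\varphi\,dx\ \le\ K\int_\Omega\varphi\,dx .$$ Then $u<v$ everywhere in $\Omega$. In particular, if $u,v\in\operatorname{int} C^0_{s_1}(\overline\Omega)_+$, then $v\ge\eta u$ in $\Omega$ for some $\eta>1$, and $v-u\in\operatorname{int} C^0_{s_1}(\overline\Omega)_+$. -/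

import Mathlib

open MeasureTheory Set

noncomputable section

namespace FracPQ

/-- The power map `J_r(t) = |t|^{r-2} t`. -/
def J (r t : ℝ) : ℝ := |t| ^ (r - 2) * t

/-- The `p`-th power of the Gagliardo seminorm over the whole of `ℝᴺ × ℝᴺ`, with values in
`[0, ∞]`. -/
def gagliardo {N : ℕ} (s p : ℝ) (u : EuclideanSpace ℝ (Fin N) → ℝ) : ENNReal :=
  ∫⁻ z : EuclideanSpace ℝ (Fin N) × EuclideanSpace ℝ (Fin N),
    ENNReal.ofReal (|u z.1 - u z.2| ^ p / ‖z.1 - z.2‖ ^ ((N : ℝ) + s * p))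

/-- `u ∈ W₀^{s,p}(Ω)`: `u ∈ L^p(Ω)`, the Gagliardo seminorm of `u` over `ℝᴺ × ℝᴺ` is finite, and
`u = 0` almost everywhere outside `Ω`. -/
structure MemW0 {N : ℕ} (Ω : Set (EuclideanSpace ℝ (Fin N))) (s p : ℝ)
    (u : EuclideanSpace ℝ (Fin N) → ℝ) : Prop where
  memLp : MemLp u (ENNReal.ofReal p) (volume.restrict Ω)
  seminorm_lt_top : gagliardo s p u < ⊤
  zero_outside : ∀ᵐ x ∂(volume.restrict Ωᶜ), u x = 0

/-- The pairing `⟨A_{s,r}(u), φ⟩`, that is, the weak form of the fractional `r`-Laplacian of order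
`s` (without normalisation constant). -/
def A {N : ℕ} (s r : ℝ) (u φ : EuclideanSpace ℝ (Fin N) → ℝ) : ℝ :=
  ∫ z : EuclideanSpace ℝ (Fin N) × EuclideanSpace ℝ (Fin N),
    J r (u z.1 - u z.2) * (φ z.1 - φ z.2) / ‖z.1 - z.2‖ ^ ((N : ℝ) + s * r)

/-- The weak form of `(-Δ_p)^{s₁} u + (-Δ_q)^{s₂} u + g(u)` in `Ω`, tested with `φ`. -/
def weakForm {N : ℕ} (Ω : Set (EuclideanSpace ℝ (Fin N))) (s₁ p s₂ q : ℝ) (g : ℝ → ℝ)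
    (u φ : EuclideanSpace ℝ (Fin N) → ℝ) : ℝ :=
  A s₁ p u φ + A s₂ q u φ + ∫ x in Ω, g (u x) * φ x

/-- The distance to the boundary, `d_Ω(x) = dist(x, ∂Ω)`. -/
def bdist {N : ℕ} (Ω : Set (EuclideanSpace ℝ (Fin N))) (x : EuclideanSpace ℝ (Fin N)) : ℝ :=
  Metric.infDist x (frontier Ω)

/-- `u ∈ C⁰_s(Ω̄)`: `u` is continuous on `Ω̄` and `u / d_Ω^s` has a continuous extension from `Ω`
to `Ω̄`. -/
def MemC0 {N : ℕ} (Ω : Set (EuclideanSpace ℝ (Fin N))) (s : ℝ)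
    (u : EuclideanSpace ℝ (Fin N) → ℝ) : Prop :=
  ContinuousOn u (closure Ω) ∧
    ∃ h : EuclideanSpace ℝ (Fin N) → ℝ, ContinuousOn h (closure Ω) ∧
      ∀ x ∈ Ω, h x = u x / bdist Ω x ^ s

/-- `u ∈ int C⁰_s(Ω̄)₊`: `u ∈ C⁰_s(Ω̄)`, `u > 0` in `Ω`, and `inf_Ω u / d_Ω^s > 0`. -/
def MemIntCone {N : ℕ} (Ω : Set (EuclideanSpace ℝ (Fin N))) (s : ℝ)
    (u : EuclideanSpace ℝ (Fin N) → ℝ) : Prop :=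
  MemC0 Ω s u ∧ (∀ x ∈ Ω, 0 < u x) ∧ ∃ c : ℝ, 0 < c ∧ ∀ x ∈ Ω, c ≤ u x / bdist Ω x ^ s

end FracPQ

end

/-!
The naive approach, comparing `η * u` with `v` for some `η > 1`, fails because the two operators have
different homogeneities: multiplying `u` by `1 + κ` changes the `p`-flux by the factor
`(1 + κ) ^ (p - 1)` but the `q`-flux only by `(1 + κ) ^ (q - 1)`, and the `q`-operator at `u` has no
sign. The defect is of first order in `κ`, like the gain from the set where `v - u` is bounded below,
so it cannot be absorbed directly. It is handled by a De Giorgi iteration.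

Fix levels `θ j * u - τ j`, decreasing in `j`, and let `ψ j` be the positive part of
`θ j * u - τ j - (v - u) / κ`, with positivity set `S j`. If the measure of `S j` tends to `0` for some
`κ > 0`, then `v - u ≥ κ * (θ * u - τ)` in the limit, everywhere by continuity. For the pointwise
strict inequality at `x₁` the levels are `u - τ j` with `τ j` between `u x₁ / 4` and `u x₁ / 2`, for the
statement on the cone they are multiples of `u` with factors between `1` and `1 / 2`.

Three inequalities drive the iteration.

* Coercivity (`Config.exists_coercivity`). Testing the difference of the two inequalities with `ψ j`,
  the monotonicity of the fluxes and a ball on which `v - u` is bounded below control a coercive energy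
  `Co j` and `κ⁻¹ * ∫ ψ j`, whose sum is `Q j`, by the mismatch error alone. The error lives on pairs
  over which `u` increases while `ψ j` decreases (`J_increment_mismatch`).
* Smallness of the error (`Config.exists_Er_le`, `Config.exists_En_le`). As `s₂ < s₁` and `q < p`, the
  `q`-energy is a small multiple of the `p`-energy up to an integrable kernel
  (`energy_interpolation`). Hence the error is a small multiple of `Co` and of the energy `En` of `u` on
  the preceding set, plus a weighted measure `Y` of the set. The energy is itself estimated by testing
  the inequality for `u` with a cut-off of `u`.
* Gain of measure (`Config.exists_measure_le`). A Hardy and a Faber–Krahn type lower bound for the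
  coercive density give `volume (S (j + 1)) ≤ C * B ^ j * Q j` and an estimate for `Y (j + 1)` by `Q j`
  with the additional factor `κ ^ w * volume (S j) ^ σ`.

Together they yield a recursion which is superlinear up to small linear terms, with a small factor
`κ ^ w`; the fast geometric convergence lemma `exists_decay` then gives the decay of `volume (S j)`.
-/

namespace FracPQ

/-! ### Elementary inequalities for the power map -/

lemma J_of_nonneg {r t : ℝ} (hr : 1 < r) (ht : 0 ≤ t) : J r t = t ^ (r - 1) := by
  unfold J
  rcases ht.eq_or_lt with rfl | h
  · rw [Real.zero_rpow (by linarith)]; simp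
  · rw [abs_of_pos h]
    nth_rewrite 2 [← Real.rpow_one t]
    rw [← Real.rpow_add h]
    ring_nf

lemma J_neg (r t : ℝ) : J r (-t) = -J r t := by
  unfold J; rw [abs_neg]; ring

lemma J_nonneg {r t : ℝ} (ht : 0 ≤ t) : 0 ≤ J r t := by
  unfold J; positivity

lemma abs_J {r : ℝ} (hr : 1 < r) (t : ℝ) : |J r t| = |t| ^ (r - 1) := by
  rcases le_total 0 t with h | h
  · rw [abs_of_nonneg (J_nonneg h), J_of_nonneg hr h, abs_of_nonneg h]
  · rw [← abs_neg, ← J_neg, abs_of_nonneg (J_nonneg (by linarith)), J_of_nonneg hr (by linarith),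
      abs_of_nonpos h]

lemma J_monotone {r : ℝ} (hr : 1 < r) : Monotone (J r) := by
  have pos : ∀ a b : ℝ, 0 ≤ a → a ≤ b → J r a ≤ J r b := fun a b ha hab => by
    rw [J_of_nonneg hr ha, J_of_nonneg hr (ha.trans hab)]
    exact Real.rpow_le_rpow ha hab (by linarith)
  intro a b hab
  rcases le_total 0 a with ha | ha
  · exact pos a b ha hab
  · rcases le_total 0 b with hb | hb
    · have h1 : J r a ≤ 0 := by
        have := J_nonneg (r := r) (t := -a) (by linarith)
        rw [J_neg] at this; linarith
      exact h1.trans (J_nonneg hb)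
    · have := pos (-b) (-a) (by linarith) (by linarith)
      rw [J_neg, J_neg] at this; linarith

lemma J_mul {r c t : ℝ} (hr : 1 < r) (hc : 0 ≤ c) (ht : 0 ≤ t) :
    J r (c * t) = c ^ (r - 1) * J r t := by
  rw [J_of_nonneg hr ht, J_of_nonneg hr (by positivity), Real.mul_rpow hc ht]

lemma measurable_J (r : ℝ) : Measurable (J r) := by
  unfold J; fun_prop

/-- Powers of comparable numbers are comparable, whatever the sign of the exponent. -/
lemma rpow_le_of_comparable {x y : ℝ} (e : ℝ) (hx : 0 < x) (h1 : x / 4 ≤ y) (h2 : y ≤ 4 * x) :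
    x ^ e ≤ 4 ^ |e| * y ^ e := by
  have hy : 0 < y := by linarith
  rcases le_total 0 e with he | he
  · rw [abs_of_nonneg he, ← Real.mul_rpow (by norm_num) hy.le]
    exact Real.rpow_le_rpow hx.le (by linarith) he
  · rw [abs_of_nonpos he]
    have : (4 * x) ^ e ≤ y ^ e := Real.rpow_le_rpow_of_nonpos hy h2 he
    rw [Real.mul_rpow (by norm_num) hx.le] at this
    calc x ^ e = 4 ^ (-e) * (4 ^ e * x ^ e) := by
          rw [← mul_assoc, ← Real.rpow_add (by norm_num)]; simp
      _ ≤ _ := by gcongr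

/-- Strict monotonicity of the power map in quantitative form. -/
lemma J_sub_ge {r : ℝ} (hr : 1 < r) : ∃ c : ℝ, 0 < c ∧ ∀ a b : ℝ, b ≤ a →
    c * (|a| + |b|) ^ (r - 2) * (a - b) ≤ J r a - J r b := by
  set m := min 1 (r - 1) / 2 with hm
  have hm0 : 0 < m := by have : 0 < min 1 (r - 1) := lt_min one_pos (by linarith)
                         positivity
  have hm1 : m ≤ 1 / 2 := by have := min_le_left 1 (r - 1); linarith
  have hm2 : m ≤ r - 1 := by
    have := min_le_right 1 (r - 1); linarith
  have hunit : ∀ x : ℝ, -1 ≤ x → x ≤ 1 → m * (1 - x) ≤ 1 - J r x := fun x h1 h2 => by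
    rcases le_total 0 x with hx | hx
    · rw [J_of_nonneg hr hx]
      rcases le_total 1 (r - 1) with h | h
      · have : x ^ (r - 1) ≤ x := by
          have := Real.rpow_le_rpow_of_exponent_ge' hx h2 zero_le_one h
          simpa using this
        nlinarith
      · have := rpow_one_add_le_one_add_mul_self (s := x - 1) (by linarith)
          (p := r - 1) (by linarith) h
        rw [show 1 + (x - 1) = x by ring] at this
        nlinarith
    · have : 0 ≤ J r (-x) := J_nonneg (by linarith)
      rw [J_neg] at this
      nlinarith
  -- By symmetry the larger modulus may be taken at the upper end.
  have key : ∀ a b : ℝ, 0 < a → |b| ≤ a →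
      m * (a ^ (r - 2) * (a - b)) ≤ J r a - J r b := fun a b ha hb => by
    have h := hunit (b / a) (by rw [le_div_iff₀ ha]; have := neg_abs_le b; linarith)
      (by rw [div_le_one ha]; have := le_abs_self b; linarith)
    have hJ : J r b = a ^ (r - 1) * J r (b / a) := by
      rcases le_total 0 b with hb0 | hb0
      · rw [← J_mul hr ha.le (by positivity), mul_div_cancel₀ _ ha.ne']
      · have : J r (-b) = a ^ (r - 1) * J r (-b / a) := by
          rw [← J_mul hr ha.le (div_nonneg (by linarith) ha.le), mul_div_cancel₀ _ ha.ne']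
        rw [neg_div, J_neg, J_neg] at this; linarith
    have hpow : a ^ (r - 1) = a ^ (r - 2) * a := by
      nth_rewrite 3 [← Real.rpow_one a]
      rw [← Real.rpow_add ha]; ring_nf
    rw [hJ, J_of_nonneg hr ha.le]
    have : m * (a ^ (r - 2) * (a - b)) = a ^ (r - 1) * (m * (1 - b / a)) := by
      rw [hpow]; field_simp
    rw [this]
    have := mul_le_mul_of_nonneg_left h (Real.rpow_nonneg ha.le (r - 1))
    linarith
  refine ⟨m / 4 ^ |r - 2|, by positivity, fun a b hab => ?_⟩
  have fin : ∀ x S : ℝ, 0 < x → x ≤ S → S ≤ 2 * x →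
      m / 4 ^ |r - 2| * S ^ (r - 2) ≤ m * x ^ (r - 2) := fun x S hx h1 h2 => by
    have := rpow_le_of_comparable (x := S) (y := x) (r - 2) (by linarith) (by linarith) (by linarith)
    rw [div_mul_eq_mul_div, div_le_iff₀ (by positivity)]
    nlinarith
  have main : ∀ a b : ℝ, b ≤ a → |b| ≤ a →
      m / 4 ^ |r - 2| * (|a| + |b|) ^ (r - 2) * (a - b) ≤ J r a - J r b := fun a b hab h => by
    have ha0 : 0 ≤ a := (abs_nonneg b).trans h
    rcases ha0.eq_or_lt with h0 | h0
    · have hb0 : b = 0 := by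
        have : |b| ≤ 0 := by linarith
        simpa using this
      simp [← h0, hb0]
    · have h1 := key a b h0 h
      have h2 := fin a (|a| + |b|) h0 (by rw [abs_of_pos h0]; linarith [abs_nonneg b])
        (by rw [abs_of_pos h0]; linarith)
      nlinarith [mul_le_mul_of_nonneg_right h2 (sub_nonneg.2 hab)]
  by_cases h : |b| ≤ a
  · exact main a b hab h
  by_cases h' : |a| ≤ -b
  · have := main (-b) (-a) (by linarith) (by rwa [abs_neg])
    rw [J_neg, J_neg, abs_neg, abs_neg, add_comm |b|] at this
    linarith
  · exfalso
    rcases abs_cases a with ⟨h1, h2⟩ | ⟨h1, h2⟩ <;> rcases abs_cases b with ⟨h3, h4⟩ | ⟨h3, h4⟩ <;>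
      linarith

/-- The increments of `J r` away from `η t` dominate the weight `(t + κ h) ^ (r - 2) * h`. -/
lemma J_increment {r : ℝ} (hr : 1 < r) : ∃ c : ℝ, 0 < c ∧ ∀ κ θ t h : ℝ, 0 < κ → κ ≤ 1 → 0 ≤ θ →
    θ ≤ 1 → 0 ≤ t → 0 ≤ h →
    c * κ * ((t + κ * h) ^ (r - 2) * h) ≤ J r ((1 + κ * θ) * t + κ * h) - J r ((1 + κ * θ) * t) ∧
    c * κ * ((t + κ * h) ^ (r - 2) * h) ≤ J r ((1 + κ * θ) * t) - J r ((1 + κ * θ) * t - κ * h) := by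
  obtain ⟨c, hc, H⟩ := J_sub_ge hr
  refine ⟨c / 4 ^ |r - 2|, by positivity, fun κ θ t h hκ hκ1 hθ hθ1 ht hh => ?_⟩
  rcases hh.eq_or_lt with rfl | hh
  · simp
  have hkh : 0 < κ * h := by positivity
  have hη : t ≤ (1 + κ * θ) * t := by nlinarith [mul_nonneg (mul_nonneg hκ.le hθ) ht]
  have hη2 : (1 + κ * θ) * t ≤ 2 * t := by nlinarith [mul_le_one₀ hκ1 hθ hθ1]
  have hη0 : 0 ≤ (1 + κ * θ) * t := ht.trans hη
  have fin : ∀ S : ℝ, (t + κ * h) / 4 ≤ S → S ≤ 4 * (t + κ * h) → ∀ X : ℝ,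
      c * S ^ (r - 2) * (κ * h) ≤ X →
      c / 4 ^ |r - 2| * κ * ((t + κ * h) ^ (r - 2) * h) ≤ X := fun S h1 h2 X hX => by
    have := rpow_le_of_comparable (r - 2) (by linarith) h1 h2
    refine le_trans ?_ hX
    have h4 : (0:ℝ) < 4 ^ |r - 2| := by positivity
    calc c / 4 ^ |r - 2| * κ * ((t + κ * h) ^ (r - 2) * h)
        ≤ c / 4 ^ |r - 2| * κ * ((4 ^ |r - 2| * S ^ (r - 2)) * h) := by gcongr
      _ = c * S ^ (r - 2) * (κ * h) := by field_simp
  constructor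
  · have := H ((1 + κ * θ) * t + κ * h) ((1 + κ * θ) * t) (by linarith)
    rw [abs_of_nonneg hη0, abs_of_nonneg (by linarith : 0 ≤ (1 + κ * θ) * t + κ * h)] at this
    refine fin ((1 + κ * θ) * t + κ * h + (1 + κ * θ) * t) ?_ ?_ _ (le_trans (le_of_eq ?_) this)
    · linarith
    · linarith
    · ring
  · have := H ((1 + κ * θ) * t) ((1 + κ * θ) * t - κ * h) (by linarith)
    rw [abs_of_nonneg hη0] at this
    refine fin ((1 + κ * θ) * t + |(1 + κ * θ) * t - κ * h|) ?_ ?_ _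
      (le_trans (le_of_eq ?_) this)
    · have := neg_abs_le ((1 + κ * θ) * t - κ * h)
      linarith [abs_nonneg ((1 + κ * θ) * t - κ * h)]
    · have : |(1 + κ * θ) * t - κ * h| ≤ (1 + κ * θ) * t + κ * h :=
        abs_le.2 ⟨by linarith, by linarith⟩
      linarith
    · ring

/-- A convexity bound: `(1 + c κ) ^ m - 1` is at most linear in `κ ∈ [0, 1]`. -/
lemma one_add_mul_rpow_le {c m κ : ℝ} (hc : 0 ≤ c) (hm : 0 ≤ m) (hκ : 0 ≤ κ) (hκ1 : κ ≤ 1) :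
    (1 + c * κ) ^ m ≤ 1 + (1 + c) ^ (m + 1) * κ := by
  have h1 : (1 + c * κ) ^ m ≤ (1 + c * κ) ^ (m + 1) :=
    Real.rpow_le_rpow_of_exponent_le (by nlinarith) (by linarith)
  have h2 := (convexOn_rpow (p := m + 1) (by linarith)).2 (Set.mem_Ici.2 zero_le_one)
    (Set.mem_Ici.2 (by linarith : 0 ≤ 1 + c)) (by linarith : 0 ≤ 1 - κ) hκ (by ring)
  simp only [smul_eq_mul, mul_one, Real.one_rpow] at h2
  rw [show 1 - κ + κ * (1 + c) = 1 + c * κ by ring] at h2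
  nlinarith

/-- The defect caused by the mismatch of the two homogeneities: comparing `J q` with the multiple
`(1 + κ θ) ^ (p - 1)` which is adapted to `J p` costs an error of order `κ J q`, and it occurs only
if the increment `h` is at most a fixed multiple of `t`. -/
lemma J_increment_mismatch {p q : ℝ} (hq : 1 < q) (hqp : q < p) :
    ∃ c C Λ : ℝ, 0 < c ∧ 0 < C ∧ 1 ≤ Λ ∧ ∀ κ θ t h : ℝ, 0 < κ → κ ≤ 1 → 0 ≤ θ → θ ≤ 1 →
    0 ≤ t → 0 ≤ h →
    ((1 + κ * θ) ^ (p - 1) - 1) * J q t + c * κ * ((t + κ * h) ^ (q - 2) * h) ≤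
      J q ((1 + κ * θ) * t + κ * h) - J q t + (if h ≤ Λ * t then C * κ * t ^ (q - 1) else 0) := by
  obtain ⟨c, hc, H⟩ := J_increment hq
  set C := (2:ℝ) ^ p with hC
  have hC0 : 0 < C := by positivity
  set m := 1 / (q - 1) with hm
  have hm0 : 0 < m := by have : 0 < q - 1 := by linarith
                         positivity
  set Λ := (1 + 2 * C) ^ (m + 1) with hΛ
  have hΛ1 : 1 ≤ Λ := Real.one_le_rpow (by linarith) (by linarith)
  refine ⟨c / 2, C, Λ, by positivity, hC0, hΛ1, fun κ θ t h hκ hκ1 hθ hθ1 ht hh => ?_⟩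
  have h1 := (H κ θ t h hκ hκ1 hθ hθ1 ht hh).1
  have hκθ : 0 ≤ κ * θ := by positivity
  have hη : (1 + κ * θ) ^ (p - 1) ≤ 1 + C * κ := by
    have := one_add_mul_rpow_le (c := θ) (m := p - 1) hθ (by linarith) hκ.le hκ1
    rw [mul_comm θ κ] at this
    have h2 : (1 + θ) ^ (p - 1 + 1) ≤ C := by
      rw [hC, sub_add_cancel]; exact Real.rpow_le_rpow (by linarith) (by linarith) (by linarith)
    nlinarith
  have hηq : 1 ≤ (1 + κ * θ) ^ (q - 1) := Real.one_le_rpow (by linarith) (by linarith)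
  have hJ : J q ((1 + κ * θ) * t) = (1 + κ * θ) ^ (q - 1) * J q t := J_mul hq (by linarith) ht
  have hJ0 := J_nonneg (r := q) ht
  have hb : 0 ≤ c * κ * ((t + κ * h) ^ (q - 2) * h) := by positivity
  split_ifs with hcase
  · rw [← J_of_nonneg hq ht]
    nlinarith [mul_le_mul_of_nonneg_right hη hJ0, mul_le_mul_of_nonneg_right hηq hJ0]
  · -- here `κ h` is so large that the increment of `J q` alone pays for the mismatch
    have h3 : (1 + 2 * C * κ) * J q t ≤ J q ((1 + κ * θ) * t + κ * h) := by
      have h4 : (1 + 2 * C * κ) ≤ (1 + Λ * κ) ^ (q - 1) := by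
        have := one_add_mul_rpow_le (c := 2 * C) (m := m) (by positivity) hm0.le hκ.le hκ1
        calc 1 + 2 * C * κ = ((1 + 2 * C * κ) ^ m) ^ (q - 1) := by
              rw [← Real.rpow_mul (by positivity), hm, one_div,
                inv_mul_cancel₀ (by linarith), Real.rpow_one]
          _ ≤ _ := Real.rpow_le_rpow (by positivity) this (by linarith)
      calc (1 + 2 * C * κ) * J q t ≤ (1 + Λ * κ) ^ (q - 1) * J q t := by gcongr
        _ = J q ((1 + Λ * κ) * t) := (J_mul hq (by positivity) ht).symm
        _ ≤ _ := J_monotone hq (by nlinarith [mul_nonneg hκθ ht])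
    rw [hJ] at h1
    nlinarith [mul_le_mul_of_nonneg_right hη hJ0, mul_le_mul_of_nonneg_right hηq hJ0]

/-- The flux `t ^ (r - 1) * h` is controlled by the coercive weight unless `h` is much smaller
than `t`. -/
lemma flux_le_weight {r κ t h : ℝ} (hr : 1 < r) (hκ : 0 < κ) (hκ1 : κ ≤ 1) (ht : 0 ≤ t)
    (hh : 0 < h) : t ^ (r - 1) * h ≤ (1 + t / h) * ((t + κ * h) ^ (r - 2) * h ^ 2) := by
  rcases ht.eq_or_lt with rfl | ht
  · rw [Real.zero_rpow (by linarith)]; simp; positivity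
  have hkh : 0 < κ * h := by positivity
  have e1 : t ^ (r - 1) = t ^ (r - 2) * t := by
    nth_rewrite 3 [← Real.rpow_one t]
    rw [← Real.rpow_add ht]; ring_nf
  have e2 : (1 + t / h) * ((t + κ * h) ^ (r - 2) * h ^ 2) =
      (t + κ * h) ^ (r - 2) * (h + t) * h := by field_simp
  rw [e2]
  gcongr
  rcases le_total 2 r with h2 | h2
  · rw [e1]
    gcongr
    · linarith
    · linarith
  · have h3 : (t + h) ^ (r - 2) ≤ (t + κ * h) ^ (r - 2) :=
      Real.rpow_le_rpow_of_nonpos (by positivity) (by nlinarith) (by linarith)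
    calc t ^ (r - 1) ≤ (t + h) ^ (r - 1) := Real.rpow_le_rpow ht.le (by linarith) (by linarith)
      _ = (t + h) ^ (r - 2) * (h + t) := by
        rw [add_comm h t]
        nth_rewrite 3 [← Real.rpow_one (t + h)]
        rw [← Real.rpow_add (by positivity)]; ring_nf
      _ ≤ _ := by gcongr

/-- On bounded sets, decrements of fixed size of the argument decrease `J r` by a fixed amount. -/
lemma J_gap {r : ℝ} (hr : 1 < r) (M s : ℝ) (hs : 0 < s) :
    ∃ γ : ℝ, 0 < γ ∧ ∀ a : ℝ, |a| ≤ M → γ ≤ J r a - J r (a - s) := by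
  obtain ⟨c, hc, H⟩ := J_sub_ge hr
  have hM : 0 < 2 * |M| + s := by positivity
  refine ⟨c * min (s ^ (r - 2)) ((2 * |M| + s) ^ (r - 2)) * s,
    by have := lt_min (Real.rpow_pos_of_pos hs (r - 2)) (Real.rpow_pos_of_pos hM (r - 2))
       positivity, fun a ha => ?_⟩
  have h1 := H a (a - s) (by linarith)
  rw [sub_sub_cancel] at h1
  refine le_trans ?_ h1
  gcongr
  have hM' := ha.trans (le_abs_self M)
  have h2 : |a - s| ≤ |a| + s := by
    have := abs_sub a s; rwa [abs_of_pos hs] at this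
  have h3 : s ≤ |a| + |a - s| := by
    have := abs_sub a (a - s); rwa [sub_sub_cancel, abs_of_pos hs] at this
  rcases le_total 2 r with h | h
  · exact (min_le_left _ _).trans (Real.rpow_le_rpow hs.le h3 (by linarith))
  · exact (min_le_right _ _).trans
      (Real.rpow_le_rpow_of_nonpos (by linarith) (by linarith) (by linarith))

/-- The exponent gained when the `q`-energy is interpolated by the `p`-energy. -/
noncomputable def gapExp (s₁ s₂ p q : ℝ) : ℝ := q * p * (s₁ - s₂) / (p - q)

/-- Since `s₂ < s₁` and `q < p`, the `q`-energy density is an arbitrarily small multiple of the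
`p`-energy density, up to an integrable kernel. -/
lemma energy_interpolation {n s₁ s₂ p q : ℝ} (hq : 1 < q) (hqp : q < p) {ε t ℓ : ℝ}
    (hε : 0 < ε) (ht : 0 ≤ t) (hℓ : 0 < ℓ) :
    t ^ q / ℓ ^ (n + s₂ * q) ≤ ε * (t ^ p / ℓ ^ (n + s₁ * p)) +
      ε ^ (-(q / (p - q))) * ℓ ^ (gapExp s₁ s₂ p q - n) := by
  have hpq : 0 < p - q := by linarith
  rcases ht.eq_or_lt with rfl | ht
  · rw [Real.zero_rpow (by linarith), Real.zero_rpow (by linarith)]; simp; positivity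
  by_cases h : ε⁻¹ * ℓ ^ (s₁ * p - s₂ * q) ≤ t ^ (p - q)
  · refine le_trans ?_ (le_add_of_nonneg_right (by positivity))
    have e1 : t ^ p = t ^ q * t ^ (p - q) := by rw [← Real.rpow_add ht]; ring_nf
    have e2 : ℓ ^ (n + s₁ * p) = ℓ ^ (n + s₂ * q) * ℓ ^ (s₁ * p - s₂ * q) := by
      rw [← Real.rpow_add hℓ]; ring_nf
    rw [e1, e2]
    have h3 : 0 < ℓ ^ (s₁ * p - s₂ * q) := by positivity
    have h4 : ℓ ^ (s₁ * p - s₂ * q) ≤ ε * t ^ (p - q) := by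
      rwa [inv_mul_le_iff₀ hε] at h
    rw [← mul_div_assoc, div_le_div_iff₀ (by positivity) (by positivity)]
    have h5 : 0 < t ^ q * ℓ ^ (n + s₂ * q) := by positivity
    nlinarith [mul_le_mul_of_nonneg_left h4 h5.le]
  · refine le_trans ?_ (le_add_of_nonneg_left (by positivity))
    push Not at h
    have h1 : t ^ q ≤ (ε⁻¹ * ℓ ^ (s₁ * p - s₂ * q)) ^ (q / (p - q)) := by
      calc t ^ q = (t ^ (p - q)) ^ (q / (p - q)) := by
            rw [← Real.rpow_mul ht.le]; congr 1; field_simp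
        _ ≤ _ := Real.rpow_le_rpow (by positivity) h.le (by positivity)
    rw [Real.mul_rpow (by positivity) (by positivity), Real.inv_rpow hε.le, ← Real.rpow_neg hε.le,
      ← Real.rpow_mul hℓ.le] at h1
    rw [div_le_iff₀ (by positivity), mul_assoc, ← Real.rpow_add hℓ]
    have e : gapExp s₁ s₂ p q - n + (n + s₂ * q) = (s₁ * p - s₂ * q) * (q / (p - q)) := by
      unfold gapExp
      field_simp
      ring
    rwa [e]

/-! ### Kernel integrals and double integrals -/

/-- The Euclidean space on which all functions live. -/
abbrev Eu (N : ℕ) := EuclideanSpace ℝ (Fin N)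

lemma nontrivial_Eu {N : ℕ} (hN : 1 ≤ N) : Nontrivial (Eu N) := by
  have : Nonempty (Fin N) := ⟨⟨0, hN⟩⟩
  infer_instance

lemma lintegral_norm_rpow_near {N : ℕ} (hN : 1 ≤ N) {e : ℝ} (he : 0 < e) (R : ℝ) :
    ∫⁻ x : Eu N, ENNReal.ofReal (if ‖x‖ ≤ R then ‖x‖ ^ (e - N) else 0) < ⊤ := by
  have := nontrivial_Eu hN
  set f : ℝ → ℝ := fun y => if y ≤ R then y ^ (e - N) else 0 with hf
  have hI : Integrable (fun x : Eu N => f ‖x‖) := by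
    rw [integrable_fun_norm_addHaar volume (f := f), finrank_euclideanSpace, Fintype.card_fin]
    have h1 : IntegrableOn (fun y : ℝ => y ^ (e - 1)) (Ioc 0 (max R 0)) := by
      have := intervalIntegral.intervalIntegrable_rpow' (a := 0) (b := max R 0) (r := e - 1)
        (by linarith)
      rwa [intervalIntegrable_iff_integrableOn_Ioc_of_le (le_max_right _ _)] at this
    have h2 : IntegrableOn ((Ioc 0 (max R 0)).indicator fun y : ℝ => y ^ (e - 1)) (Ioi 0) :=
      ((integrable_indicator_iff measurableSet_Ioc).2 h1).integrableOn
    refine h2.congr_fun (fun y hy => ?_) measurableSet_Ioi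
    have hy : 0 < y := hy
    simp only [hf, smul_eq_mul, indicator, mem_Ioc]
    by_cases hyR : y ≤ R
    · rw [if_pos ⟨hy, hyR.trans (le_max_left _ _)⟩, if_pos hyR, ← Real.rpow_natCast, ←
        Real.rpow_add hy, Nat.cast_sub hN]
      congr 1; push_cast; ring
    · have : ¬ (0 < y ∧ y ≤ max R 0) := fun h => by
        rcases le_max_iff.1 h.2 with h' | h'
        · exact hyR h'
        · linarith
      rw [if_neg this, if_neg hyR, mul_zero]
  exact hI.lintegral_lt_top

lemma lintegral_norm_rpow_far {N : ℕ} (hN : 1 ≤ N) {e : ℝ} (he : 0 < e) :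
    ∃ C : ℝ, 0 < C ∧ ∀ ρ : ℝ, 0 < ρ →
      ∫⁻ x : Eu N, ENNReal.ofReal (if ρ < ‖x‖ then ‖x‖ ^ (-e - N) else 0) ≤
        ENNReal.ofReal (C * ρ ^ (-e)) := by
  have := nontrivial_Eu hN
  refine ⟨N * volume.real (Metric.ball (0 : Eu N) 1) * e⁻¹ + 1, by positivity, fun ρ hρ => ?_⟩
  set f : ℝ → ℝ := fun y => if ρ < y then y ^ (-e - N) else 0 with hf
  have hfun : ∀ y ∈ Ioi (0:ℝ), ((Ioi ρ).indicator fun y : ℝ => y ^ (-e - 1)) y =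
      y ^ (N - 1) • f y := fun y hy => by
    have hy : 0 < y := hy
    simp only [hf, smul_eq_mul, indicator, mem_Ioi]
    by_cases hyR : ρ < y
    · rw [if_pos hyR, if_pos hyR, ← Real.rpow_natCast, ← Real.rpow_add hy, Nat.cast_sub hN]
      congr 1; push_cast; ring
    · rw [if_neg hyR, if_neg hyR, mul_zero]
  have h1 : IntegrableOn (fun y : ℝ => y ^ (-e - 1)) (Ioi ρ) :=
    integrableOn_Ioi_rpow_of_lt (by linarith) hρ
  have hI : Integrable (fun x : Eu N => f ‖x‖) := by
    rw [integrable_fun_norm_addHaar volume (f := f), finrank_euclideanSpace, Fintype.card_fin]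
    have h2 : IntegrableOn ((Ioi ρ).indicator fun y : ℝ => y ^ (-e - 1)) (Ioi 0) :=
      ((integrable_indicator_iff measurableSet_Ioi).2 h1).integrableOn
    exact h2.congr_fun hfun measurableSet_Ioi
  have hval : ∫ x : Eu N, f ‖x‖ = N * volume.real (Metric.ball (0 : Eu N) 1) * (e⁻¹ * ρ ^ (-e)) := by
    rw [integral_fun_norm_addHaar volume f, finrank_euclideanSpace, Fintype.card_fin,
      ← setIntegral_congr_fun measurableSet_Ioi hfun, setIntegral_indicator measurableSet_Ioi,
      Ioi_inter_Ioi, max_eq_right hρ.le, integral_Ioi_rpow_of_lt (by linarith) hρ]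
    simp only [nsmul_eq_mul, smul_eq_mul]
    rw [mul_assoc]
    congr 2
    rw [show -e - 1 + 1 = -e by ring]
    field_simp
  have h0 : ∀ x : Eu N, 0 ≤ f ‖x‖ := fun x => by simp only [hf]; split_ifs <;> positivity
  calc ∫⁻ x : Eu N, ENNReal.ofReal (if ρ < ‖x‖ then ‖x‖ ^ (-e - N) else 0)
      = ENNReal.ofReal (∫ x : Eu N, f ‖x‖) :=
        (ofReal_integral_eq_lintegral_ofReal hI (.of_forall h0)).symm
    _ ≤ _ := by
        rw [hval]
        apply ENNReal.ofReal_le_ofReal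
        have : 0 < ρ ^ (-e) := by positivity
        nlinarith

open Classical in
/-- Fubini for a kernel which depends on the difference of the variables: if the integral of the
kernel around `y ∈ S` is at most `w y`, the double integral of `f y * k (x - y)` over `y ∈ S` is at
most the integral of `f * w` over `S`. -/
lemma lintegral_prod_kernel_le {N : ℕ} {S : Set (Eu N)} (hS : MeasurableSet S) {f : Eu N → ℝ}
    (hf : Measurable f) (hf0 : ∀ y, 0 ≤ f y) {k : Eu N → Eu N → ℝ}
    (hk : Measurable fun z : Eu N × Eu N => k z.2 (z.1 - z.2)) {w : Eu N → ℝ}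
    (hw : ∀ y ∈ S, ∫⁻ x, ENNReal.ofReal (k y x) ≤ ENNReal.ofReal (w y)) :
    ∫⁻ z : Eu N × Eu N, ENNReal.ofReal (if z.2 ∈ S then f z.2 * k z.2 (z.1 - z.2) else 0) ≤
      ∫⁻ y in S, ENNReal.ofReal (f y * w y) := by
  have hm : Measurable fun z : Eu N × Eu N =>
      ENNReal.ofReal (if z.2 ∈ S then f z.2 * k z.2 (z.1 - z.2) else 0) :=
    (Measurable.ite (measurable_snd hS) ((hf.comp measurable_snd).mul hk)
      measurable_const).ennreal_ofReal
  rw [← lintegral_indicator hS]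
  change ∫⁻ z, _ ∂(volume.prod volume) ≤ _
  rw [lintegral_prod_symm _ hm.aemeasurable]
  refine lintegral_mono fun y => ?_
  by_cases hy : y ∈ S
  · simp only [hy, if_true, indicator_of_mem]
    simp_rw [ENNReal.ofReal_mul (hf0 y)]
    rw [lintegral_const_mul' _ _ ENNReal.ofReal_ne_top]
    gcongr
    rw [lintegral_sub_right_eq_self (fun x => ENNReal.ofReal (k y x)) y]
    exact hw y hy
  · simp [hy]

/-- Passing from an integrated identity to an estimate between nonnegative integrals. -/
lemma lintegral_le_of_le_add {α : Type*} [MeasurableSpace α] {μ : Measure α} {W X Y : α → ℝ}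
    (hX : Integrable X μ) (hY : ∀ z, 0 ≤ Y z) (h : ∀ z, W z ≤ X z + Y z) (hW : ∀ z, 0 ≤ W z) :
    ∫⁻ z, ENNReal.ofReal (W z) ∂μ ≤
      ENNReal.ofReal (∫ z, X z ∂μ) + ∫⁻ z, ENNReal.ofReal (Y z) ∂μ := by
  have hXm := hX.aestronglyMeasurable.aemeasurable
  have hnm : AEMeasurable (fun z => -X z) μ := hXm.neg
  have hneg : ∫⁻ z, ENNReal.ofReal (-X z) ∂μ ≠ ⊤ := (hX.neg.lintegral_lt_top).ne
  have hpos : ∫⁻ z, ENNReal.ofReal (X z) ∂μ ≠ ⊤ := (hX.lintegral_lt_top).ne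
  have h1 : ∫⁻ z, ENNReal.ofReal (W z) ∂μ + ∫⁻ z, ENNReal.ofReal (-X z) ∂μ ≤
      ∫⁻ z, ENNReal.ofReal (X z) ∂μ + ∫⁻ z, ENNReal.ofReal (Y z) ∂μ := by
    rw [← lintegral_add_right' _ hnm.ennreal_ofReal, ← lintegral_add_left' hXm.ennreal_ofReal]
    refine lintegral_mono fun z => ?_
    rcases le_total 0 (X z) with hx | hx
    · rw [ENNReal.ofReal_of_nonpos (p := -X z) (by linarith), add_zero,
        ← ENNReal.ofReal_add hx (hY z)]
      exact ENNReal.ofReal_le_ofReal (h z)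
    · rw [ENNReal.ofReal_of_nonpos (p := X z) hx, zero_add,
        ← ENNReal.ofReal_add (hW z) (by linarith)]
      exact ENNReal.ofReal_le_ofReal (by linarith [h z])
  rw [integral_eq_lintegral_pos_part_sub_lintegral_neg_part hX]
  set P := ∫⁻ z, ENNReal.ofReal (X z) ∂μ
  set n := ∫⁻ z, ENNReal.ofReal (-X z) ∂μ
  have h2 : ENNReal.ofReal (P.toReal - n.toReal) = P - n := by
    rw [ENNReal.ofReal_sub _ ENNReal.toReal_nonneg, ENNReal.ofReal_toReal hpos,
      ENNReal.ofReal_toReal hneg]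
  rw [h2]
  have h3 : ∫⁻ z, ENNReal.ofReal (W z) ∂μ ≤ P + ∫⁻ z, ENNReal.ofReal (Y z) ∂μ - n :=
    ENNReal.le_sub_of_add_le_right hneg h1
  refine h3.trans ?_
  rw [tsub_le_iff_right]
  calc P + ∫⁻ z, ENNReal.ofReal (Y z) ∂μ ≤ (P - n + n) + ∫⁻ z, ENNReal.ofReal (Y z) ∂μ := by
        gcongr; exact le_tsub_add
    _ = _ := by ring

/-! ### The set-up -/

/-- The data of the comparison problem, in the form in which the iteration uses them: bounded
functions `0 ≤ u ≤ v` which vanish outside a bounded set `Ω`, a weight `ρ` playing the role of the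
distance to the boundary, and the levels `θ j * u - τ j` with which `(v - u) / κ` is compared. -/
structure Config (N : ℕ) where
  (s₁ s₂ p q : ℝ)
  (Ω B : Set (Eu N))
  (ρ u v : Eu N → ℝ)
  (θ τ : ℕ → ℝ)
  (C₀ c₀ M R b ε₀ L : ℝ)
  hN : 1 ≤ N
  hs₂ : 0 < s₂
  hs : s₂ < s₁
  hs₁ : s₁ < 1
  hq : 1 < q
  hqp : q < p
  measurable_Ω : MeasurableSet Ω
  volume_Ω : volume Ω < ⊤
  hR : 1 ≤ R
  diam_le : ∀ x ∈ Ω, ∀ y ∈ Ω, ‖x - y‖ ≤ R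
  measurable_ρ : Measurable ρ
  ρ_nonneg : ∀ x, 0 ≤ ρ x
  ρ_lip : ∀ x y, ρ x ≤ ρ y + ‖x - y‖
  /-- every point of `Ω` has a nearest zero of the weight -/
  ρ_proj : ∀ y ∈ Ω, ∃ z, ‖y - z‖ ≤ ρ y ∧ ρ z = 0
  measurable_u : Measurable u
  measurable_v : Measurable v
  u_nonneg : ∀ x, 0 ≤ u x
  u_le_v : ∀ x, u x ≤ v x
  hM : 1 ≤ M
  v_le : ∀ x, v x ≤ M
  u_zero : ∀ x ∉ Ω, u x = 0
  v_zero : ∀ x ∉ Ω, v x = 0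
  hC₀ : 1 ≤ C₀
  u_le : ∀ x, u x ≤ C₀ * ρ x ^ s₁
  u_energy : Integrable fun z : Eu N × Eu N =>
    |u z.1 - u z.2| ^ p / ‖z.1 - z.2‖ ^ ((N : ℝ) + s₁ * p)
  v_energy : Integrable fun z : Eu N × Eu N =>
    |v z.1 - v z.2| ^ p / ‖z.1 - z.2‖ ^ ((N : ℝ) + s₁ * p)
  hL : 0 < L
  /-- `u` is a subsolution with bounded right-hand side -/
  u_sub : ∀ φ, MemW0 Ω s₁ p φ → (∀ x, 0 ≤ φ x) → A s₁ p u φ + A s₂ q u φ ≤ L * ∫ x in Ω, φ x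
  /-- tested where `v - u` is small, the operators at `u` and `v` are almost ordered -/
  u_v : ∀ ω > 0, ∃ δ > 0, ∀ φ, MemW0 Ω s₁ p φ → (∀ x, 0 ≤ φ x) →
    (∀ x ∈ Ω, δ < v x - u x → φ x = 0) →
    A s₁ p u φ + A s₂ q u φ ≤ A s₁ p v φ + A s₂ q v φ + ω * ∫ x in Ω, φ x
  measurable_B : MeasurableSet B
  B_sub : B ⊆ Ω
  volume_B : 0 < volume B
  hε₀ : 0 < ε₀
  /-- `v - u` is bounded below on a set of positive measure -/
  B_gap : ∀ x ∈ B, ε₀ ≤ v x - u x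
  θ_nonneg : ∀ j, 0 ≤ θ j
  θ_le : ∀ j, θ j ≤ 1
  θ_anti : ∀ j, θ (j + 1) ≤ θ j
  τ_nonneg : ∀ j, 0 ≤ τ j
  τ_mono : ∀ j, τ j ≤ τ (j + 1)
  hb : 0 < b
  hb1 : b ≤ 1
  /-- where the lower level is positive, the two levels differ by a multiple of `u` which decays
  only geometrically in `j` -/
  level_gap : ∀ j x, 0 < θ (j + 1) * u x - τ (j + 1) →
    b * (1 / 2) ^ j * u x ≤ (θ j * u x - τ j) - (θ (j + 1) * u x - τ (j + 1))
  hc₀ : 0 < c₀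
  hc₀1 : c₀ ≤ 1
  /-- `u` is comparable with `ρ ^ s₁` where the highest level is positive -/
  le_u : ∀ x, 0 < θ 0 * u x - τ 0 → c₀ * ρ x ^ s₁ ≤ u x

namespace Config

variable {N : ℕ} (X : Config N)

lemma hp : 1 < X.p := X.hq.trans X.hqp
lemma s₁_pos : 0 < X.s₁ := X.hs₂.trans X.hs

/-- The denominator of order `s₁`, exponent `p`. -/
noncomputable def K₁ (z : Eu N × Eu N) : ℝ := ‖z.1 - z.2‖ ^ ((N : ℝ) + X.s₁ * X.p)

/-- The denominator of order `s₂`, exponent `q`. -/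
noncomputable def K₂ (z : Eu N × Eu N) : ℝ := ‖z.1 - z.2‖ ^ ((N : ℝ) + X.s₂ * X.q)

lemma K₁_nonneg (z : Eu N × Eu N) : 0 ≤ X.K₁ z := by unfold K₁; positivity
lemma K₂_nonneg (z : Eu N × Eu N) : 0 ≤ X.K₂ z := by unfold K₂; positivity

lemma K₁_swap (z : Eu N × Eu N) : X.K₁ z.swap = X.K₁ z := by
  simp [K₁, norm_sub_rev]
lemma K₂_swap (z : Eu N × Eu N) : X.K₂ z.swap = X.K₂ z := by
  simp [K₂, norm_sub_rev]

lemma measurable_K₁ : Measurable X.K₁ := by unfold K₁; fun_prop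
lemma measurable_K₂ : Measurable X.K₂ := by unfold K₂; fun_prop

/-- Bounded functions of finite energy vanishing outside `Ω`. -/
structure Nice (w : Eu N → ℝ) : Prop where
  measurable : Measurable w
  bdd : ∃ C, ∀ x, |w x| ≤ C
  zero : ∀ x ∉ X.Ω, w x = 0
  energy : Integrable fun z : Eu N × Eu N => |w z.1 - w z.2| ^ X.p / X.K₁ z

variable {X}

lemma nice_u : X.Nice X.u where
  measurable := X.measurable_u
  bdd := ⟨X.M, fun x => by
    rw [abs_of_nonneg (X.u_nonneg x)]; exact (X.u_le_v x).trans (X.v_le x)⟩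
  zero := X.u_zero
  energy := X.u_energy

lemma nice_v : X.Nice X.v where
  measurable := X.measurable_v
  bdd := ⟨X.M, fun x => by
    rw [abs_of_nonneg ((X.u_nonneg x).trans (X.u_le_v x))]; exact X.v_le x⟩
  zero := X.v_zero
  energy := X.v_energy

open Classical in
lemma lintegral_indicator_kernel_lt_top {S : Set (Eu N)} (hS : MeasurableSet S)
    (hS' : volume S < ⊤) {k : Eu N → ℝ} (hk : Measurable k)
    (hk' : ∫⁻ x, ENNReal.ofReal (k x) < ⊤) :
    ∫⁻ z : Eu N × Eu N, ENNReal.ofReal (if z.2 ∈ S then k (z.1 - z.2) else 0) < ⊤ ∧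
    ∫⁻ z : Eu N × Eu N, ENNReal.ofReal (if z.1 ∈ S then k (z.1 - z.2) else 0) < ⊤ := by
  have h1 : ∀ k : Eu N → ℝ, Measurable k → ∫⁻ x, ENNReal.ofReal (k x) < ⊤ →
      ∫⁻ z : Eu N × Eu N, ENNReal.ofReal (if z.2 ∈ S then k (z.1 - z.2) else 0) < ⊤ := by
    intro k hk hk'
    have := lintegral_prod_kernel_le hS (f := fun _ => 1) measurable_const (fun _ => zero_le_one)
      (k := fun _ x => k x) (hk.comp (measurable_fst.sub measurable_snd))
      (w := fun _ => (∫⁻ x, ENNReal.ofReal (k x)).toReal)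
      (fun y _ => by rw [ENNReal.ofReal_toReal hk'.ne])
    simp only [one_mul] at this
    refine this.trans_lt ?_
    rw [lintegral_const, Measure.restrict_apply_univ]
    exact ENNReal.mul_lt_top ENNReal.ofReal_lt_top hS'
  refine ⟨h1 k hk hk', ?_⟩
  have h2 := h1 (fun x => k (-x)) (hk.comp measurable_neg)
    (by rwa [lintegral_neg_eq_self (fun x => ENNReal.ofReal (k x))])
  rw [Measure.volume_eq_prod] at h2 ⊢
  rw [← lintegral_prod_swap]
  simpa using h2

lemma gapExp_pos : 0 < gapExp X.s₁ X.s₂ X.p X.q := by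
  unfold gapExp
  have := X.hs; have := X.hq; have := X.hp; have := X.hqp
  have h1 : 0 < X.s₁ - X.s₂ := by linarith
  have h2 : 0 < X.p - X.q := by linarith
  positivity

open Classical in
lemma Nice.energy_q {w : Eu N → ℝ} (hw : X.Nice w) :
    Integrable fun z : Eu N × Eu N => |w z.1 - w z.2| ^ X.q / X.K₂ z := by
  obtain ⟨C, hC⟩ := hw.bdd
  have hC0 : 0 ≤ C := (abs_nonneg _).trans (hC 0)
  have hq := X.hq
  have hwm := hw.measurable
  have hm : Measurable fun z : Eu N × Eu N => |w z.1 - w z.2| ^ X.q / X.K₂ z := by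
    have := X.measurable_K₂
    fun_prop
  set σ := gapExp X.s₁ X.s₂ X.p X.q
  set k : Eu N → ℝ := fun x => (if ‖x‖ ≤ 1 then ‖x‖ ^ (σ - N) else 0) +
    (2 * C) ^ X.q * (if 1 < ‖x‖ then ‖x‖ ^ (-(X.s₂ * X.q) - N) else 0) with hk
  have hkm : Measurable k := by
    refine Measurable.add (Measurable.ite ?_ (by fun_prop) measurable_const)
      (measurable_const.mul (Measurable.ite ?_ (by fun_prop) measurable_const))
    · exact measurableSet_le measurable_norm measurable_const
    · exact measurableSet_lt measurable_const measurable_norm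
  have hk0 : ∀ x, 0 ≤ k x := fun x => by
    simp only [hk]; split_ifs <;> positivity
  have hsq : 0 < X.s₂ * X.q := mul_pos X.hs₂ (by linarith)
  have hkint : ∫⁻ x, ENNReal.ofReal (k x) < ⊤ := by
    obtain ⟨C', hC', hfar⟩ := lintegral_norm_rpow_far X.hN hsq
    have h1 := lintegral_norm_rpow_near X.hN (gapExp_pos (X := X)) 1
    calc ∫⁻ x, ENNReal.ofReal (k x)
        ≤ ∫⁻ x : Eu N, (ENNReal.ofReal (if ‖x‖ ≤ 1 then ‖x‖ ^ (σ - N) else 0) +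
          ENNReal.ofReal ((2 * C) ^ X.q) *
            ENNReal.ofReal (if 1 < ‖x‖ then ‖x‖ ^ (-(X.s₂ * X.q) - N) else 0)) := by
          refine lintegral_mono fun x => ?_
          rw [← ENNReal.ofReal_mul (by positivity)]
          exact ENNReal.ofReal_add_le
      _ < ⊤ := by
          rw [lintegral_add_left, lintegral_const_mul' _ _ ENNReal.ofReal_ne_top]
          · refine ENNReal.add_lt_top.2 ⟨h1, ENNReal.mul_lt_top ENNReal.ofReal_lt_top ?_⟩
            exact (hfar 1 one_pos).trans_lt ENNReal.ofReal_lt_top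
          · refine (Measurable.ite ?_ (by fun_prop) measurable_const).ennreal_ofReal
            exact measurableSet_le measurable_norm measurable_const
  obtain ⟨i1, i2⟩ := lintegral_indicator_kernel_lt_top X.measurable_Ω X.volume_Ω hkm hkint
  have pw : ∀ z : Eu N × Eu N, |w z.1 - w z.2| ^ X.q / X.K₂ z ≤ |w z.1 - w z.2| ^ X.p / X.K₁ z +
      ((if z.2 ∈ X.Ω then k (z.1 - z.2) else 0) + (if z.1 ∈ X.Ω then k (z.1 - z.2) else 0)) := by
    intro z
    have hp0 : 0 ≤ |w z.1 - w z.2| ^ X.p / X.K₁ z := div_nonneg (by positivity) (X.K₁_nonneg z)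
    have hi : ∀ P : Prop, [Decidable P] → 0 ≤ if P then k (z.1 - z.2) else 0 := fun P _ => by
      split_ifs; exacts [hk0 _, le_rfl]
    by_cases hz : z.1 ∈ X.Ω ∨ z.2 ∈ X.Ω
    · have hk1 : k (z.1 - z.2) ≤ (if z.2 ∈ X.Ω then k (z.1 - z.2) else 0) +
          (if z.1 ∈ X.Ω then k (z.1 - z.2) else 0) := by
        rcases hz with h | h
        · rw [if_pos h]; linarith [hi (z.2 ∈ X.Ω)]
        · rw [if_pos h]; linarith [hi (z.1 ∈ X.Ω)]
      rcases (norm_nonneg (z.1 - z.2)).eq_or_lt with h0 | h0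
      · have : z.1 = z.2 := by rw [← sub_eq_zero, ← norm_eq_zero]; exact h0.symm
        have : |w z.1 - w z.2| ^ X.q / X.K₂ z = 0 := by
          rw [this, sub_self, abs_zero, Real.zero_rpow (by linarith), zero_div]
        rw [this]
        linarith [hk0 (z.1 - z.2)]
      · by_cases h1 : ‖z.1 - z.2‖ ≤ 1
        · have := energy_interpolation (n := N) (s₁ := X.s₁) (s₂ := X.s₂) X.hq X.hqp one_pos
            (abs_nonneg (w z.1 - w z.2)) h0
          rw [Real.one_rpow, one_mul, one_mul] at this
          have hk2 : k (z.1 - z.2) = ‖z.1 - z.2‖ ^ (σ - N) := by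
            simp only [hk]; rw [if_pos h1, if_neg (by linarith)]; ring
          rw [show gapExp X.s₁ X.s₂ X.p X.q = σ from rfl, ← hk2] at this
          unfold K₁ K₂
          linarith
        · push Not at h1
          have hk2 : k (z.1 - z.2) = (2 * C) ^ X.q * ‖z.1 - z.2‖ ^ (-(X.s₂ * X.q) - N) := by
            simp only [hk]; rw [if_pos h1, if_neg (by linarith)]; ring
          have h2 : |w z.1 - w z.2| ≤ 2 * C := by
            have := abs_sub (w z.1) (w z.2)
            linarith [hC z.1, hC z.2]
          have : |w z.1 - w z.2| ^ X.q / X.K₂ z ≤ k (z.1 - z.2) := by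
            rw [hk2, show -(X.s₂ * X.q) - (N:ℝ) = -((N:ℝ) + X.s₂ * X.q) by ring,
              Real.rpow_neg h0.le, ← div_eq_mul_inv]
            unfold K₂
            gcongr
          linarith
    · push Not at hz
      have : |w z.1 - w z.2| ^ X.q / X.K₂ z = 0 := by
        rw [hw.zero _ hz.1, hw.zero _ hz.2, sub_self, abs_zero, Real.zero_rpow (by linarith),
          zero_div]
      rw [this]
      linarith [hi (z.1 ∈ X.Ω), hi (z.2 ∈ X.Ω)]
  refine ⟨hm.aestronglyMeasurable, ?_⟩
  rw [hasFiniteIntegral_iff_ofReal (.of_forall fun z => div_nonneg (by positivity)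
    (X.K₂_nonneg z))]
  have mk : Measurable fun z : Eu N × Eu N => z.1 - z.2 := measurable_fst.sub measurable_snd
  calc ∫⁻ z : Eu N × Eu N, ENNReal.ofReal (|w z.1 - w z.2| ^ X.q / X.K₂ z)
      ≤ ∫⁻ z : Eu N × Eu N, (ENNReal.ofReal (|w z.1 - w z.2| ^ X.p / X.K₁ z) +
        (ENNReal.ofReal (if z.2 ∈ X.Ω then k (z.1 - z.2) else 0) +
          ENNReal.ofReal (if z.1 ∈ X.Ω then k (z.1 - z.2) else 0))) := by
        refine lintegral_mono fun z => (ENNReal.ofReal_le_ofReal (pw z)).trans ?_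
        refine ENNReal.ofReal_add_le.trans ?_
        gcongr
        exact ENNReal.ofReal_add_le
    _ < ⊤ := by
        rw [lintegral_add_left, lintegral_add_left]
        · exact ENNReal.add_lt_top.2 ⟨hw.energy.lintegral_lt_top, ENNReal.add_lt_top.2 ⟨i1, i2⟩⟩
        · exact (Measurable.ite (measurable_snd X.measurable_Ω) (hkm.comp mk)
            measurable_const).ennreal_ofReal
        · have := X.measurable_K₁
          fun_prop

/-- Young's inequality in its crudest form. -/
lemma rpow_sub_one_mul_le {r a b : ℝ} (hr : 1 < r) (ha : 0 ≤ a) (hb : 0 ≤ b) :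
    a ^ (r - 1) * b ≤ a ^ r + b ^ r := by
  have split : ∀ x : ℝ, 0 ≤ x → x ^ r = x ^ (r - 1) * x := fun x hx => by
    have := Real.rpow_add_one' (y := r - 1) hx (by linarith)
    rwa [sub_add_cancel] at this
  rcases le_total a b with h | h
  · have : a ^ (r - 1) * b ≤ b ^ r := by
      rw [split b hb]; gcongr
    linarith [Real.rpow_nonneg ha r]
  · have : a ^ (r - 1) * b ≤ a ^ r := by
      rw [split a ha]; gcongr
    linarith [Real.rpow_nonneg hb r]

lemma integrable_flux {r : ℝ} (hr : 1 < r) {K : Eu N × Eu N → ℝ} (hK : Measurable K)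
    (hK0 : ∀ z, 0 ≤ K z) {w φ : Eu N → ℝ} (hw : Measurable w) (hφ : Measurable φ)
    (hwi : Integrable fun z : Eu N × Eu N => |w z.1 - w z.2| ^ r / K z)
    (hφi : Integrable fun z : Eu N × Eu N => |φ z.1 - φ z.2| ^ r / K z) :
    Integrable fun z : Eu N × Eu N => J r (w z.1 - w z.2) * (φ z.1 - φ z.2) / K z := by
  refine (hwi.add hφi).mono' ?_ (.of_forall fun z => ?_)
  · have := measurable_J r
    exact Measurable.aestronglyMeasurable (by fun_prop)
  · simp only [Pi.add_apply]
    rw [Real.norm_eq_abs, abs_div, abs_mul, abs_J hr, abs_of_nonneg (hK0 z), ← add_div]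
    exact div_le_div_of_nonneg_right
      (rpow_sub_one_mul_le hr (abs_nonneg _) (abs_nonneg _)) (hK0 z)

lemma Nice.integrable_p {w φ : Eu N → ℝ} (hw : X.Nice w) (hφ : X.Nice φ) :
    Integrable fun z : Eu N × Eu N => J X.p (w z.1 - w z.2) * (φ z.1 - φ z.2) / X.K₁ z :=
  integrable_flux X.hp X.measurable_K₁ X.K₁_nonneg hw.measurable hφ.measurable hw.energy hφ.energy

lemma Nice.integrable_q {w φ : Eu N → ℝ} (hw : X.Nice w) (hφ : X.Nice φ) :
    Integrable fun z : Eu N × Eu N => J X.q (w z.1 - w z.2) * (φ z.1 - φ z.2) / X.K₂ z :=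
  integrable_flux X.hq X.measurable_K₂ X.K₂_nonneg hw.measurable hφ.measurable hw.energy_q
    hφ.energy_q

lemma Nice.memW0 {w : Eu N → ℝ} (hw : X.Nice w) : MemW0 X.Ω X.s₁ X.p w where
  memLp := by
    have : IsFiniteMeasure (volume.restrict X.Ω) := ⟨by
      rw [Measure.restrict_apply_univ]; exact X.volume_Ω⟩
    obtain ⟨C, hC⟩ := hw.bdd
    exact MemLp.of_bound hw.measurable.aestronglyMeasurable C (.of_forall hC)
  seminorm_lt_top := hw.energy.lintegral_lt_top
  zero_outside := by
    filter_upwards [ae_restrict_mem X.measurable_Ω.compl] with x hx using hw.zero x hx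

/-- Lipschitz functions of `u` and `v` are admissible. -/
lemma nice_of_abs_sub_le {φ : Eu N → ℝ} (hm : Measurable φ) (hb : ∃ C, ∀ x, |φ x| ≤ C)
    (h0 : ∀ x ∉ X.Ω, φ x = 0) {C : ℝ}
    (h : ∀ x y, |φ x - φ y| ≤ C * max |X.u x - X.u y| |X.v x - X.v y|) : X.Nice φ where
  measurable := hm
  bdd := hb
  zero := h0
  energy := by
    have hp := X.hp
    have hK := X.measurable_K₁
    refine ((X.u_energy.add X.v_energy).const_mul (|C| ^ X.p)).mono'
      (Measurable.aestronglyMeasurable (by fun_prop)) (.of_forall fun z => ?_)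
    simp only [Pi.add_apply]
    rw [Real.norm_eq_abs, abs_of_nonneg (div_nonneg (by positivity) (X.K₁_nonneg z)), ← add_div,
      ← mul_div_assoc]
    refine div_le_div_of_nonneg_right ?_ (X.K₁_nonneg z)
    have hmax : 0 ≤ max |X.u z.1 - X.u z.2| |X.v z.1 - X.v z.2| :=
      (abs_nonneg _).trans (le_max_left _ _)
    calc |φ z.1 - φ z.2| ^ X.p
        ≤ (|C| * max |X.u z.1 - X.u z.2| |X.v z.1 - X.v z.2|) ^ X.p := by
          refine Real.rpow_le_rpow (abs_nonneg _) ((h _ _).trans ?_) (by linarith)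
          gcongr; exact le_abs_self C
      _ = |C| ^ X.p * (max |X.u z.1 - X.u z.2| |X.v z.1 - X.v z.2|) ^ X.p :=
          Real.mul_rpow (abs_nonneg _) hmax
      _ ≤ _ := by
          gcongr
          rcases max_cases |X.u z.1 - X.u z.2| |X.v z.1 - X.v z.2| with ⟨h, _⟩ | ⟨h, _⟩ <;> rw [h]
          · exact le_add_of_nonneg_right (by positivity)
          · exact le_add_of_nonneg_left (by positivity)


/-! ### Levels and pair densities -/

variable (X)

/-- The truncated difference between the `j`-th level and `(v - u) / κ`. -/
noncomputable def ψ (κ : ℝ) (j : ℕ) (x : Eu N) : ℝ :=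
  max (X.θ j * X.u x - X.τ j - (X.v x - X.u x) / κ) 0

/-- The set on which `(v - u) / κ` is below the `j`-th level. These sets decrease with `j`. -/
def S (κ : ℝ) (j : ℕ) : Set (Eu N) := {x | 0 < X.ψ κ j x}

/-- The increment of `u` over a pair of points. -/
def t (z : Eu N × Eu N) : ℝ := X.u z.1 - X.u z.2

/-- The drop of the truncation over a pair of points. -/
noncomputable def h (κ : ℝ) (j : ℕ) (z : Eu N × Eu N) : ℝ := X.ψ κ j z.2 - X.ψ κ j z.1

/-- The modulus of the flux of `u` over a pair of points. -/
noncomputable def flux (z : Eu N × Eu N) : ℝ :=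
  |X.t z| ^ (X.p - 1) / X.K₁ z + |X.t z| ^ (X.q - 1) / X.K₂ z

/-- The coercive density produced by the monotonicity of the operator. The argument of the powers
is `|t| + κ * |h|`, because the increments of `u` and `v` over the pair differ by a quantity of order
`κ * (|t| + |h|)`. -/
noncomputable def co (κ : ℝ) (j : ℕ) (z : Eu N × Eu N) : ℝ :=
  (|X.t z| + κ * |X.h κ j z|) ^ (X.p - 2) * |X.h κ j z| ^ 2 / X.K₁ z +
    (|X.t z| + κ * |X.h κ j z|) ^ (X.q - 2) * |X.h κ j z| ^ 2 / X.K₂ z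

open Classical in
/-- The energy density of `u` over the pairs whose upper point lies in the `j`-th set. -/
noncomputable def en (κ : ℝ) (j : ℕ) (z : Eu N × Eu N) : ℝ :=
  if 0 < X.t z ∧ z.1 ∈ X.S κ j then X.t z * X.flux z else 0

open Classical in
/-- The error density due to the mismatch of homogeneities: it lives on the pairs over which `u`
increases while the truncation decreases. -/
noncomputable def err (Λ κ : ℝ) (j : ℕ) (z : Eu N × Eu N) : ℝ :=
  if 0 < X.t z ∧ 0 < X.h κ j z ∧ X.h κ j z ≤ Λ * X.t z then
    X.t z ^ (X.q - 1) / X.K₂ z * X.h κ j z else 0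

variable {X} {κ : ℝ} {j : ℕ}

lemma ψ_nonneg (x : Eu N) : 0 ≤ X.ψ κ j x := le_max_right _ _

lemma ψ_eq_of_pos {x : Eu N} (hx : 0 < X.ψ κ j x) :
    X.ψ κ j x = X.θ j * X.u x - X.τ j - (X.v x - X.u x) / κ := by
  unfold ψ at *
  rcases max_choice (X.θ j * X.u x - X.τ j - (X.v x - X.u x) / κ) 0 with h | h
  · exact h
  · rw [h] at hx; exact absurd hx (lt_irrefl _)

lemma le_ψ (x : Eu N) : X.θ j * X.u x - X.τ j - (X.v x - X.u x) / κ ≤ X.ψ κ j x := le_max_left _ _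

lemma d_nonneg (x : Eu N) : 0 ≤ X.v x - X.u x := sub_nonneg.2 (X.u_le_v x)

lemma u_le_M (x : Eu N) : X.u x ≤ X.M := (X.u_le_v x).trans (X.v_le x)

lemma ψ_le_u (hκ : 0 < κ) (x : Eu N) : X.ψ κ j x ≤ X.u x := by
  refine max_le ?_ (X.u_nonneg x)
  have h1 : 0 ≤ (X.v x - X.u x) / κ := div_nonneg (d_nonneg x) hκ.le
  have h2 := X.τ_nonneg j
  have h3 := mul_le_mul_of_nonneg_right (X.θ_le j) (X.u_nonneg x)
  linarith

lemma ψ_le_M (hκ : 0 < κ) (x : Eu N) : X.ψ κ j x ≤ X.M := (ψ_le_u hκ x).trans (u_le_M x)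

lemma ψ_zero (hκ : 0 < κ) {x : Eu N} (hx : x ∉ X.Ω) : X.ψ κ j x = 0 :=
  le_antisymm ((ψ_le_u hκ x).trans (X.u_zero x hx).le) (ψ_nonneg x)

lemma ψ_succ_le (x : Eu N) : X.ψ κ (j + 1) x ≤ X.ψ κ j x := by
  unfold ψ
  refine max_le_max ?_ le_rfl
  have h1 := mul_le_mul_of_nonneg_right (X.θ_anti j) (X.u_nonneg x)
  linarith [X.τ_mono j]

lemma S_succ_subset : X.S κ (j + 1) ⊆ X.S κ j := fun x hx => lt_of_lt_of_le hx (ψ_succ_le x)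

lemma S_subset_zero : X.S κ j ⊆ X.S κ 0 := by
  induction j with
  | zero => exact le_rfl
  | succ k ih => exact S_succ_subset.trans ih

lemma S_subset (hκ : 0 < κ) : X.S κ j ⊆ X.Ω := fun x hx => by
  by_contra h
  have : 0 < X.ψ κ j x := hx
  rw [ψ_zero hκ h] at this
  exact lt_irrefl _ this

lemma notMem_S {x : Eu N} : x ∉ X.S κ j ↔ X.ψ κ j x = 0 := by
  unfold S
  rw [mem_ofPred_eq, not_lt]
  exact ⟨fun h => le_antisymm h (ψ_nonneg x), fun h => h.le⟩

/-- The gap between consecutive levels. -/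
lemma ψ_ge_of_mem_succ (hκ : 0 < κ) {x : Eu N} (hx : x ∈ X.S κ (j + 1)) :
    X.b * (1 / 2) ^ j * X.u x ≤ X.ψ κ j x := by
  have h1 : 0 < X.ψ κ (j + 1) x := hx
  have h2 := ψ_eq_of_pos h1
  have h3 : 0 ≤ (X.v x - X.u x) / κ := div_nonneg (d_nonneg x) hκ.le
  have h4 := X.level_gap j x (by linarith)
  have h5 := le_ψ (X := X) (κ := κ) (j := j) x
  linarith

lemma d_lt_of_mem (hκ : 0 < κ) {x : Eu N} (hx : x ∈ X.S κ j) : X.v x - X.u x < κ * X.M := by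
  have h1 : 0 < X.ψ κ j x := hx
  rw [ψ_eq_of_pos h1] at h1
  have h2 := mul_le_mul_of_nonneg_right (X.θ_le j) (X.u_nonneg x)
  have h3 := X.τ_nonneg j
  have h4 : (X.v x - X.u x) / κ < X.M := by linarith [u_le_M (X := X) x]
  rw [div_lt_iff₀ hκ] at h4
  linarith

lemma le_u_of_mem (hκ : 0 < κ) {x : Eu N} (hx : x ∈ X.S κ j) : X.c₀ * X.ρ x ^ X.s₁ ≤ X.u x := by
  have h1 : 0 < X.ψ κ 0 x := S_subset_zero hx
  rw [ψ_eq_of_pos h1] at h1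
  have h2 : 0 ≤ (X.v x - X.u x) / κ := div_nonneg (d_nonneg x) hκ.le
  exact X.le_u x (by linarith)

lemma u_pos_of_mem (hκ : 0 < κ) {x : Eu N} (hx : x ∈ X.S κ j) : 0 < X.u x :=
  lt_of_lt_of_le hx (ψ_le_u hκ x)

lemma ρ_pos_of_mem (hκ : 0 < κ) {x : Eu N} (hx : x ∈ X.S κ j) : 0 < X.ρ x := by
  rcases (X.ρ_nonneg x).eq_or_lt with h | h
  · have := X.u_le x
    rw [← h, Real.zero_rpow X.s₁_pos.ne', mul_zero] at this
    linarith [u_pos_of_mem hκ hx]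
  · exact h

lemma measurable_ψ : Measurable (X.ψ κ j) := by
  have := X.measurable_u; have := X.measurable_v
  unfold ψ; fun_prop

lemma measurableSet_S : MeasurableSet (X.S κ j) := measurableSet_lt measurable_const measurable_ψ

lemma measurable_t : Measurable X.t := by
  have := X.measurable_u
  unfold t; fun_prop

lemma measurable_h : Measurable (X.h κ j) := by
  have := measurable_ψ (X := X) (κ := κ) (j := j)
  unfold h; fun_prop

lemma measurable_flux : Measurable X.flux := by
  have := measurable_t (X := X); have := X.measurable_K₁; have := X.measurable_K₂
  unfold flux; fun_prop

lemma measurable_co : Measurable (X.co κ j) := by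
  have := measurable_t (X := X); have := X.measurable_K₁; have := X.measurable_K₂
  have := measurable_h (X := X) (κ := κ) (j := j)
  unfold co; fun_prop

lemma measurable_en : Measurable (X.en κ j) := by
  have h1 := measurable_t (X := X)
  have h2 := measurable_flux (X := X)
  unfold en
  exact Measurable.ite ((measurableSet_lt measurable_const h1).inter
    (measurable_fst measurableSet_S)) (h1.mul h2) measurable_const

lemma measurable_err {Λ : ℝ} : Measurable (X.err Λ κ j) := by
  have h1 := measurable_t (X := X)
  have h2 := measurable_h (X := X) (κ := κ) (j := j)
  have := X.measurable_K₂
  unfold err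
  refine Measurable.ite ((measurableSet_lt measurable_const h1).inter
    ((measurableSet_lt measurable_const h2).inter
      (measurableSet_le h2 (h1.const_mul Λ)))) (by fun_prop) measurable_const

lemma flux_nonneg (z : Eu N × Eu N) : 0 ≤ X.flux z := by
  have := X.K₁_nonneg z; have := X.K₂_nonneg z
  unfold flux; positivity

lemma co_nonneg (hκ : 0 ≤ κ) (z : Eu N × Eu N) : 0 ≤ X.co κ j z := by
  have := X.K₁_nonneg z; have := X.K₂_nonneg z
  unfold co; positivity

lemma en_nonneg (z : Eu N × Eu N) : 0 ≤ X.en κ j z := by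
  unfold en
  split_ifs with hz
  · exact mul_nonneg hz.1.le (flux_nonneg z)
  · exact le_rfl

lemma err_nonneg {Λ : ℝ} (z : Eu N × Eu N) : 0 ≤ X.err Λ κ j z := by
  have := X.K₂_nonneg z
  unfold err
  split_ifs with hz
  · have := hz.1; have := hz.2.1
    positivity
  · exact le_rfl

lemma t_swap (z : Eu N × Eu N) : X.t z.swap = -X.t z := by simp [t]
lemma h_swap (z : Eu N × Eu N) : X.h κ j z.swap = -X.h κ j z := by simp [h]
lemma co_swap (z : Eu N × Eu N) : X.co κ j z.swap = X.co κ j z := by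
  simp [co, t_swap, h_swap, K₁_swap, K₂_swap]

lemma abs_ψ_sub_le (hκ : 0 < κ) (x y : Eu N) : |X.ψ κ j x - X.ψ κ j y| ≤
    (1 + 2 / κ) * max |X.u x - X.u y| |X.v x - X.v y| := by
  set m := max |X.u x - X.u y| |X.v x - X.v y| with hm
  have h1 : |X.u x - X.u y| ≤ m := le_max_left _ _
  have h2 : |X.v x - X.v y| ≤ m := le_max_right _ _
  unfold ψ
  refine (abs_max_sub_max_le_abs _ _ 0).trans ?_
  rw [show X.θ j * X.u x - X.τ j - (X.v x - X.u x) / κ -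
    (X.θ j * X.u y - X.τ j - (X.v y - X.u y) / κ) = X.θ j * (X.u x - X.u y) -
      ((X.v x - X.v y) - (X.u x - X.u y)) / κ by ring]
  refine (abs_sub _ _).trans ?_
  rw [abs_mul, abs_div, abs_of_nonneg (X.θ_nonneg j), abs_of_pos hκ]
  have h3 : |(X.v x - X.v y) - (X.u x - X.u y)| / κ ≤ (m + m) / κ := by
    gcongr
    exact (abs_sub _ _).trans (by linarith)
  have h4 : X.θ j * |X.u x - X.u y| ≤ 1 * m := by
    gcongr
    exact X.θ_le j
  calc _ ≤ 1 * m + (m + m) / κ := add_le_add h4 h3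
    _ = _ := by ring

lemma nice_ψ (hκ : 0 < κ) : X.Nice (X.ψ κ j) :=
  nice_of_abs_sub_le measurable_ψ
    ⟨X.M, fun x => by rw [abs_of_nonneg (ψ_nonneg x)]; exact ψ_le_M hκ x⟩
    (fun x hx => ψ_zero hκ hx) (abs_ψ_sub_le hκ)

/-! ### Testing the difference of the operators with the truncation -/

/-- Scalar form of the monotonicity estimate, for increments `t ≥ 0` of `u`, `t + δd` of `v` and `δ`
of the truncation, with a further decrease by `G` if the increments are separated by `s`. -/
lemma exists_pair_ineq {p q : ℝ} (hq : 1 < q) (hqp : q < p) : ∃ c C Λ : ℝ, 0 < c ∧ 0 < C ∧ 1 ≤ Λ ∧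
    ∀ κ θ t δ δd s M G : ℝ, 0 < κ → κ ≤ 1 → 0 ≤ θ → θ ≤ 1 → 0 ≤ t → 0 ≤ s → 0 ≤ G →
    (0 < δ → δd ≤ κ * (θ * t - δ) - s) → (δ < 0 → κ * (θ * t - δ) + s ≤ δd) →
    (∀ a, |a| ≤ M → G ≤ J p a - J p (a - s)) → 2 * t + |δ| + s ≤ M →
    (J p (t + δd) - J p t) * δ ≤ ((1 + κ * θ) ^ (p - 1) - 1) * (J p t * δ) -
      c * κ * ((t + κ * |δ|) ^ (p - 2) * |δ| ^ 2) - G * |δ| ∧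
    (J q (t + δd) - J q t) * δ ≤ ((1 + κ * θ) ^ (p - 1) - 1) * (J q t * δ) -
      c * κ * ((t + κ * |δ|) ^ (q - 2) * |δ| ^ 2) +
      (if 0 < t ∧ 0 < -δ ∧ -δ ≤ Λ * t then C * κ * (t ^ (q - 1) * (-δ)) else 0) := by
  have hp : 1 < p := hq.trans hqp
  obtain ⟨c₁, hc₁, H₁⟩ := J_increment hp
  obtain ⟨c₂, hc₂, H₂⟩ := J_increment hq
  obtain ⟨c₃, C, Λ, hc₃, hC, hΛ, H₃⟩ := J_increment_mismatch hq hqp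
  refine ⟨min c₁ (min c₂ c₃), C, Λ, lt_min hc₁ (lt_min hc₂ hc₃), hC, hΛ, ?_⟩
  intro κ θ t δ δd s M G hκ hκ1 hθ hθ1 ht hs hG hgood hbad hgap hM
  set c := min c₁ (min c₂ c₃)
  have l1 : c ≤ c₁ := min_le_left _ _
  have l2 : c ≤ c₂ := (min_le_right _ _).trans (min_le_left _ _)
  have l3 : c ≤ c₃ := (min_le_right _ _).trans (min_le_right _ _)
  have hκθ : 0 ≤ κ * θ := by positivity
  have hκθ1 : κ * θ ≤ 1 := mul_le_one₀ hκ1 hθ hθ1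
  have hη : 1 ≤ 1 + κ * θ := by linarith
  have Jp : J p ((1 + κ * θ) * t) = (1 + κ * θ) ^ (p - 1) * J p t := J_mul hp (by linarith) ht
  have Jq : J q ((1 + κ * θ) * t) = (1 + κ * θ) ^ (q - 1) * J q t := J_mul hq (by linarith) ht
  have Jq0 : 0 ≤ J q t := J_nonneg ht
  have hpow : (1 + κ * θ) ^ (q - 1) ≤ (1 + κ * θ) ^ (p - 1) :=
    Real.rpow_le_rpow_of_exponent_le hη (by linarith)
  have hηt : (1 + κ * θ) * t ≤ 2 * t := by nlinarith
  have hηt0 : 0 ≤ (1 + κ * θ) * t := by positivity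
  rcases lt_trichotomy δ 0 with hδ | rfl | hδ
  · obtain ⟨h', rfl⟩ : ∃ h', δ = -h' := ⟨-δ, by ring⟩
    have hh : 0 < h' := by linarith
    have h1 := hbad hδ
    rw [abs_neg, abs_of_pos hh] at *
    have hκh : κ * h' ≤ h' := by nlinarith
    have hκh0 : 0 < κ * h' := by positivity
    have w1 := (H₁ κ θ t h' hκ hκ1 hθ hθ1 ht hh.le).1
    have w3 := H₃ κ θ t h' hκ hκ1 hθ hθ1 ht hh.le
    have m1 : J p ((1 + κ * θ) * t + κ * h') + G ≤ J p (t + δd) := by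
      have g := hgap ((1 + κ * θ) * t + κ * h' + s) (by rw [abs_of_nonneg (by linarith)]; linarith)
      rw [add_sub_cancel_right] at g
      have := J_monotone hp (show (1 + κ * θ) * t + κ * h' + s ≤ t + δd by linarith)
      linarith
    have m2 : J q ((1 + κ * θ) * t + κ * h') ≤ J q (t + δd) := J_monotone hq (by linarith)
    have b1 : c * κ * ((t + κ * h') ^ (p - 2) * h') ≤ c₁ * κ * ((t + κ * h') ^ (p - 2) * h') := by
      gcongr
    have b2 : c * κ * ((t + κ * h') ^ (q - 2) * h') ≤ c₃ * κ * ((t + κ * h') ^ (q - 2) * h') := by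
      gcongr
    constructor
    · have := mul_le_mul_of_nonneg_right (show
        ((1 + κ * θ) ^ (p - 1) - 1) * J p t + c * κ * ((t + κ * h') ^ (p - 2) * h') + G ≤
          J p (t + δd) - J p t by linarith) hh.le
      linarith
    · have w4 : ((1 + κ * θ) ^ (p - 1) - 1) * J q t + c * κ * ((t + κ * h') ^ (q - 2) * h') ≤
          J q (t + δd) - J q t + (if h' ≤ Λ * t then C * κ * t ^ (q - 1) else 0) := by linarith
      have w5 := mul_le_mul_of_nonneg_right w4 hh.le
      have w6 : (if h' ≤ Λ * t then C * κ * t ^ (q - 1) else 0) * h' ≤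
          if 0 < t ∧ 0 < - -h' ∧ - -h' ≤ Λ * t then C * κ * (t ^ (q - 1) * (- -h')) else 0 := by
        rw [neg_neg]
        by_cases hc : h' ≤ Λ * t
        · have ht0 : 0 < t := by
            by_contra h0
            have : t = 0 := le_antisymm (not_lt.1 h0) ht
            rw [this, mul_zero] at hc; linarith
          rw [if_pos hc, if_pos ⟨ht0, hh, hc⟩]
          exact le_of_eq (by ring)
        · rw [if_neg hc, if_neg (fun h => hc h.2.2), zero_mul]
      linarith
  · simp
  · have h1 := hgood hδ
    rw [abs_of_pos hδ] at *
    have hκh : κ * δ ≤ δ := by nlinarith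
    have hκh0 : 0 < κ * δ := by positivity
    have w1 := (H₁ κ θ t δ hκ hκ1 hθ hθ1 ht hδ.le).2
    have w2 := (H₂ κ θ t δ hκ hκ1 hθ hθ1 ht hδ.le).2
    have m1 : J p (t + δd) + G ≤ J p ((1 + κ * θ) * t - κ * δ) := by
      have g := hgap ((1 + κ * θ) * t - κ * δ) (abs_le.2 ⟨by linarith, by linarith⟩)
      have := J_monotone hp (show t + δd ≤ (1 + κ * θ) * t - κ * δ - s by linarith)
      linarith
    have m2 : J q (t + δd) ≤ J q ((1 + κ * θ) * t - κ * δ) := J_monotone hq (by linarith)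
    have b1 : c * κ * ((t + κ * δ) ^ (p - 2) * δ) ≤ c₁ * κ * ((t + κ * δ) ^ (p - 2) * δ) := by
      gcongr
    have b2 : c * κ * ((t + κ * δ) ^ (q - 2) * δ) ≤ c₂ * κ * ((t + κ * δ) ^ (q - 2) * δ) := by
      gcongr
    rw [if_neg (fun h => by linarith [h.2.1])]
    constructor
    · have := mul_le_mul_of_nonneg_right (show J p (t + δd) - J p t ≤
        ((1 + κ * θ) ^ (p - 1) - 1) * J p t - c * κ * ((t + κ * δ) ^ (p - 2) * δ) - G
          by linarith) hδ.le
      linarith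
    · have w3 := mul_le_mul_of_nonneg_right hpow Jq0
      have := mul_le_mul_of_nonneg_right (show J q (t + δd) - J q t ≤
        ((1 + κ * θ) ^ (p - 1) - 1) * J q t - c * κ * ((t + κ * δ) ^ (q - 2) * δ)
          by linarith) hδ.le
      linarith


/-! ### The coercivity inequality -/

/-- The coercive energy at level `j`. -/
noncomputable def Co (X : Config N) (κ : ℝ) (j : ℕ) : ENNReal :=
  ∫⁻ z, ENNReal.ofReal (X.co κ j z)

/-- The energy of `u` over the pairs whose upper point lies in the `j`-th set. -/
noncomputable def En (X : Config N) (κ : ℝ) (j : ℕ) : ENNReal :=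
  ∫⁻ z, ENNReal.ofReal (X.en κ j z)

/-- The integrated mismatch error. -/
noncomputable def Er (X : Config N) (Λ κ : ℝ) (j : ℕ) : ENNReal :=
  ∫⁻ z, ENNReal.ofReal (X.err Λ κ j z)

/-- The quantity controlled by the coercivity inequality. -/
noncomputable def Q (X : Config N) (κ : ℝ) (j : ℕ) : ENNReal :=
  X.Co κ j + ENNReal.ofReal κ⁻¹ * ∫⁻ x, ENNReal.ofReal (X.ψ κ j x)

/-- The integrand of the weak form of the two operators at `w` tested with `φ`. -/
noncomputable def form (X : Config N) (w φ : Eu N → ℝ) (z : Eu N × Eu N) : ℝ :=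
  J X.p (w z.1 - w z.2) * (φ z.1 - φ z.2) / X.K₁ z +
    J X.q (w z.1 - w z.2) * (φ z.1 - φ z.2) / X.K₂ z

lemma form_swap (w φ : Eu N → ℝ) (z : Eu N × Eu N) : X.form w φ z.swap = X.form w φ z := by
  unfold form
  rw [K₁_swap, K₂_swap, Prod.fst_swap, Prod.snd_swap, ← neg_sub (w z.1), ← neg_sub (φ z.1),
    J_neg, J_neg]
  ring

lemma integrable_form {w φ : Eu N → ℝ} (hw : X.Nice w) (hφ : X.Nice φ) :
    Integrable (X.form w φ) := (hw.integrable_p hφ).add (hw.integrable_q hφ)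

lemma integral_form {w φ : Eu N → ℝ} (hw : X.Nice w) (hφ : X.Nice φ) :
    ∫ z, X.form w φ z = A X.s₁ X.p w φ + A X.s₂ X.q w φ :=
  integral_add (hw.integrable_p hφ) (hw.integrable_q hφ)

open Classical in
/-- The pairs with one point in `B`, where `v - u` is not small, give a definite decrease. -/
noncomputable def gain (X : Config N) (κ : ℝ) (j : ℕ) (z : Eu N × Eu N) : ℝ :=
  (if z.2 ∈ X.B then X.ψ κ j z.1 else 0) + (if z.1 ∈ X.B then X.ψ κ j z.2 else 0)

lemma gain_swap (z : Eu N × Eu N) : X.gain κ j z.swap = X.gain κ j z := by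
  simp [gain, add_comm]

lemma ψ_eq_zero_of_mem_B (hκ : 0 < κ) (hκM : κ * X.M ≤ X.ε₀) {x : Eu N} (hx : x ∈ X.B) :
    X.ψ κ j x = 0 := by
  rw [← notMem_S]
  intro h
  linarith [d_lt_of_mem hκ h, X.B_gap x hx]

variable (X) in
/-- The pointwise estimate behind the coercivity inequality. -/
lemma exists_form_le : ∃ c C Λ γ κ₁ : ℝ, 0 < c ∧ 0 < C ∧ 1 ≤ Λ ∧ 0 < γ ∧ 0 < κ₁ ∧ κ₁ ≤ 1 ∧
    ∀ κ, 0 < κ → κ ≤ κ₁ → ∀ j z, X.form X.v (X.ψ κ j) z - X.form X.u (X.ψ κ j) z ≤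
      ((1 + κ * X.θ j) ^ (X.p - 1) - 1) * X.form X.u (X.ψ κ j) z - c * κ * X.co κ j z -
        γ * X.gain κ j z + C * κ * (X.err Λ κ j z + X.err Λ κ j z.swap) := by
  obtain ⟨c, C, Λ, hc, hC, hΛ, H⟩ := exists_pair_ineq X.hq X.hqp
  have hε := X.hε₀
  have hM := X.hM
  have hR := X.hR
  obtain ⟨γ, hγ, hgap⟩ := J_gap X.hp (3 * X.M + X.ε₀) (X.ε₀ / 2) (by linarith)
  set D : ℝ := X.R ^ ((N : ℝ) + X.s₁ * X.p) with hD
  have hexp : 0 ≤ (N : ℝ) + X.s₁ * X.p := by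
    have := X.s₁_pos; have := X.hp; positivity
  have hD0 : 0 < D := by positivity
  refine ⟨c, C, Λ, γ / D, min 1 (X.ε₀ / (6 * X.M)), hc, hC, hΛ, by positivity,
    lt_min one_pos (by positivity), min_le_left _ _, fun κ hκ hκ1 j => ?_⟩
  have hκM : 6 * (κ * X.M) ≤ X.ε₀ := by
    have := hκ1.trans (min_le_right _ _)
    rw [le_div_iff₀ (by positivity)] at this
    linarith
  have hκM0 : 0 < κ * X.M := by positivity
  replace hκ1 : κ ≤ 1 := hκ1.trans (min_le_left _ _)
  have main : ∀ z : Eu N × Eu N, 0 ≤ X.t z →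
      X.form X.v (X.ψ κ j) z - X.form X.u (X.ψ κ j) z ≤
      ((1 + κ * X.θ j) ^ (X.p - 1) - 1) * X.form X.u (X.ψ κ j) z - c * κ * X.co κ j z -
        γ / D * X.gain κ j z + C * κ * X.err Λ κ j z := by
    intro z ht
    set δ := X.ψ κ j z.1 - X.ψ κ j z.2 with hδ
    set δd := (X.v z.1 - X.u z.1) - (X.v z.2 - X.u z.2) with hδd
    have hh : X.h κ j z = -δ := by rw [hδ]; unfold h; ring
    have ψ1 := ψ_nonneg (X := X) (κ := κ) (j := j) z.1
    have ψ2 := ψ_nonneg (X := X) (κ := κ) (j := j) z.2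
    have ψM1 := ψ_le_M (X := X) (j := j) hκ z.1
    have ψM2 := ψ_le_M (X := X) (j := j) hκ z.2
    have hδM : |δ| ≤ X.M := abs_le.2 ⟨by linarith, by linarith⟩
    have htM : X.t z ≤ X.M := by
      unfold t; linarith [u_le_M (X := X) z.1, X.u_nonneg z.2]
    have hθt : 0 ≤ X.θ j * X.t z := mul_nonneg (X.θ_nonneg j) ht
    have hθtM : X.θ j * X.t z ≤ X.M := by nlinarith [X.θ_le j]
    have hgood : 0 < δ → δd ≤ κ * (X.θ j * X.t z - δ) := fun h0 => by
      have e1 := ψ_eq_of_pos (show 0 < X.ψ κ j z.1 by linarith)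
      have e2 := le_ψ (X := X) (κ := κ) (j := j) z.2
      have : δd / κ ≤ X.θ j * X.t z - δ := by
        have : δd / κ = (X.v z.1 - X.u z.1) / κ - (X.v z.2 - X.u z.2) / κ := by
          rw [hδd]; ring
        rw [this, hδ]; unfold t; linarith
      rw [div_le_iff₀ hκ] at this
      linarith
    have hbad : δ < 0 → κ * (X.θ j * X.t z - δ) ≤ δd := fun h0 => by
      have e1 := ψ_eq_of_pos (show 0 < X.ψ κ j z.2 by linarith)
      have e2 := le_ψ (X := X) (κ := κ) (j := j) z.1
      have : X.θ j * X.t z - δ ≤ δd / κ := by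
        have : δd / κ = (X.v z.1 - X.u z.1) / κ - (X.v z.2 - X.u z.2) / κ := by
          rw [hδd]; ring
        rw [this, hδ]; unfold t; linarith
      rw [le_div_iff₀ hκ] at this
      linarith
    have hv : X.v z.1 - X.v z.2 = X.t z + δd := by rw [hδd]; unfold t; ring
    have hu : X.u z.1 - X.u z.2 = X.t z := rfl
    have fin : ∀ s G : ℝ, 0 ≤ s → 0 ≤ G → (0 < δ → δd ≤ κ * (X.θ j * X.t z - δ) - s) →
        (δ < 0 → κ * (X.θ j * X.t z - δ) + s ≤ δd) →
        (∀ a, |a| ≤ 3 * X.M + X.ε₀ → G ≤ J X.p a - J X.p (a - s)) → s ≤ X.ε₀ →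
        X.form X.v (X.ψ κ j) z - X.form X.u (X.ψ κ j) z ≤
      ((1 + κ * X.θ j) ^ (X.p - 1) - 1) * X.form X.u (X.ψ κ j) z - c * κ * X.co κ j z -
        G * |δ| / X.K₁ z + C * κ * X.err Λ κ j z := by
      intro s G hs hG h1 h2 h3 hsε
      obtain ⟨i1, i2⟩ := H κ (X.θ j) (X.t z) δ δd s (3 * X.M + X.ε₀) G hκ hκ1 (X.θ_nonneg j)
        (X.θ_le j) ht hs hG h1 h2 h3 (by linarith)
      have j1 := div_le_div_of_nonneg_right i1 (X.K₁_nonneg z)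
      have j2 := div_le_div_of_nonneg_right i2 (X.K₂_nonneg z)
      have herr : C * κ * X.err Λ κ j z = (if 0 < X.t z ∧ 0 < -δ ∧ -δ ≤ Λ * X.t z then
          C * κ * (X.t z ^ (X.q - 1) * (-δ)) else 0) / X.K₂ z := by
        unfold err
        rw [hh]
        split_ifs <;> ring
      rw [herr]
      unfold form co
      rw [hv, hu, ← hδ, hh, abs_neg, abs_of_nonneg ht]
      calc _ = (J X.p (X.t z + δd) - J X.p (X.t z)) * δ / X.K₁ z +
            (J X.q (X.t z + δd) - J X.q (X.t z)) * δ / X.K₂ z := by ring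
        _ ≤ _ := add_le_add j1 j2
        _ = _ := by ring
    have hKD : z.1 ∈ X.Ω → z.2 ∈ X.Ω → z.1 ≠ z.2 →
        γ / D * |δ| ≤ γ * |δ| / X.K₁ z := fun m1 m2 hne => by
      have hpos : 0 < ‖z.1 - z.2‖ := norm_pos_iff.2 (sub_ne_zero.2 hne)
      have hK : X.K₁ z ≤ D := Real.rpow_le_rpow hpos.le (X.diam_le _ m1 _ m2) hexp
      have hK0 : 0 < X.K₁ z := Real.rpow_pos_of_pos hpos _
      rw [div_mul_eq_mul_div]
      gcongr
    -- a pair contributes to the gain if one point is in `B` and the truncation is positive at the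
    -- other
    by_cases hA : z.2 ∈ X.B ∧ 0 < X.ψ κ j z.1
    · have z0 : X.ψ κ j z.2 = 0 := ψ_eq_zero_of_mem_B hκ (by linarith) hA.1
      have hn1 : z.1 ∉ X.B := fun h => by
        have := ψ_eq_zero_of_mem_B (j := j) hκ (by linarith) h
        linarith [hA.2]
      have hg : X.gain κ j z = |δ| := by
        unfold gain
        rw [if_pos hA.1, if_neg hn1, hδ, z0, add_zero, sub_zero, abs_of_pos hA.2]
      have hδ0 : 0 < δ := by rw [hδ, z0]; linarith [hA.2]
      have d1 := d_lt_of_mem hκ (show z.1 ∈ X.S κ j from hA.2)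
      have d2 := X.B_gap _ hA.1
      have := fin (X.ε₀ / 2) γ (by linarith) hγ.le (fun _ => by
        have : κ * (X.θ j * X.t z - δ) ≥ κ * (-X.M) := by
          gcongr
          linarith [le_abs_self δ]
        linarith) (fun h => by linarith) hgap (by linarith)
      have hk := hKD (S_subset hκ hA.2) (X.B_sub hA.1) (fun e => hn1 (e ▸ hA.1))
      rw [hg]; linarith
    · by_cases hB : z.1 ∈ X.B ∧ 0 < X.ψ κ j z.2
      · have z0 : X.ψ κ j z.1 = 0 := ψ_eq_zero_of_mem_B hκ (by linarith) hB.1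
        have hn1 : z.2 ∉ X.B := fun h => by
          have := ψ_eq_zero_of_mem_B (j := j) hκ (by linarith) h
          linarith [hB.2]
        have hg : X.gain κ j z = |δ| := by
          unfold gain
          rw [if_pos hB.1, if_neg hn1, hδ, z0, zero_add, zero_sub, abs_neg, abs_of_pos hB.2]
        have hδ0 : δ < 0 := by rw [hδ, z0]; linarith [hB.2]
        have d1 := d_lt_of_mem hκ (show z.2 ∈ X.S κ j from hB.2)
        have d2 := X.B_gap _ hB.1
        have := fin (X.ε₀ / 2) γ (by linarith) hγ.le (fun h => by linarith) (fun _ => by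
          have : κ * (X.θ j * X.t z - δ) ≤ κ * (2 * X.M) := by
            gcongr
            linarith [neg_abs_le δ]
          linarith) hgap (by linarith)
        have hk := hKD (X.B_sub hB.1) (S_subset hκ hB.2) (fun e => hn1 (e ▸ hB.1))
        rw [hg]; linarith
      · have hg : X.gain κ j z = 0 := by
          have a1 : z.2 ∈ X.B → X.ψ κ j z.1 = 0 := fun hh =>
            le_antisymm (not_lt.1 fun h' => hA ⟨hh, h'⟩) ψ1
          have a2 : z.1 ∈ X.B → X.ψ κ j z.2 = 0 := fun hh =>
            le_antisymm (not_lt.1 fun h' => hB ⟨hh, h'⟩) ψ2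
          unfold gain
          split_ifs with u1 u2 u2
          · rw [a1 u1, a2 u2, add_zero]
          · rw [a1 u1, add_zero]
          · rw [a2 u2, add_zero]
          · rw [add_zero]
        have := fin 0 0 le_rfl le_rfl (by simpa using hgood) (by simpa using hbad)
          (fun a _ => by simp) hε.le
        rw [hg]
        simpa using this
  intro z
  have e0 : ∀ z, 0 ≤ C * κ * X.err Λ κ j z := fun z =>
    mul_nonneg (by positivity) (err_nonneg z)
  rcases le_total 0 (X.t z) with h | h
  · linarith [main z h, e0 z.swap]
  · have := main z.swap (by rw [t_swap]; linarith)
    rw [form_swap, form_swap, co_swap, gain_swap] at this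
    linarith [e0 z]

lemma integral_ψ_eq (hκ : 0 < κ) : ENNReal.ofReal (∫ x in X.Ω, X.ψ κ j x) =
    ∫⁻ x, ENNReal.ofReal (X.ψ κ j x) := by
  rw [setIntegral_eq_integral_of_forall_compl_eq_zero (fun x hx => ψ_zero hκ hx)]
  refine ofReal_integral_eq_lintegral_ofReal ?_ (.of_forall ψ_nonneg)
  have h1 : IntegrableOn (X.ψ κ j) X.Ω := by
    refine Measure.integrableOn_of_bounded X.volume_Ω.ne
      measurable_ψ.aestronglyMeasurable (M := X.M) (.of_forall fun x => ?_)
    rw [Real.norm_eq_abs, abs_of_nonneg (ψ_nonneg x)]; exact ψ_le_M hκ x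
  exact h1.integrable_of_forall_notMem_eq_zero fun x hx => ψ_zero hκ hx

variable (X) in
/-- The coercivity inequality: the truncation tested in the difference of the two inequalities.
The coercive energy and the (large) multiple `κ⁻¹` of the mean of the truncation are controlled by
the mismatch error alone. -/
lemma exists_coercivity : ∃ C Λ κ₁ : ℝ, 0 < C ∧ 1 ≤ Λ ∧ 0 < κ₁ ∧ κ₁ ≤ 1 ∧
    ∀ κ, 0 < κ → κ ≤ κ₁ → ∀ j,
    X.Q κ j ≤ ENNReal.ofReal C * X.Er Λ κ j := by
  obtain ⟨c, C, Λ, γ, κ₁, hc, hC, hΛ, hγ, hκ₁, hκ₁1, H⟩ := exists_form_le X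
  have hBfin : volume X.B ≠ ⊤ := ((measure_mono X.B_sub).trans_lt X.volume_Ω).ne
  set β := (volume X.B).toReal with hβ
  have hβ0 : 0 < β := ENNReal.toReal_pos X.volume_B.ne' hBfin
  have hM := X.hM
  have hL := X.hL
  obtain ⟨δ, hδ, hδ'⟩ := X.u_v (γ * β / 4) (by positivity)
  set C₁ := (2:ℝ) ^ X.p with hC₁
  have hC₁0 : 0 < C₁ := by positivity
  set m := min c (γ * β / 2) with hm
  have hm0 : 0 < m := lt_min hc (by positivity)
  refine ⟨2 * C / m, Λ, min κ₁ (min (δ / X.M) (γ * β / (4 * C₁ * X.L))), by positivity, hΛ,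
    lt_min hκ₁ (lt_min (by positivity) (by positivity)), (min_le_left _ _).trans hκ₁1,
    fun κ hκ hκle j => ?_⟩
  -- small `κ` makes `v - u ≤ δ` on the support of the truncation and lets the gain from `B` absorb
  -- the right-hand side of the inequality for `u`
  have k1 : κ ≤ κ₁ := hκle.trans (min_le_left _ _)
  have k2 : κ * X.M ≤ δ := by
    have := hκle.trans ((min_le_right _ _).trans (min_le_left _ _))
    rwa [le_div_iff₀ (by positivity)] at this
  have k3 : C₁ * κ * X.L ≤ γ * β / 4 := by
    have := hκle.trans ((min_le_right _ _).trans (min_le_right _ _))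
    rw [le_div_iff₀ (by positivity)] at this
    linarith
  have hκ1 : κ ≤ 1 := k1.trans hκ₁1
  set I := ∫ x in X.Ω, X.ψ κ j x with hI
  have hI0 : 0 ≤ I := integral_nonneg ψ_nonneg
  have hψ : X.Nice (X.ψ κ j) := nice_ψ hκ
  have hsub := X.u_sub _ hψ.memW0 ψ_nonneg
  have huv := hδ' _ hψ.memW0 ψ_nonneg (fun x _ hx => by
    by_contra h
    have : x ∈ X.S κ j := lt_of_le_of_ne (ψ_nonneg x) (Ne.symm h)
    linarith [d_lt_of_mem hκ this])
  set η := (1 + κ * X.θ j) ^ (X.p - 1) - 1 with hη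
  have hη0 : 0 ≤ η := by
    have := Real.one_le_rpow (show 1 ≤ 1 + κ * X.θ j by
      linarith [mul_nonneg hκ.le (X.θ_nonneg j)]) (show 0 ≤ X.p - 1 by linarith [X.hp])
    linarith
  have hη1 : η ≤ C₁ * κ := by
    have h1 := one_add_mul_rpow_le (c := 1) (m := X.p - 1) zero_le_one (by linarith [X.hp]) hκ.le
      hκ1
    have h2 : (1 + κ * X.θ j) ^ (X.p - 1) ≤ (1 + 1 * κ) ^ (X.p - 1) := by
      refine Real.rpow_le_rpow (by have := X.θ_nonneg j; positivity) ?_ (by linarith [X.hp])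
      nlinarith [X.θ_le j]
    rw [sub_add_cancel, show (1:ℝ) + 1 = 2 by norm_num] at h1
    linarith
  have iu := integrable_form (X := X) nice_u hψ
  have iv := integrable_form (X := X) nice_v hψ
  have key := lintegral_le_of_le_add (μ := volume)
    (W := fun z => c * κ * X.co κ j z + γ * (X.ψ κ j z.1 * X.B.indicator 1 z.2))
    (X := fun z => η * X.form X.u (X.ψ κ j) z -
      (X.form X.v (X.ψ κ j) z - X.form X.u (X.ψ κ j) z))
    (Y := fun z => C * κ * (X.err Λ κ j z + X.err Λ κ j z.swap))
    ((iu.const_mul η).sub (iv.sub iu))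
    (fun z => mul_nonneg (by positivity) (add_nonneg (err_nonneg _) (err_nonneg _)))
    (fun z => by
      have h1 := H κ hκ k1 j z
      have h2 : X.ψ κ j z.1 * X.B.indicator 1 z.2 ≤ X.gain κ j z := by
        have := ψ_nonneg (X := X) (κ := κ) (j := j) z.2
        by_cases hz : z.2 ∈ X.B
        · unfold gain
          rw [indicator_of_mem hz, if_pos hz]
          split_ifs <;> simp [this]
        · unfold gain
          rw [indicator_of_notMem hz, if_neg hz]
          split_ifs <;> simp [this]
      have h3 := mul_le_mul_of_nonneg_left h2 hγ.le
      linarith)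
    (fun z => by
      have := co_nonneg (X := X) (j := j) hκ.le z
      have h1 := ψ_nonneg (X := X) (κ := κ) (j := j) z.1
      have h2 : (0:ℝ) ≤ X.B.indicator 1 z.2 := indicator_nonneg (fun _ _ => zero_le_one) _
      positivity)
  have eX : ∫ z, (η * X.form X.u (X.ψ κ j) z -
      (X.form X.v (X.ψ κ j) z - X.form X.u (X.ψ κ j) z)) =
      η * (A X.s₁ X.p X.u (X.ψ κ j) + A X.s₂ X.q X.u (X.ψ κ j)) -
      (A X.s₁ X.p X.v (X.ψ κ j) + A X.s₂ X.q X.v (X.ψ κ j) -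
        (A X.s₁ X.p X.u (X.ψ κ j) + A X.s₂ X.q X.u (X.ψ κ j))) := by
    rw [← integral_form nice_u hψ, ← integral_form nice_v hψ, ← integral_const_mul,
      ← integral_sub iv iu]
    exact integral_sub (iu.const_mul η) (iv.sub iu)
  rw [eX] at key
  have hX : η * (A X.s₁ X.p X.u (X.ψ κ j) + A X.s₂ X.q X.u (X.ψ κ j)) -
      (A X.s₁ X.p X.v (X.ψ κ j) + A X.s₂ X.q X.v (X.ψ κ j) -
        (A X.s₁ X.p X.u (X.ψ κ j) + A X.s₂ X.q X.u (X.ψ κ j))) ≤ γ * β / 2 * I := by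
    have h1 := mul_le_mul_of_nonneg_left hsub hη0
    have h2 : η * (X.L * I) ≤ C₁ * κ * (X.L * I) := by gcongr
    have h3 : C₁ * κ * X.L * I ≤ γ * β / 4 * I := by gcongr
    linarith
  -- the left-hand side
  have hco0 := co_nonneg (X := X) (j := j) hκ.le
  have eW : ∫⁻ z, ENNReal.ofReal (c * κ * X.co κ j z + γ * (X.ψ κ j z.1 * X.B.indicator 1 z.2)) =
      ENNReal.ofReal (c * κ) * X.Co κ j + ENNReal.ofReal (γ * β * I) := by
    have e1 : ∀ z : Eu N × Eu N,
        ENNReal.ofReal (c * κ * X.co κ j z + γ * (X.ψ κ j z.1 * X.B.indicator 1 z.2)) =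
        ENNReal.ofReal (c * κ) * ENNReal.ofReal (X.co κ j z) +
        ENNReal.ofReal γ * (ENNReal.ofReal (X.ψ κ j z.1) * X.B.indicator 1 z.2) := fun z => by
      have h1 := ψ_nonneg (X := X) (κ := κ) (j := j) z.1
      have h2 : (0:ℝ) ≤ X.B.indicator 1 z.2 := indicator_nonneg (fun _ _ => zero_le_one) _
      rw [ENNReal.ofReal_add (mul_nonneg (by positivity) (hco0 z)) (by positivity),
        ENNReal.ofReal_mul (by positivity), ENNReal.ofReal_mul hγ.le, ENNReal.ofReal_mul h1]
      congr 3
      by_cases hz : z.2 ∈ X.B <;> simp [hz]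
    unfold Co
    simp_rw [e1]
    rw [lintegral_add_left (measurable_co.ennreal_ofReal.const_mul _),
      lintegral_const_mul' _ _ ENNReal.ofReal_ne_top,
      lintegral_const_mul' _ _ ENNReal.ofReal_ne_top, Measure.volume_eq_prod,
      lintegral_prod_mul (f := fun x => ENNReal.ofReal (X.ψ κ j x))
        (g := X.B.indicator 1) measurable_ψ.ennreal_ofReal.aemeasurable
        (measurable_one.indicator X.measurable_B).aemeasurable,
      lintegral_indicator_one X.measurable_B, ← integral_ψ_eq hκ, mul_assoc γ,
      ENNReal.ofReal_mul hγ.le, mul_comm β, ENNReal.ofReal_mul hI0, hβ, ENNReal.ofReal_toReal hBfin]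
  have eY : ∫⁻ z, ENNReal.ofReal (C * κ * (X.err Λ κ j z + X.err Λ κ j z.swap)) =
      ENNReal.ofReal (2 * C * κ) * X.Er Λ κ j := by
    unfold Er
    simp_rw [ENNReal.ofReal_mul (show 0 ≤ C * κ by positivity),
      ENNReal.ofReal_add (err_nonneg _) (err_nonneg _)]
    rw [lintegral_const_mul' _ _ ENNReal.ofReal_ne_top,
      lintegral_add_left measurable_err.ennreal_ofReal, Measure.volume_eq_prod,
      lintegral_prod_swap (fun z => ENNReal.ofReal (X.err Λ κ j z)), ← two_mul, ← mul_assoc,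
      mul_comm _ (2:ENNReal), mul_assoc 2 C κ, ENNReal.ofReal_mul (by norm_num : (0:ℝ) ≤ 2)]
    simp
  rw [eW, eY] at key
  have key2 : ENNReal.ofReal (c * κ) * X.Co κ j + ENNReal.ofReal (γ * β / 2 * I) ≤
      ENNReal.ofReal (2 * C * κ) * X.Er Λ κ j := by
    have e : ENNReal.ofReal (γ * β * I) = ENNReal.ofReal (γ * β / 2 * I) +
        ENNReal.ofReal (γ * β / 2 * I) := by
      rw [← ENNReal.ofReal_add (by positivity) (by positivity)]; congr 1; ring
    rw [e, ← add_assoc] at key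
    have := key.trans (add_le_add (ENNReal.ofReal_le_ofReal hX) le_rfl)
    rw [add_comm (ENNReal.ofReal (γ * β / 2 * I)) (ENNReal.ofReal (2 * C * κ) * X.Er Λ κ j)] at this
    exact (ENNReal.add_le_add_iff_right ENNReal.ofReal_ne_top).1 this
  -- the factor `κ` is common to both sides: dividing by it produces the coefficient `κ⁻¹`
  unfold Q
  rw [← integral_ψ_eq hκ, ← hI, ← ENNReal.ofReal_mul (by positivity)]
  have hmk : 0 < m * κ := by positivity
  have key3 : ENNReal.ofReal (m * κ) * (X.Co κ j + ENNReal.ofReal (κ⁻¹ * I)) ≤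
      ENNReal.ofReal (m * κ) * (ENNReal.ofReal (2 * C / m) * X.Er Λ κ j) := by
    rw [mul_add, ← mul_assoc, ← ENNReal.ofReal_mul hmk.le, ← ENNReal.ofReal_mul hmk.le]
    have r1 : m * κ * (κ⁻¹ * I) = m * I := by field_simp
    have r2 : m * κ * (2 * C / m) = 2 * C * κ := by field_simp
    rw [r1, r2]
    refine le_trans ?_ key2
    gcongr
    · exact min_le_left _ _
    · exact min_le_right _ _
  exact (ENNReal.mul_le_mul_iff_right (by simpa using hmk) ENNReal.ofReal_ne_top).1 key3


/-! ### Pointwise bounds for the error and the flux -/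

variable {i : ℕ}

/-- The flux against the drop of the truncation is coercive, unless the drop is small compared with
the increment of `u`. -/
lemma flux_mul_h_le (hκ : 0 < κ) (hκ1 : κ ≤ 1) {z : Eu N × Eu N} (ht : 0 < X.t z)
    (hh : 0 < X.h κ j z) :
    X.flux z * X.h κ j z ≤ (1 + X.t z / X.h κ j z) * X.co κ j z := by
  have h1 := div_le_div_of_nonneg_right (flux_le_weight X.hp hκ hκ1 ht.le hh) (X.K₁_nonneg z)
  have h2 := div_le_div_of_nonneg_right (flux_le_weight X.hq hκ hκ1 ht.le hh) (X.K₂_nonneg z)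
  unfold flux co
  rw [abs_of_pos ht, abs_of_pos hh]
  calc _ = X.t z ^ (X.p - 1) * X.h κ j z / X.K₁ z + X.t z ^ (X.q - 1) * X.h κ j z / X.K₂ z := by
        ring
    _ ≤ _ := add_le_add h1 h2
    _ = _ := by ring

lemma mem_of_h_pos {z : Eu N × Eu N} (hh : 0 < X.h κ j z) : z.2 ∈ X.S κ j := by
  have := ψ_nonneg (X := X) (κ := κ) (j := j) z.1
  unfold h at hh
  exact lt_of_le_of_lt this (by linarith)

lemma mem_of_t_pos {z : Eu N × Eu N} (ht : 0 < X.t z) : z.1 ∈ X.Ω := by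
  by_contra h
  unfold t at ht
  rw [X.u_zero _ h] at ht
  linarith [X.u_nonneg z.2]

lemma dist_pos_of_t_pos {z : Eu N × Eu N} (ht : 0 < X.t z) : 0 < ‖z.1 - z.2‖ := by
  refine norm_pos_iff.2 (sub_ne_zero.2 fun h => ?_)
  unfold t at ht
  rw [h] at ht; linarith

/-- At distance at least `ρ y`, the increment of `u` is at most of order `r ^ s₁`. -/
lemma t_le {z : Eu N × Eu N} {r : ℝ} (h1 : X.ρ z.2 ≤ r) (h2 : ‖z.1 - z.2‖ ≤ r) :
    X.t z ≤ 2 * X.C₀ * r ^ X.s₁ := by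
  have hC := X.hC₀
  have hr : 0 ≤ r := (X.ρ_nonneg _).trans h1
  have h3 : X.ρ z.1 ≤ 2 * r := (X.ρ_lip z.1 z.2).trans (by linarith)
  calc X.t z ≤ X.u z.1 := by unfold t; linarith [X.u_nonneg z.2]
    _ ≤ X.C₀ * X.ρ z.1 ^ X.s₁ := X.u_le _
    _ ≤ X.C₀ * (2 * r) ^ X.s₁ := by
        gcongr
        · exact X.ρ_nonneg _
        · exact X.s₁_pos.le
    _ = X.C₀ * (2 ^ X.s₁ * r ^ X.s₁) := by rw [Real.mul_rpow (by norm_num) hr]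
    _ ≤ X.C₀ * (2 ^ (1:ℝ) * r ^ X.s₁) := by
        gcongr
        · norm_num
        · exact X.hs₁.le
    _ = _ := by rw [Real.rpow_one]; ring

/-- The quotient of the upper bound for increments of `u` over short pairs and the lower bound for
the truncation, up to the factor `2 ^ j`. -/
noncomputable def D (X : Config N) : ℝ := 2 * X.C₀ / (X.b * X.c₀)

lemma one_le_D : 1 ≤ X.D := by
  have := X.hC₀; have := X.hb; have := X.hb1; have := X.hc₀; have := X.hc₀1
  unfold D
  rw [le_div_iff₀ (by positivity)]
  nlinarith

/-- If the upper point of a short pair is not in the `i`-th set while the lower one is in the next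
set, the drop of the `i`-th truncation is comparable with the increment of `u`. -/
lemma t_le_h (hκ : 0 < κ) {z : Eu N × Eu N} (hz : ‖z.1 - z.2‖ ≤ X.ρ z.2)
    (h2 : z.2 ∈ X.S κ (i + 1)) (h1 : z.1 ∉ X.S κ i) : X.t z ≤ X.D * 2 ^ i * X.h κ i z := by
  have hb := X.hb; have hc := X.hc₀; have hC := X.hC₀
  have a1 := t_le (X := X) (z := z) le_rfl hz
  have a2 := ψ_ge_of_mem_succ hκ h2
  have a3 := le_u_of_mem hκ h2
  have a4 : X.h κ i z = X.ψ κ i z.2 := by unfold h; rw [notMem_S.1 h1, sub_zero]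
  have a5 : X.b * (1 / 2) ^ i * (X.c₀ * X.ρ z.2 ^ X.s₁) ≤ X.h κ i z := by
    rw [a4]; refine le_trans ?_ a2
    gcongr
  refine a1.trans ?_
  calc 2 * X.C₀ * X.ρ z.2 ^ X.s₁
      = X.D * 2 ^ i * (X.b * (1 / 2) ^ i * (X.c₀ * X.ρ z.2 ^ X.s₁)) := by
        unfold D
        rw [div_pow, one_pow]
        field_simp
    _ ≤ _ := by
        have := one_le_D (X := X)
        gcongr

lemma h_le_h_of_notMem {z : Eu N × Eu N} (h1 : z.1 ∉ X.S κ i) :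
    X.h κ (i + 1) z ≤ X.h κ i z := by
  have h3 := notMem_S.1 h1
  have h4 := notMem_S.1 (fun hh => h1 (S_succ_subset hh) : z.1 ∉ X.S κ (i + 1))
  unfold h
  rw [h3, h4]
  linarith [ψ_succ_le (X := X) (κ := κ) (j := i) z.2]

lemma flux_mul_h_le_of_notMem (hκ : 0 < κ) (hκ1 : κ ≤ 1) {z : Eu N × Eu N}
    (hz : ‖z.1 - z.2‖ ≤ X.ρ z.2) (ht : 0 < X.t z) (h2 : z.2 ∈ X.S κ (i + 1))
    (h1 : z.1 ∉ X.S κ i) : 0 < X.h κ i z ∧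
      X.flux z * X.h κ i z ≤ 2 * X.D * 2 ^ i * X.co κ i z := by
  have hD := one_le_D (X := X)
  have a4 : X.h κ i z = X.ψ κ i z.2 := by unfold h; rw [notMem_S.1 h1, sub_zero]
  have hh : 0 < X.h κ i z := by rw [a4]; exact S_succ_subset h2
  refine ⟨hh, (flux_mul_h_le hκ hκ1 ht hh).trans ?_⟩
  have := t_le_h hκ hz h2 h1
  have hco := co_nonneg (X := X) (j := i) hκ.le z
  gcongr
  have h3 : X.t z / X.h κ i z ≤ X.D * 2 ^ i := by rwa [div_le_iff₀ hh]
  have h4 : (1:ℝ) ≤ 2 ^ i := one_le_pow₀ (by norm_num)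
  nlinarith

lemma en_of_mem {z : Eu N × Eu N} (ht : 0 < X.t z) (h1 : z.1 ∈ X.S κ i) :
    X.en κ i z = X.t z * X.flux z := by unfold en; rw [if_pos ⟨ht, h1⟩]

/-- The flux over short pairs is absorbed by the energy and the coercive densities. -/
lemma flux_near_le (hκ : 0 < κ) (hκ1 : κ ≤ 1) {δ : ℝ} (hδ : 0 < δ) (hδ1 : δ ≤ 1)
    {z : Eu N × Eu N} (hz : ‖z.1 - z.2‖ ≤ X.ρ z.2) (ht : 0 < X.t z)
    (hh : 0 < X.h κ (i + 1) z) :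
    2 ^ i * (X.flux z * X.h κ (i + 1) z) ≤
      δ * X.en κ i z + δ⁻¹ * (2 * X.D) * 4 ^ i * (X.co κ (i + 1) z + X.co κ i z) := by
  have hD := one_le_D (X := X)
  have hco := co_nonneg (X := X) (j := i) hκ.le z
  have hco' := co_nonneg (X := X) (j := i + 1) hκ.le z
  have hfl := flux_nonneg (X := X) z
  have h2 := mem_of_h_pos hh
  have h2i : (1:ℝ) ≤ 2 ^ i := one_le_pow₀ (by norm_num)
  have h4i : (4:ℝ) ^ i = 2 ^ i * 2 ^ i := by rw [← mul_pow]; norm_num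
  have hδi : 1 ≤ δ⁻¹ := (one_le_inv₀ hδ).2 hδ1
  by_cases h1 : z.1 ∈ X.S κ i
  · rw [en_of_mem ht h1]
    by_cases hc : 2 ^ i * X.h κ (i + 1) z ≤ δ * X.t z
    · have := mul_le_mul_of_nonneg_right hc hfl
      have h5 : 0 ≤ δ⁻¹ * (2 * X.D) * 4 ^ i * (X.co κ (i + 1) z + X.co κ i z) := by positivity
      linarith
    · push Not at hc
      have h3 : X.t z / X.h κ (i + 1) z ≤ δ⁻¹ * 2 ^ i := by
        rw [div_le_iff₀ hh, mul_assoc, le_inv_mul_iff₀ hδ]; exact hc.le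
      have h5 := flux_mul_h_le hκ hκ1 ht hh
      have h6 : (1 + X.t z / X.h κ (i + 1) z) ≤ δ⁻¹ * (2 * X.D) * 2 ^ i := by
        have : 1 ≤ δ⁻¹ * 2 ^ i := one_le_mul_of_one_le_of_one_le hδi h2i
        nlinarith [mul_le_mul_of_nonneg_left hD (show 0 ≤ 2 * (δ⁻¹ * 2 ^ i) by positivity)]
      have h7 : X.flux z * X.h κ (i + 1) z ≤ δ⁻¹ * (2 * X.D) * 2 ^ i * X.co κ (i + 1) z :=
        h5.trans (by gcongr)
      have h8 := mul_le_mul_of_nonneg_left h7 (show (0:ℝ) ≤ 2 ^ i by positivity)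
      have h9 : 0 ≤ δ * (X.t z * X.flux z) := by positivity
      have h10 : 0 ≤ δ⁻¹ * (2 * X.D) * 4 ^ i * X.co κ i z := by positivity
      rw [h4i] at *
      linarith
  · obtain ⟨h3, h4⟩ := flux_mul_h_le_of_notMem hκ hκ1 hz ht h2 h1
    have h5 : X.flux z * X.h κ (i + 1) z ≤ 2 * X.D * 2 ^ i * X.co κ i z :=
      (mul_le_mul_of_nonneg_left (h_le_h_of_notMem h1) hfl).trans h4
    have h6 := mul_le_mul_of_nonneg_left h5 (show (0:ℝ) ≤ 2 ^ i by positivity)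
    have h7 : 2 ^ i * (2 * X.D * 2 ^ i * X.co κ i z) ≤ δ⁻¹ * (2 * X.D) * 4 ^ i * X.co κ i z := by
      rw [h4i]
      have : 0 ≤ 2 * X.D * (2 ^ i * 2 ^ i) * X.co κ i z := by positivity
      nlinarith
    have h8 : 0 ≤ δ * X.en κ i z := mul_nonneg hδ.le (en_nonneg z)
    have h10 : 0 ≤ δ⁻¹ * (2 * X.D) * 4 ^ i * X.co κ (i + 1) z := by positivity
    linarith

/-- The mismatch error over short pairs is a small multiple of the energy and the coercive
density, up to an integrable kernel. -/
lemma err_near_le (hκ : 0 < κ) (hκ1 : κ ≤ 1) {Λ ε : ℝ} (hΛ : 1 ≤ Λ) (hε : 0 < ε)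
    {z : Eu N × Eu N} (hz : ‖z.1 - z.2‖ ≤ X.ρ z.2) (ht : 0 < X.t z)
    (hh : 0 < X.h κ (i + 1) z) (hΛt : X.h κ (i + 1) z ≤ Λ * X.t z) :
    X.t z ^ (X.q - 1) / X.K₂ z * X.h κ (i + 1) z ≤
      Λ * (ε * X.en κ i z + ε * (2 * X.D ^ 2) * 4 ^ i * X.co κ i z +
        ε ^ (-(X.q / (X.p - X.q))) * ‖z.1 - z.2‖ ^ (gapExp X.s₁ X.s₂ X.p X.q - N)) := by
  have hD := one_le_D (X := X)
  have hco := co_nonneg (X := X) (j := i) hκ.le z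
  have hfl := flux_nonneg (X := X) z
  have h2 := mem_of_h_pos hh
  have h4i : (4:ℝ) ^ i = 2 ^ i * 2 ^ i := by rw [← mul_pow]; norm_num
  have hK2 := X.K₂_nonneg z
  have hint := energy_interpolation (n := N) (s₁ := X.s₁) (s₂ := X.s₂) X.hq X.hqp hε ht.le
    (dist_pos_of_t_pos ht)
  have split : ∀ r : ℝ, X.t z ^ r = X.t z ^ (r - 1) * X.t z := fun r => by
    nth_rewrite 3 [← Real.rpow_one (X.t z)]
    rw [← Real.rpow_add ht]; ring_nf
  have hP : X.t z ^ X.p / X.K₁ z ≤ X.t z * X.flux z := by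
    have : 0 ≤ X.t z ^ (X.q - 1) / X.K₂ z * X.t z := by positivity
    unfold flux
    rw [abs_of_pos ht, split X.p]
    calc _ = X.t z ^ (X.p - 1) / X.K₁ z * X.t z := by ring
      _ ≤ _ := by linarith
  have hE : X.t z * X.flux z ≤ X.en κ i z + 2 * X.D ^ 2 * 4 ^ i * X.co κ i z := by
    by_cases h1 : z.1 ∈ X.S κ i
    · rw [en_of_mem ht h1]
      have : 0 ≤ 2 * X.D ^ 2 * 4 ^ i * X.co κ i z := by positivity
      linarith
    · obtain ⟨h3, h4⟩ := flux_mul_h_le_of_notMem hκ hκ1 hz ht h2 h1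
      have h5 := mul_le_mul_of_nonneg_right (t_le_h hκ hz h2 h1) hfl
      have h6 := mul_le_mul_of_nonneg_left h4 (show 0 ≤ X.D * 2 ^ i by positivity)
      rw [h4i]
      linarith [en_nonneg (X := X) (κ := κ) (j := i) z]
  calc X.t z ^ (X.q - 1) / X.K₂ z * X.h κ (i + 1) z
      ≤ X.t z ^ (X.q - 1) / X.K₂ z * (Λ * X.t z) := by gcongr
    _ = Λ * (X.t z ^ X.q / X.K₂ z) := by rw [split X.q]; ring
    _ ≤ _ := by
        refine mul_le_mul_of_nonneg_left (hint.trans ?_) (by linarith)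
        have := mul_le_mul_of_nonneg_left (hP.trans hE) hε.le
        unfold K₁ at this
        linarith

/-- Over long pairs both `u` and the truncation are bounded by powers of the weight and of the
distance, so that the flux has an integrable bound; the `q`-part is better by the positive power
`(s₁ - s₂) * q` of the distance. -/
lemma exists_flux_far_le : ∃ C : ℝ, 0 < C ∧ ∀ κ, 0 < κ → ∀ j, ∀ z : Eu N × Eu N,
    X.ρ z.2 < ‖z.1 - z.2‖ → 0 < X.t z → 0 < X.h κ j z →
    X.flux z * X.h κ j z ≤ C * (X.ρ z.2 ^ X.s₁ * ‖z.1 - z.2‖ ^ (-X.s₁ - N)) ∧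
    X.t z ^ (X.q - 1) / X.K₂ z * X.h κ j z ≤
      C * (X.ρ z.2 ^ X.s₁ * ‖z.1 - z.2‖ ^ (-X.s₁ + (X.s₁ - X.s₂) * X.q - N)) := by
  have hC := X.hC₀
  have hR := X.hR
  have hq := X.hq
  have hp := X.hp
  have hss : 0 < X.s₁ - X.s₂ := sub_pos.2 X.hs
  set E : ℝ := X.R ^ ((X.s₁ - X.s₂) * X.q) with hE
  have hE1 : 1 ≤ E := Real.one_le_rpow hR (by positivity)
  set P : ℝ := (2 * X.C₀) ^ (X.p - 1)
  set Q : ℝ := (2 * X.C₀) ^ (X.q - 1)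
  have hP : 0 < P := by positivity
  have hQ : 0 < Q := by positivity
  refine ⟨(P + Q * E) * X.C₀, by positivity, fun κ hκ j z hz ht hh => ?_⟩
  set r := ‖z.1 - z.2‖ with hr
  have hr0 : 0 < r := dist_pos_of_t_pos ht
  have h2 := mem_of_h_pos hh
  have hrR : r ≤ X.R := X.diam_le _ (mem_of_t_pos ht) _ (S_subset hκ h2)
  have htr := t_le (X := X) (z := z) (r := r) hz.le le_rfl
  have hρ := X.ρ_nonneg z.2
  have hhρ : X.h κ j z ≤ X.C₀ * X.ρ z.2 ^ X.s₁ := by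
    refine le_trans ?_ (X.u_le _)
    have := ψ_le_u (X := X) (j := j) hκ z.2
    have := ψ_nonneg (X := X) (κ := κ) (j := j) z.1
    unfold h; linarith
  have b1 : X.t z ^ (X.p - 1) / X.K₁ z ≤ P * r ^ (-X.s₁ - N) := by
    have : X.t z ^ (X.p - 1) ≤ P * r ^ (X.s₁ * (X.p - 1)) := by
      rw [Real.rpow_mul hr0.le, ← Real.mul_rpow (by positivity) (by positivity)]
      exact Real.rpow_le_rpow ht.le htr (by linarith)
    unfold K₁
    rwa [← hr, div_le_iff₀ (by positivity), mul_assoc, ← Real.rpow_add hr0,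
      show -X.s₁ - (N:ℝ) + (N + X.s₁ * X.p) = X.s₁ * (X.p - 1) by ring]
  have b2 : X.t z ^ (X.q - 1) / X.K₂ z ≤ Q * r ^ (-X.s₁ + (X.s₁ - X.s₂) * X.q - N) := by
    have : X.t z ^ (X.q - 1) ≤ Q * r ^ (X.s₁ * (X.q - 1)) := by
      rw [Real.rpow_mul hr0.le, ← Real.mul_rpow (by positivity) (by positivity)]
      exact Real.rpow_le_rpow ht.le htr (by linarith)
    unfold K₂
    rwa [← hr, div_le_iff₀ (by positivity), mul_assoc, ← Real.rpow_add hr0,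
      show -X.s₁ + (X.s₁ - X.s₂) * X.q - (N:ℝ) + (N + X.s₂ * X.q) = X.s₁ * (X.q - 1) by ring]
  have b3 : r ^ (-X.s₁ + (X.s₁ - X.s₂) * X.q - N) ≤ E * r ^ (-X.s₁ - N) := by
    rw [show -X.s₁ + (X.s₁ - X.s₂) * X.q - (N:ℝ) = (X.s₁ - X.s₂) * X.q + (-X.s₁ - N) by ring,
      Real.rpow_add hr0]
    gcongr
    exact Real.rpow_le_rpow hr0.le hrR (by positivity)
  have hρs : 0 ≤ X.ρ z.2 ^ X.s₁ := by positivity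
  constructor
  · have b4 : X.flux z ≤ (P + Q * E) * r ^ (-X.s₁ - N) := by
      unfold flux
      rw [abs_of_pos ht]
      have := mul_le_mul_of_nonneg_left b3 hQ.le
      linarith
    calc X.flux z * X.h κ j z
        ≤ ((P + Q * E) * r ^ (-X.s₁ - N)) * (X.C₀ * X.ρ z.2 ^ X.s₁) := by gcongr
      _ = _ := by ring
  · have b5 : Q ≤ P + Q * E := by nlinarith
    have hK := X.K₂_nonneg z
    calc X.t z ^ (X.q - 1) / X.K₂ z * X.h κ j z
        ≤ (Q * r ^ (-X.s₁ + (X.s₁ - X.s₂) * X.q - N)) * (X.C₀ * X.ρ z.2 ^ X.s₁) := by gcongr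
      _ ≤ ((P + Q * E) * r ^ (-X.s₁ + (X.s₁ - X.s₂) * X.q - N)) * (X.C₀ * X.ρ z.2 ^ X.s₁) := by
          gcongr
      _ = _ := by ring


/-! ### Integrated bounds for the error and the energy -/

/-- The weighted measure of the `j`-th set. -/
noncomputable def Y (X : Config N) (τ κ : ℝ) (j : ℕ) : ENNReal :=
  ∫⁻ x in X.S κ j, ENNReal.ofReal (X.ρ x ^ τ)

lemma rpow_le_of_le_R {r α e : ℝ} (hr : 0 < r) (hrR : r ≤ X.R) (he : e ≤ α) :
    r ^ (α - N) ≤ X.R ^ (α - e) * r ^ (e - N) := by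
  rw [show α - (N:ℝ) = (α - e) + (e - N) by ring, Real.rpow_add hr]
  gcongr

variable (X) in
/-- The mismatch error is a small multiple of the energy and of the coercive energy, up to a weighted
measure of the next set. Short pairs are treated by interpolation between the two orders, long ones
directly. -/
lemma exists_Er_le {Λ τ : ℝ} (hΛ : 1 ≤ Λ) (hτ : 0 < τ) (hτ1 : τ ≤ X.s₁)
    (hτ2 : τ < (X.s₁ - X.s₂) * X.q) (hτ3 : τ < gapExp X.s₁ X.s₂ X.p X.q) :
    ∃ C : ℝ, 0 < C ∧ ∀ κ ε, 0 < κ → κ ≤ 1 → 0 < ε → ε ≤ 1 → ∀ i,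
      X.Er Λ κ (i + 1) ≤ ENNReal.ofReal (C * ε) * X.En κ i +
        ENNReal.ofReal (C * ε * 4 ^ i) * X.Co κ i +
        ENNReal.ofReal (C * ε ^ (-(X.q / (X.p - X.q)))) * X.Y τ κ (i + 1) := by
  classical
  obtain ⟨Cf, hCf, hfar⟩ := exists_flux_far_le (X := X)
  have hR := X.hR
  have hD := one_le_D (X := X)
  set σ := gapExp X.s₁ X.s₂ X.p X.q with hσ
  set α := (X.s₁ - X.s₂) * X.q with hα
  set a := X.q / (X.p - X.q) with ha
  have ha0 : 0 < a := by
    have := X.hqp; have := X.hq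
    exact div_pos (by linarith) (by linarith)
  set e := min σ α - τ with he
  have he0 : 0 < e := by have := lt_min hτ3 hτ2; linarith
  have e1 : e ≤ σ - τ := by have := min_le_left σ α; linarith
  have e2 : e ≤ α - τ := by have := min_le_right σ α; linarith
  set kk : Eu N → ℝ := fun x => if ‖x‖ ≤ X.R then ‖x‖ ^ (e - N) else 0 with hkk
  have hkkm : Measurable kk := Measurable.ite
    (measurableSet_le measurable_norm measurable_const) (by fun_prop) measurable_const
  have hkk0 : ∀ x, 0 ≤ kk x := fun x => by simp only [hkk]; split_ifs <;> positivity
  set Ck := (∫⁻ x, ENNReal.ofReal (kk x)).toReal with hCk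
  have hCk' : ∫⁻ x, ENNReal.ofReal (kk x) = ENNReal.ofReal Ck :=
    (ENNReal.ofReal_toReal (lintegral_norm_rpow_near X.hN he0 X.R).ne).symm
  set C₂ := Λ * X.R ^ (σ - τ - e) + Cf * X.R ^ (α - τ - e) with hC₂
  have hC₂0 : 0 < C₂ := by positivity
  have hC3 : 0 < Λ * (2 * X.D ^ 2) := by positivity
  refine ⟨Λ * (2 * X.D ^ 2) + C₂ * Ck, by positivity, fun κ ε hκ hκ1 hε hε1 i => ?_⟩
  have hεa : 1 ≤ ε ^ (-a) := Real.one_le_rpow_of_pos_of_le_one_of_nonpos hε hε1 (by linarith)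
  have pw : ∀ z : Eu N × Eu N, X.err Λ κ (i + 1) z ≤ Λ * ε * X.en κ i z +
      Λ * ε * (2 * X.D ^ 2) * 4 ^ i * X.co κ i z + C₂ * ε ^ (-a) *
        (if z.2 ∈ X.S κ (i + 1) then X.ρ z.2 ^ τ * kk (z.1 - z.2) else 0) := by
    intro z
    have q1 : 0 ≤ X.en κ i z := en_nonneg z
    have q2 := co_nonneg (X := X) (j := i) hκ.le z
    have hρ := X.ρ_nonneg z.2
    have q3 : 0 ≤ if z.2 ∈ X.S κ (i + 1) then X.ρ z.2 ^ τ * kk (z.1 - z.2) else 0 := by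
      have := hkk0 (z.1 - z.2)
      split_ifs <;> positivity
    by_cases hc : 0 < X.t z ∧ 0 < X.h κ (i + 1) z ∧ X.h κ (i + 1) z ≤ Λ * X.t z
    · obtain ⟨ht, hh, hht⟩ := hc
      have h2 := mem_of_h_pos hh
      set r := ‖z.1 - z.2‖ with hr
      have hr0 : 0 < r := dist_pos_of_t_pos ht
      have hrR : r ≤ X.R := X.diam_le _ (mem_of_t_pos ht) _ (S_subset hκ h2)
      have hkv : kk (z.1 - z.2) = r ^ (e - N) := by simp only [hkk]; rw [if_pos hrR]
      unfold err
      rw [if_pos ⟨ht, hh, hht⟩, if_pos h2, hkv]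
      have hρτ : 0 ≤ X.ρ z.2 ^ τ := by positivity
      by_cases hz : r ≤ X.ρ z.2
      · have := err_near_le hκ hκ1 hΛ hε hz ht hh hht
        rw [← hσ, ← ha, ← hr] at this
        have k1 : r ^ (σ - N) ≤ X.ρ z.2 ^ τ * (X.R ^ (σ - τ - e) * r ^ (e - N)) := by
          rw [show σ - (N:ℝ) = τ + (σ - τ - N) by ring, Real.rpow_add hr0]
          gcongr
          exact rpow_le_of_le_R hr0 hrR e1
        have k2 : Λ * (ε ^ (-a) * r ^ (σ - N)) ≤
            C₂ * ε ^ (-a) * (X.ρ z.2 ^ τ * r ^ (e - N)) := by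
          calc Λ * (ε ^ (-a) * r ^ (σ - N))
              ≤ Λ * (ε ^ (-a) * (X.ρ z.2 ^ τ * (X.R ^ (σ - τ - e) * r ^ (e - N)))) := by gcongr
            _ = (Λ * X.R ^ (σ - τ - e)) * ε ^ (-a) * (X.ρ z.2 ^ τ * r ^ (e - N)) := by ring
            _ ≤ _ := by
              gcongr
              rw [hC₂]
              exact le_add_of_nonneg_right (by positivity)
        linarith
      · push Not at hz
        have h3 := (hfar κ hκ (i + 1) z hz ht hh).2
        rw [← hr] at h3
        have hρ0 : 0 < X.ρ z.2 := ρ_pos_of_mem hκ h2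
        have k1 : X.ρ z.2 ^ X.s₁ * r ^ (-X.s₁ + α - N) ≤
            X.ρ z.2 ^ τ * (X.R ^ (α - τ - e) * r ^ (e - N)) := by
          rw [show X.s₁ = τ + (X.s₁ - τ) by ring, Real.rpow_add hρ0, mul_assoc]
          refine mul_le_mul_of_nonneg_left ?_ hρτ
          calc X.ρ z.2 ^ (X.s₁ - τ) * r ^ (-(τ + (X.s₁ - τ)) + α - N)
              ≤ r ^ (X.s₁ - τ) * r ^ (-(τ + (X.s₁ - τ)) + α - N) := by
                gcongr
            _ = r ^ (α - τ - N) := by rw [← Real.rpow_add hr0]; ring_nf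
            _ ≤ _ := rpow_le_of_le_R hr0 hrR e2
        have k2 : Cf * (X.ρ z.2 ^ X.s₁ * r ^ (-X.s₁ + α - N)) ≤
            C₂ * ε ^ (-a) * (X.ρ z.2 ^ τ * r ^ (e - N)) := by
          calc Cf * (X.ρ z.2 ^ X.s₁ * r ^ (-X.s₁ + α - N))
              ≤ Cf * (X.ρ z.2 ^ τ * (X.R ^ (α - τ - e) * r ^ (e - N))) := by gcongr
            _ = (Cf * X.R ^ (α - τ - e)) * 1 * (X.ρ z.2 ^ τ * r ^ (e - N)) := by ring
            _ ≤ _ := by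
              gcongr
              rw [hC₂]
              exact le_add_of_nonneg_left (by positivity)
        have : 0 ≤ Λ * ε * X.en κ i z + Λ * ε * (2 * X.D ^ 2) * 4 ^ i * X.co κ i z := by positivity
        linarith
    · unfold err
      rw [if_neg hc]
      positivity
  have hkint : ∫⁻ z : Eu N × Eu N, ENNReal.ofReal
      (if z.2 ∈ X.S κ (i + 1) then X.ρ z.2 ^ τ * kk (z.1 - z.2) else 0) ≤
      ENNReal.ofReal Ck * X.Y τ κ (i + 1) := by
    have := lintegral_prod_kernel_le (measurableSet_S (X := X) (κ := κ) (j := i + 1))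
      (f := fun y => X.ρ y ^ τ) (by have := X.measurable_ρ; fun_prop)
      (fun y => Real.rpow_nonneg (X.ρ_nonneg y) τ) (k := fun _ x => kk x)
      (hkkm.comp (measurable_fst.sub measurable_snd)) (w := fun _ => Ck) (fun y _ => hCk'.le)
    refine (le_of_eq ?_).trans (this.trans (le_of_eq ?_))
    · refine lintegral_congr fun z => ?_
      congr
    · unfold Y
      rw [← lintegral_const_mul' _ _ ENNReal.ofReal_ne_top]
      refine lintegral_congr fun y => ?_
      rw [mul_comm, ENNReal.ofReal_mul ENNReal.toReal_nonneg]
  have m1 : Measurable fun z : Eu N × Eu N => ENNReal.ofReal (X.en κ i z) :=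
    measurable_en.ennreal_ofReal
  have m2 : Measurable fun z : Eu N × Eu N => ENNReal.ofReal (X.co κ i z) :=
    measurable_co.ennreal_ofReal
  have hCk0 : 0 ≤ Ck := ENNReal.toReal_nonneg
  calc X.Er Λ κ (i + 1)
      ≤ ∫⁻ z : Eu N × Eu N, (ENNReal.ofReal (Λ * ε) * ENNReal.ofReal (X.en κ i z) +
          ENNReal.ofReal (Λ * ε * (2 * X.D ^ 2) * 4 ^ i) * ENNReal.ofReal (X.co κ i z) +
          ENNReal.ofReal (C₂ * ε ^ (-a)) * ENNReal.ofReal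
            (if z.2 ∈ X.S κ (i + 1) then X.ρ z.2 ^ τ * kk (z.1 - z.2) else 0)) := by
        refine lintegral_mono fun z => (ENNReal.ofReal_le_ofReal (pw z)).trans ?_
        rw [← ENNReal.ofReal_mul (by positivity), ← ENNReal.ofReal_mul (by positivity),
          ← ENNReal.ofReal_mul (by positivity)]
        exact ENNReal.ofReal_add_le.trans (add_le_add ENNReal.ofReal_add_le le_rfl)
    _ = ENNReal.ofReal (Λ * ε) * X.En κ i +
          ENNReal.ofReal (Λ * ε * (2 * X.D ^ 2) * 4 ^ i) * X.Co κ i +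
          ENNReal.ofReal (C₂ * ε ^ (-a)) * ∫⁻ z : Eu N × Eu N, ENNReal.ofReal
            (if z.2 ∈ X.S κ (i + 1) then X.ρ z.2 ^ τ * kk (z.1 - z.2) else 0) := by
        have m12 : Measurable fun z : Eu N × Eu N =>
            ENNReal.ofReal (Λ * ε) * ENNReal.ofReal (X.en κ i z) +
            ENNReal.ofReal (Λ * ε * (2 * X.D ^ 2) * 4 ^ i) * ENNReal.ofReal (X.co κ i z) :=
          (m1.const_mul _).add (m2.const_mul _)
        rw [lintegral_add_left m12,
          lintegral_add_left (m1.const_mul _), lintegral_const_mul' _ _ ENNReal.ofReal_ne_top,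
          lintegral_const_mul' _ _ ENNReal.ofReal_ne_top,
          lintegral_const_mul' _ _ ENNReal.ofReal_ne_top]
        rfl
    _ ≤ ENNReal.ofReal (Λ * ε) * X.En κ i +
          ENNReal.ofReal (Λ * ε * (2 * X.D ^ 2) * 4 ^ i) * X.Co κ i +
          ENNReal.ofReal (C₂ * ε ^ (-a)) * (ENNReal.ofReal Ck * X.Y τ κ (i + 1)) := by gcongr
    _ ≤ _ := by
        rw [← mul_assoc (ENNReal.ofReal (C₂ * ε ^ (-a))), ← ENNReal.ofReal_mul (by positivity)]
        have hDD : 1 ≤ 2 * X.D ^ 2 := by nlinarith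
        have z1 : 0 ≤ C₂ * Ck := by positivity
        gcongr ENNReal.ofReal ?_ * _ + ENNReal.ofReal ?_ * _ + ENNReal.ofReal ?_ * _
        · gcongr
          nlinarith
        · calc Λ * ε * (2 * X.D ^ 2) * 4 ^ i = (Λ * (2 * X.D ^ 2)) * ε * 4 ^ i := by ring
            _ ≤ _ := by gcongr; linarith
        · calc C₂ * ε ^ (-a) * Ck = (C₂ * Ck) * ε ^ (-a) := by ring
            _ ≤ _ := by gcongr; linarith


/-! ### The energy inequality -/

/-- The function which equals `u` on the `(j + 1)`-st set and vanishes off the `j`-th one. -/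
noncomputable def cut (X : Config N) (κ : ℝ) (j : ℕ) (x : Eu N) : ℝ :=
  min (X.u x) (X.b⁻¹ * 2 ^ j * X.ψ κ j x)

lemma cut_nonneg (x : Eu N) : 0 ≤ X.cut κ j x := by
  have := X.hb
  exact le_min (X.u_nonneg x) (mul_nonneg (by positivity) (ψ_nonneg x))

lemma cut_eq_of_mem_succ (hκ : 0 < κ) {x : Eu N} (hx : x ∈ X.S κ (j + 1)) :
    X.cut κ j x = X.u x := by
  have hb := X.hb
  refine min_eq_left ?_
  have h := mul_le_mul_of_nonneg_left (ψ_ge_of_mem_succ hκ hx)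
    (show 0 ≤ X.b⁻¹ * 2 ^ j by positivity)
  refine le_trans (le_of_eq ?_) h
  rw [div_pow, one_pow]
  field_simp

lemma cut_eq_zero {x : Eu N} (hx : x ∉ X.S κ j) : X.cut κ j x = 0 := by
  unfold cut
  rw [notMem_S.1 hx, mul_zero]
  exact min_eq_right (X.u_nonneg x)

lemma nice_cut (hκ : 0 < κ) : X.Nice (X.cut κ j) := by
  have hb := X.hb
  have hψ := measurable_ψ (X := X) (κ := κ) (j := j)
  have hu := X.measurable_u
  refine nice_of_abs_sub_le (by unfold cut; fun_prop) ⟨X.M, fun x => ?_⟩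
    (fun x hx => cut_eq_zero fun h => hx (S_subset hκ h))
    (C := 1 + X.b⁻¹ * 2 ^ j * (1 + 2 / κ)) (fun x y => ?_)
  · rw [abs_of_nonneg (cut_nonneg x)]; exact (min_le_left _ _).trans (u_le_M x)
  · set m := max |X.u x - X.u y| |X.v x - X.v y| with hm
    have h1 : |X.u x - X.u y| ≤ m := le_max_left _ _
    have h2 : |X.v x - X.v y| ≤ m := le_max_right _ _
    have hm0 : 0 ≤ m := (abs_nonneg _).trans h1
    have h3 : |X.ψ κ j x - X.ψ κ j y| ≤ (1 + 2 / κ) * m := abs_ψ_sub_le hκ x y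
    unfold cut
    refine (abs_min_sub_min_le_max _ _ _ _).trans (max_le ?_ ?_)
    · have : 0 ≤ X.b⁻¹ * 2 ^ j * (1 + 2 / κ) * m := by positivity
      linarith
    · rw [← mul_sub, abs_mul, abs_of_nonneg (show 0 ≤ X.b⁻¹ * 2 ^ j by positivity)]
      have := mul_le_mul_of_nonneg_left h3 (show 0 ≤ X.b⁻¹ * 2 ^ j by positivity)
      linarith

open Classical in
/-- The flux of `u` against the drop of the truncation, over the pairs on which it is positive. -/
noncomputable def bf (X : Config N) (κ : ℝ) (j : ℕ) (z : Eu N × Eu N) : ℝ :=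
  if 0 < X.t z ∧ 0 < X.h κ j z then X.flux z * X.h κ j z else 0

lemma bf_nonneg (z : Eu N × Eu N) : 0 ≤ X.bf κ j z := by
  unfold bf
  split_ifs with h
  exacts [mul_nonneg (flux_nonneg z) h.2.le, le_rfl]

lemma measurable_bf : Measurable (X.bf κ j) := by
  have h1 := measurable_t (X := X)
  have h2 := measurable_h (X := X) (κ := κ) (j := j)
  have h3 := measurable_flux (X := X)
  unfold bf
  exact Measurable.ite ((measurableSet_lt measurable_const h1).inter
    (measurableSet_lt measurable_const h2)) (h3.mul h2) measurable_const

lemma form_eq_flux_mul {φ : Eu N → ℝ} {z : Eu N × Eu N} (ht : 0 ≤ X.t z) :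
    X.form X.u φ z = X.flux z * (φ z.1 - φ z.2) := by
  unfold form flux
  rw [show X.u z.1 - X.u z.2 = X.t z from rfl, J_of_nonneg X.hp ht, J_of_nonneg X.hq ht,
    abs_of_nonneg ht]
  ring

/-- The pointwise estimate behind the energy inequality. -/
lemma en_le_form (hκ : 0 < κ) (z : Eu N × Eu N) : X.en κ (j + 1) z ≤
    X.form X.u (X.cut κ j) z + (X.b⁻¹ * 2 ^ j) * (X.bf κ j z + X.bf κ j z.swap) := by
  have hb := X.hb
  set c := X.b⁻¹ * 2 ^ j with hc
  have hc0 : 0 < c := by positivity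
  have main : ∀ z : Eu N × Eu N, 0 ≤ X.t z →
      X.en κ (j + 1) z ≤ X.form X.u (X.cut κ j) z + c * X.bf κ j z := by
    intro z ht
    have hfl := flux_nonneg (X := X) z
    have hbf := bf_nonneg (X := X) (κ := κ) (j := j) z
    rw [form_eq_flux_mul ht]
    have hy : X.cut κ j z.2 ≤ X.u z.2 := min_le_left _ _
    by_cases h1 : 0 < X.t z ∧ z.1 ∈ X.S κ (j + 1)
    · unfold en
      rw [if_pos h1, cut_eq_of_mem_succ hκ h1.2]
      have : X.flux z * X.t z ≤ X.flux z * (X.u z.1 - X.cut κ j z.2) := by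
        gcongr
        unfold t; linarith
      have := mul_nonneg hc0.le hbf
      linarith
    · unfold en
      rw [if_neg h1]
      rcases ht.eq_or_lt with h0 | h0
      · have : X.flux z = 0 := by
          unfold flux
          rw [← h0, abs_zero, Real.zero_rpow (by linarith [X.hp]),
            Real.zero_rpow (by linarith [X.hq])]
          simp
        rw [this, zero_mul, zero_add]
        positivity
      · rcases le_or_gt (X.cut κ j z.2) (X.cut κ j z.1) with h2 | h2
        · have := mul_nonneg hfl (sub_nonneg.2 h2)
          positivity
        · have hx : X.cut κ j z.1 = c * X.ψ κ j z.1 := by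
            refine (min_choice (X.u z.1) (c * X.ψ κ j z.1)).resolve_left fun h3 => ?_
            have h4 : X.cut κ j z.1 = X.u z.1 := h3
            unfold t at h0
            linarith
          have hy2 : X.cut κ j z.2 ≤ c * X.ψ κ j z.2 := min_le_right _ _
          have h3 : X.cut κ j z.2 - X.cut κ j z.1 ≤ c * X.h κ j z := by
            unfold h; linarith
          have h4 : 0 < X.h κ j z := by
            have : 0 < c * X.h κ j z := by linarith
            exact (mul_pos_iff_of_pos_left hc0).1 this
          unfold bf
          rw [if_pos ⟨h0, h4⟩]
          have := mul_le_mul_of_nonneg_left h3 hfl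
          linarith
  rcases le_total 0 (X.t z) with ht | ht
  · have := mul_nonneg hc0.le (bf_nonneg (X := X) (κ := κ) (j := j) z.swap)
    linarith [main z ht]
  · have h1 := main z.swap (by rw [t_swap]; linarith)
    rw [form_swap] at h1
    have h2 := en_nonneg (X := X) (κ := κ) (j := j + 1) z.swap
    have h3 : X.en κ (j + 1) z = 0 := by
      unfold en
      rw [if_neg fun h => by linarith [h.1]]
    have := mul_nonneg hc0.le (bf_nonneg (X := X) (κ := κ) (j := j) z)
    linarith

variable (X) in
/-- The energy inequality: the equation of `u` tested with the cut-off of `u`. -/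
lemma exists_En_le : ∃ C : ℝ, 0 < C ∧ ∀ κ δ, 0 < κ → κ ≤ 1 → 0 < δ → δ ≤ 1 → ∀ i,
    X.En κ (i + 2) ≤ ENNReal.ofReal δ * X.En κ i +
      ENNReal.ofReal (C * δ⁻¹ * 4 ^ i) * (X.Co κ (i + 1) + X.Co κ i) +
      ENNReal.ofReal (C * 2 ^ i) * volume (X.S κ (i + 1)) := by
  classical
  obtain ⟨Cf, hCf, hfar⟩ := exists_flux_far_le (X := X)
  obtain ⟨Ck, hCk, hker⟩ := lintegral_norm_rpow_far X.hN X.s₁_pos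
  have hb := X.hb; have hb1 := X.hb1; have hL := X.hL; have hM := X.hM
  have hD := one_le_D (X := X)
  have hbi : 1 ≤ X.b⁻¹ := (one_le_inv₀ hb).2 hb1
  refine ⟨32 * X.D * (X.b⁻¹ * X.b⁻¹) + 4 * X.b⁻¹ * Cf * Ck + X.L * X.M, by positivity,
    fun κ δ hκ hκ1 hδ hδ1 i => ?_⟩
  set kk : Eu N → Eu N → ℝ :=
    fun y x => if X.ρ y < ‖x‖ then ‖x‖ ^ (-X.s₁ - N) else 0 with hkk
  have hkkm : Measurable fun z : Eu N × Eu N => kk z.2 (z.1 - z.2) := by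
    have := X.measurable_ρ
    refine Measurable.ite (measurableSet_lt (by fun_prop) (by fun_prop)) (by fun_prop)
      measurable_const
  have hkk0 : ∀ y x, 0 ≤ kk y x := fun y x => by simp only [hkk]; split_ifs <;> positivity
  set c := X.b⁻¹ * 2 ^ (i + 1) with hc
  have hc0 : 0 < c := by positivity
  have hfi : ∀ z : Eu N × Eu N,
      0 ≤ if z.2 ∈ X.S κ (i + 1) then X.ρ z.2 ^ X.s₁ * kk z.2 (z.1 - z.2) else 0 := fun z => by
    have := hkk0 z.2 (z.1 - z.2); have := X.ρ_nonneg z.2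
    split_ifs <;> positivity
  have pw : ∀ z : Eu N × Eu N, c * X.bf κ (i + 1) z ≤ δ / 2 * X.en κ i z +
      16 * X.D * (X.b⁻¹ * X.b⁻¹) * δ⁻¹ * 4 ^ i * (X.co κ (i + 1) z + X.co κ i z) +
      c * Cf * (if z.2 ∈ X.S κ (i + 1) then X.ρ z.2 ^ X.s₁ * kk z.2 (z.1 - z.2) else 0) := by
    intro z
    have q1 : 0 ≤ X.en κ i z := en_nonneg z
    have q2 := co_nonneg (X := X) (j := i) hκ.le z
    have q3 := co_nonneg (X := X) (j := i + 1) hκ.le z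
    have q4 := hfi z
    by_cases hz : 0 < X.t z ∧ 0 < X.h κ (i + 1) z
    · unfold bf
      rw [if_pos hz]
      obtain ⟨ht, hh⟩ := hz
      rcases le_or_gt ‖z.1 - z.2‖ (X.ρ z.2) with hr | hr
      · -- this choice makes the two copies of the energy term add up to `δ`
        have h1 := flux_near_le (δ := δ * X.b / 4) hκ hκ1 (by positivity) (by nlinarith) hr ht hh
        have h2 := mul_le_mul_of_nonneg_left h1 (show 0 ≤ 2 * X.b⁻¹ by positivity)
        have e1 : 2 * X.b⁻¹ * (2 ^ i * (X.flux z * X.h κ (i + 1) z)) =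
            c * (X.flux z * X.h κ (i + 1) z) := by rw [hc, pow_succ]; ring
        have e2 : 2 * X.b⁻¹ * (δ * X.b / 4 * X.en κ i z + (δ * X.b / 4)⁻¹ * (2 * X.D) * 4 ^ i *
            (X.co κ (i + 1) z + X.co κ i z)) = δ / 2 * X.en κ i z +
            16 * X.D * (X.b⁻¹ * X.b⁻¹) * δ⁻¹ * 4 ^ i * (X.co κ (i + 1) z + X.co κ i z) := by
          field_simp
          ring
        rw [e1, e2] at h2
        have := mul_nonneg (mul_nonneg hc0.le hCf.le) q4
        linarith
      · have h1 := (hfar κ hκ (i + 1) z hr ht hh).1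
        rw [if_pos (mem_of_h_pos hh), show kk z.2 (z.1 - z.2) = ‖z.1 - z.2‖ ^ (-X.s₁ - (N:ℝ)) by
          simp only [hkk]; rw [if_pos hr]]
        have h2 := mul_le_mul_of_nonneg_left h1 hc0.le
        have h3 : 0 ≤ δ / 2 * X.en κ i z +
          16 * X.D * (X.b⁻¹ * X.b⁻¹) * δ⁻¹ * 4 ^ i * (X.co κ (i + 1) z + X.co κ i z) := by
          positivity
        linarith
    · unfold bf
      rw [if_neg hz, mul_zero]
      positivity
  have hint : ∫⁻ z : Eu N × Eu N, ENNReal.ofReal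
      (if z.2 ∈ X.S κ (i + 1) then X.ρ z.2 ^ X.s₁ * kk z.2 (z.1 - z.2) else 0) ≤
      ENNReal.ofReal Ck * volume (X.S κ (i + 1)) := by
    have := lintegral_prod_kernel_le (measurableSet_S (X := X) (κ := κ) (j := i + 1))
      (f := fun y => X.ρ y ^ X.s₁) (by have := X.measurable_ρ; fun_prop)
      (fun y => Real.rpow_nonneg (X.ρ_nonneg y) X.s₁) (k := kk) hkkm
      (w := fun y => Ck * X.ρ y ^ (-X.s₁)) (fun y hy => hker _ (ρ_pos_of_mem hκ hy))
    refine (le_of_eq ?_).trans (this.trans (le_of_eq ?_))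
    · refine lintegral_congr fun z => ?_
      congr
    · rw [← setLIntegral_const]
      refine setLIntegral_congr_fun measurableSet_S fun y hy => ?_
      have hρ := ρ_pos_of_mem hκ hy
      rw [mul_left_comm, ← Real.rpow_add hρ, add_neg_cancel, Real.rpow_zero, mul_one]
  have m1 : Measurable fun z : Eu N × Eu N => ENNReal.ofReal (X.en κ i z) :=
    measurable_en.ennreal_ofReal
  have m2 : ∀ j, Measurable fun z : Eu N × Eu N => ENNReal.ofReal (X.co κ j z) := fun j =>
    measurable_co.ennreal_ofReal
  set c₂ := 16 * X.D * (X.b⁻¹ * X.b⁻¹) * δ⁻¹ * 4 ^ i with hc₂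
  have hc₂0 : 0 ≤ c₂ := by positivity
  have hbf : ∫⁻ z, ENNReal.ofReal (c * X.bf κ (i + 1) z) ≤ ENNReal.ofReal (δ / 2) * X.En κ i +
      ENNReal.ofReal c₂ * (X.Co κ (i + 1) + X.Co κ i) +
      ENNReal.ofReal (c * Cf) * (ENNReal.ofReal Ck * volume (X.S κ (i + 1))) := by
    have m12 : Measurable fun z : Eu N × Eu N =>
        ENNReal.ofReal (δ / 2) * ENNReal.ofReal (X.en κ i z) + ENNReal.ofReal c₂ *
          (ENNReal.ofReal (X.co κ (i + 1) z) + ENNReal.ofReal (X.co κ i z)) :=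
      (m1.const_mul _).add (((m2 _).add (m2 _)).const_mul _)
    calc ∫⁻ z, ENNReal.ofReal (c * X.bf κ (i + 1) z)
        ≤ ∫⁻ z, (ENNReal.ofReal (δ / 2) * ENNReal.ofReal (X.en κ i z) + ENNReal.ofReal c₂ *
            (ENNReal.ofReal (X.co κ (i + 1) z) + ENNReal.ofReal (X.co κ i z)) +
          ENNReal.ofReal (c * Cf) * ENNReal.ofReal
            (if z.2 ∈ X.S κ (i + 1) then X.ρ z.2 ^ X.s₁ * kk z.2 (z.1 - z.2) else 0)) := by
          refine lintegral_mono fun z => (ENNReal.ofReal_le_ofReal (pw z)).trans ?_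
          rw [← ENNReal.ofReal_add (co_nonneg hκ.le z) (co_nonneg hκ.le z),
            ← ENNReal.ofReal_mul (by positivity), ← ENNReal.ofReal_mul hc₂0,
            ← ENNReal.ofReal_mul (by positivity)]
          exact ENNReal.ofReal_add_le.trans (add_le_add ENNReal.ofReal_add_le le_rfl)
      _ = ENNReal.ofReal (δ / 2) * X.En κ i +
          ENNReal.ofReal c₂ * (X.Co κ (i + 1) + X.Co κ i) +
          ENNReal.ofReal (c * Cf) * ∫⁻ z : Eu N × Eu N, ENNReal.ofReal
            (if z.2 ∈ X.S κ (i + 1) then X.ρ z.2 ^ X.s₁ * kk z.2 (z.1 - z.2) else 0) := by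
          rw [lintegral_add_left m12, lintegral_add_left (m1.const_mul _),
            lintegral_const_mul' _ _ ENNReal.ofReal_ne_top,
            lintegral_const_mul' _ _ ENNReal.ofReal_ne_top,
            lintegral_const_mul' _ _ ENNReal.ofReal_ne_top, lintegral_add_left (m2 _)]
          rfl
      _ ≤ _ := by gcongr
  have hform := integrable_form (X := X) nice_u (nice_cut (X := X) (κ := κ) (j := i + 1) hκ)
  have hcn := nice_cut (X := X) (κ := κ) (j := i + 1) hκ
  have hsub : ENNReal.ofReal (∫ z, X.form X.u (X.cut κ (i + 1)) z) ≤
      ENNReal.ofReal (X.L * X.M) * volume (X.S κ (i + 1)) := by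
    rw [integral_form nice_u hcn]
    have hS : volume (X.S κ (i + 1)) ≠ ⊤ :=
      ((measure_mono (S_subset hκ)).trans_lt X.volume_Ω).ne
    have hI : ∫ x in X.Ω, X.cut κ (i + 1) x ≤ X.M * (volume (X.S κ (i + 1))).toReal := by
      have e : ∫ x in X.Ω, X.cut κ (i + 1) x = ∫ x in X.S κ (i + 1), X.cut κ (i + 1) x :=
        setIntegral_eq_of_subset_of_forall_sdiff_eq_zero X.measurable_Ω (S_subset hκ)
          fun x hx => cut_eq_zero hx.2
      rw [e]
      refine (le_abs_self _).trans ?_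
      rw [← Real.norm_eq_abs]
      refine norm_setIntegral_le_of_norm_le_const (lt_top_iff_ne_top.2 hS) fun x _ => ?_
      rw [Real.norm_eq_abs, abs_of_nonneg (cut_nonneg x)]
      exact (min_le_left _ _).trans (u_le_M x)
    have h1 := X.u_sub _ hcn.memW0 cut_nonneg
    have h2 : X.L * ∫ x in X.Ω, X.cut κ (i + 1) x ≤
        X.L * X.M * (volume (X.S κ (i + 1))).toReal := by
      rw [mul_assoc]; gcongr
    refine (ENNReal.ofReal_le_ofReal (h1.trans h2)).trans (le_of_eq ?_)
    rw [ENNReal.ofReal_mul (by positivity), ENNReal.ofReal_toReal hS]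
  have key := lintegral_le_of_le_add (μ := volume) (W := fun z => X.en κ (i + 2) z)
    (X := fun z => X.form X.u (X.cut κ (i + 1)) z)
    (Y := fun z => c * (X.bf κ (i + 1) z + X.bf κ (i + 1) z.swap)) hform
    (fun z => mul_nonneg hc0.le (add_nonneg (bf_nonneg _) (bf_nonneg _)))
    (fun z => en_le_form hκ z) en_nonneg
  have eY : ∫⁻ z, ENNReal.ofReal (c * (X.bf κ (i + 1) z + X.bf κ (i + 1) z.swap)) =
      2 * ∫⁻ z, ENNReal.ofReal (c * X.bf κ (i + 1) z) := by
    have mb : Measurable fun z => ENNReal.ofReal (c * X.bf κ (i + 1) z) :=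
      (measurable_bf.const_mul c).ennreal_ofReal
    simp_rw [mul_add, ENNReal.ofReal_add (mul_nonneg hc0.le (bf_nonneg _))
      (mul_nonneg hc0.le (bf_nonneg _))]
    rw [lintegral_add_left mb, Measure.volume_eq_prod,
      lintegral_prod_swap (fun z => ENNReal.ofReal (c * X.bf κ (i + 1) z)), two_mul]
  rw [eY] at key
  set E := X.En κ i
  set V := volume (X.S κ (i + 1))
  set W := X.Co κ (i + 1) + X.Co κ i
  have two : (2 : ENNReal) = ENNReal.ofReal 2 := by simp
  calc X.En κ (i + 2) ≤ ENNReal.ofReal (X.L * X.M) * V + 2 * (ENNReal.ofReal (δ / 2) * E +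
        ENNReal.ofReal c₂ * W + ENNReal.ofReal (c * Cf) * (ENNReal.ofReal Ck * V)) :=
        key.trans (by gcongr)
    _ = ENNReal.ofReal δ * E + ENNReal.ofReal (2 * c₂) * W +
        ENNReal.ofReal (X.L * X.M + 2 * (c * Cf) * Ck) * V := by
        rw [ENNReal.ofReal_add (by positivity) (by positivity), two,
          ENNReal.ofReal_mul (show 0 ≤ 2 * (c * Cf) by positivity),
          ENNReal.ofReal_mul (show (0:ℝ) ≤ 2 by norm_num) (q := c * Cf),
          ENNReal.ofReal_mul (show (0:ℝ) ≤ 2 by norm_num) (q := c₂),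
          show ENNReal.ofReal δ = ENNReal.ofReal 2 * ENNReal.ofReal (δ / 2) by
            rw [← ENNReal.ofReal_mul (by norm_num)]; congr 1; ring]
        ring
    _ ≤ _ := by
        have z1 : 0 ≤ X.L * X.M := by positivity
        have z2 : 0 ≤ 4 * X.b⁻¹ * Cf * Ck := by positivity
        have z3 : 0 ≤ 32 * X.D * (X.b⁻¹ * X.b⁻¹) := by positivity
        have z4 : (1:ℝ) ≤ 2 ^ i := one_le_pow₀ (by norm_num)
        gcongr ENNReal.ofReal ?_ * _ + ENNReal.ofReal ?_ * _ + ENNReal.ofReal ?_ * _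
        · exact le_rfl
        · calc 2 * c₂ = (32 * X.D * (X.b⁻¹ * X.b⁻¹)) * δ⁻¹ * 4 ^ i := by rw [hc₂]; ring
            _ ≤ _ := by gcongr; linarith
        · calc X.L * X.M + 2 * (c * Cf) * Ck
              = X.L * X.M * 1 + (4 * X.b⁻¹ * Cf * Ck) * 2 ^ i := by rw [hc, pow_succ]; ring
            _ ≤ X.L * X.M * 2 ^ i + (4 * X.b⁻¹ * Cf * Ck) * 2 ^ i := by gcongr
            _ = (0 + 4 * X.b⁻¹ * Cf * Ck + X.L * X.M) * 2 ^ i := by ring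
            _ ≤ _ := by gcongr


/-! ### Hardy and Faber–Krahn inequalities for the coercive energy -/

/-- Lower bound for the coercive density, valid for `X.p` on either side of `2`. -/
lemma le_co {z : Eu N × Eu N} {m m' W K : ℝ} (hm : 0 < m) (hm' : 0 < m')
    (h1 : m' ≤ |X.t z| + κ * |X.h κ j z|) (h2 : |X.t z| + κ * |X.h κ j z| ≤ W)
    (h3 : m ≤ |X.h κ j z|) (h4 : X.K₁ z ≤ K) :
    m' ^ X.p * m ^ 2 / (W ^ 2 * K) ≤ X.co κ j z := by
  have hp := X.hp
  set w := |X.t z| + κ * |X.h κ j z| with hw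
  have hw0 : 0 < w := hm'.trans_le h1
  have hne : z.1 ≠ z.2 := fun e => by
    have : X.h κ j z = 0 := by unfold h; rw [e, sub_self]
    rw [this, abs_zero] at h3; linarith
  have hK : 0 < X.K₁ z := Real.rpow_pos_of_pos (norm_pos_iff.2 (sub_ne_zero.2 hne)) _
  have h5 : m' ^ X.p / W ^ 2 ≤ w ^ (X.p - 2) := by
    rw [Real.rpow_sub hw0, Real.rpow_two]
    gcongr
  have h6 : 0 ≤ w ^ (X.q - 2) * |X.h κ j z| ^ 2 / X.K₂ z :=
    div_nonneg (by positivity) (X.K₂_nonneg z)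
  unfold co
  rw [← hw]
  calc m' ^ X.p * m ^ 2 / (W ^ 2 * K) = m' ^ X.p / W ^ 2 * m ^ 2 / K := by field_simp
    _ ≤ w ^ (X.p - 2) * |X.h κ j z| ^ 2 / X.K₁ z := by gcongr
    _ ≤ _ := by linarith

lemma ofReal_mul_volume_le {a s : ℝ} (ha : 0 ≤ a) {T : Set (Eu N)} (hT : MeasurableSet T)
    (hs : ENNReal.ofReal s ≤ volume T) {f : Eu N → ℝ} (h : ∀ x ∈ T, a ≤ f x) :
    ENNReal.ofReal (a * s) ≤ ∫⁻ x, ENNReal.ofReal (f x) := by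
  rw [ENNReal.ofReal_mul ha]
  calc ENNReal.ofReal a * ENNReal.ofReal s ≤ ENNReal.ofReal a * volume T := by gcongr
    _ = ∫⁻ _ in T, ENNReal.ofReal a := (setLIntegral_const _ _).symm
    _ ≤ ∫⁻ x in T, ENNReal.ofReal (f x) :=
        setLIntegral_mono' hT fun x hx => ENNReal.ofReal_le_ofReal (h x hx)
    _ ≤ _ := setLIntegral_le_lintegral _ _

/-- The volume of the unit ball. -/
noncomputable def unitBall (N : ℕ) : ℝ := (volume (Metric.ball (0 : Eu N) 1)).toReal

lemma unitBall_pos : 0 < unitBall N :=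
  ENNReal.toReal_pos (Metric.measure_ball_pos _ _ one_pos).ne' measure_ball_lt_top.ne

lemma volume_ball_eq (hN : 1 ≤ N) (x : Eu N) {r : ℝ} (hr : 0 ≤ r) :
    volume (Metric.ball x r) = ENNReal.ofReal (unitBall N * r ^ (N : ℝ)) := by
  have := nontrivial_Eu hN
  rw [Measure.addHaar_ball _ _ hr, finrank_euclideanSpace, Fintype.card_fin, mul_comm,
    ENNReal.ofReal_mul unitBall_pos.le, unitBall, ENNReal.ofReal_toReal measure_ball_lt_top.ne,
    Real.rpow_natCast]

variable (X) in
/-- Hardy-type lower bound: near the closest zero of the weight, the truncation is much smaller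
than at `y`. -/
lemma exists_hardy : ∃ c : ℝ, 0 < c ∧ ∀ κ, 0 < κ → κ ≤ 1 → ∀ j, ∀ y ∈ X.S κ (j + 1),
    ENNReal.ofReal (c * ((1 / 2 : ℝ) ^ j) ^ (X.p + 2 + N / X.s₁)) ≤
      ∫⁻ x, ENNReal.ofReal (X.co κ j (x, y)) := by
  have hb := X.hb; have hb1 := X.hb1; have hc := X.hc₀; have hC := X.hC₀
  have hD := one_le_D (X := X)
  have hs := X.s₁_pos
  have hp := X.hp
  have hω := unitBall_pos (N := N)
  refine ⟨(X.b * X.c₀ / 2) ^ X.p * (1 / (2 * X.D)) ^ 2 * (1 / 2) ^ (N + X.s₁ * X.p) *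
    (unitBall N * (1 / X.D) ^ (N / X.s₁)), by positivity, fun κ hκ hκ1 j y hy => ?_⟩
  set L : ℝ := (1 / 2) ^ j with hL
  have hL0 : 0 < L := by positivity
  have hL1 : L ≤ 1 := pow_le_one₀ (by norm_num) (by norm_num)
  have hρ := ρ_pos_of_mem hκ hy
  set ρ := X.ρ y with hρd
  have hyΩ := S_subset hκ hy
  obtain ⟨z, hz, hz0⟩ := X.ρ_proj y hyΩ
  have hψy := ψ_ge_of_mem_succ hκ hy
  have huy := le_u_of_mem hκ hy
  rw [← hL] at hψy
  rw [← hρd] at huy hz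
  -- within distance `δ * ρ` of the zero `z`, `u` is at most half the lower bound of the truncation
  -- at `y`
  set δ := (L / X.D) ^ (1 / X.s₁) with hδ
  have hLD : L / X.D ≤ 1 := by rw [div_le_one (by linarith)]; linarith
  have hδ0 : 0 < δ := by positivity
  have hδ1 : δ ≤ 1 := Real.rpow_le_one (by positivity) hLD (by positivity)
  have hδs : δ ^ X.s₁ = L / X.D := by
    rw [hδ, ← Real.rpow_mul (by positivity), one_div_mul_cancel hs.ne', Real.rpow_one]
  set P := ρ ^ X.s₁ with hP
  have hP0 : 0 < P := by positivity
  set m := X.b * X.c₀ / 2 * L * P with hm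
  have hm0 : 0 < m := by positivity
  have hψm : 2 * m ≤ X.ψ κ j y := by
    refine le_trans (le_of_eq ?_) ((mul_le_mul_of_nonneg_left huy
      (show 0 ≤ X.b * L by positivity)).trans hψy)
    rw [hm]; ring
  have key : ∀ x ∈ Metric.ball z (δ * ρ), m ^ X.p * m ^ 2 /
      ((2 * X.C₀ * P) ^ 2 * (2 * ρ) ^ (N + X.s₁ * X.p)) ≤ X.co κ j (x, y) := by
    intro x hx
    rw [mem_ball_iff_norm] at hx
    have hρx : X.ρ x ≤ δ * ρ := by
      have := X.ρ_lip x z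
      rw [hz0] at this; linarith
    have hux : X.u x ≤ m := by
      refine (X.u_le x).trans ?_
      calc X.C₀ * X.ρ x ^ X.s₁ ≤ X.C₀ * (δ * ρ) ^ X.s₁ := by
            have := X.ρ_nonneg x
            gcongr
        _ = m := by
            rw [Real.mul_rpow hδ0.le hρ.le, hδs, hm]
            unfold D
            field_simp
            exact hP.symm
    have hψx := ψ_le_u (X := X) (j := j) hκ x
    have hψx0 := ψ_nonneg (X := X) (κ := κ) (j := j) x
    have hψyu := ψ_le_u (X := X) (j := j) hκ y
    have huy' : X.u y ≤ X.C₀ * P := X.u_le y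
    have hh : X.h κ j (x, y) = X.ψ κ j y - X.ψ κ j x := rfl
    have ht : X.t (x, y) = -(X.u y - X.u x) := by unfold t; ring
    have hh0 : 0 ≤ X.h κ j (x, y) := by rw [hh]; linarith
    have ht0 : 0 ≤ X.u y - X.u x := by linarith
    have hux0 := X.u_nonneg x
    refine le_co hm0 hm0 ?_ ?_ ?_ ?_
    · rw [ht, abs_neg, abs_of_nonneg ht0]
      have := mul_nonneg hκ.le (abs_nonneg (X.h κ j (x, y)))
      linarith
    · rw [ht, abs_neg, abs_of_nonneg ht0, abs_of_nonneg hh0]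
      have : κ * X.h κ j (x, y) ≤ 1 * X.h κ j (x, y) := by gcongr
      rw [hh] at *
      linarith
    · rw [abs_of_nonneg hh0, hh]; linarith
    · unfold K₁
      refine Real.rpow_le_rpow (norm_nonneg _) ?_ (by positivity)
      have := norm_sub_le_norm_sub_add_norm_sub x z y
      rw [norm_sub_rev z y] at this
      have : δ * ρ ≤ 1 * ρ := by gcongr
      simp only
      linarith
  have hvol := volume_ball_eq X.hN z (show 0 ≤ δ * ρ by positivity)
  refine le_trans (le_of_eq ?_) (ofReal_mul_volume_le (by positivity) measurableSet_ball
    hvol.ge key)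
  congr 1
  have e1 : (2 * X.C₀ * P) = m * (2 * X.D / L) := by
    rw [hm]; unfold D; field_simp
  have e2 : m ^ X.p = (X.b * X.c₀ / 2) ^ X.p * L ^ X.p * ρ ^ (X.s₁ * X.p) := by
    rw [hm, Real.mul_rpow (by positivity) hP0.le, Real.mul_rpow (by positivity) hL0.le, hP,
      ← Real.rpow_mul hρ.le]
  have e3 : (δ * ρ) ^ (N : ℝ) = (1 / X.D) ^ (N / X.s₁) * L ^ (N / X.s₁) * ρ ^ (N : ℝ) := by
    rw [Real.mul_rpow hδ0.le hρ.le, hδ, ← Real.rpow_mul (by positivity),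
      ← Real.mul_rpow (by positivity) (by positivity), div_mul_eq_mul_div, one_mul]
    ring_nf
  have e4 : (2 * ρ) ^ (N + X.s₁ * X.p) =
      2 ^ (N + X.s₁ * X.p) * (ρ ^ (N : ℝ) * ρ ^ (X.s₁ * X.p)) := by
    rw [Real.mul_rpow (by norm_num) hρ.le, Real.rpow_add hρ]
  have e5 : L ^ (X.p + 2 + N / X.s₁) = L ^ X.p * L ^ 2 * L ^ (N / X.s₁) := by
    rw [Real.rpow_add hL0, Real.rpow_add hL0, Real.rpow_two]
  have e6 : ((1:ℝ) / 2) ^ (N + X.s₁ * X.p) = (2 ^ (N + X.s₁ * X.p))⁻¹ := by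
    rw [one_div, Real.inv_rpow (by norm_num)]
  rw [e1, e2, e3, e4, e5, e6]
  have : 0 < (2:ℝ) ^ (N + X.s₁ * X.p) := by positivity
  have : 0 < ρ ^ (N : ℝ) := by positivity
  have : 0 < ρ ^ (X.s₁ * X.p) := by positivity
  field_simp

variable (X) in
/-- Faber–Krahn-type lower bound: within a ball of twice the volume of the `j`-th set, the
truncation vanishes on a large set. -/
lemma exists_faberKrahn : ∃ c : ℝ, 0 < c ∧ ∀ κ, 0 < κ → κ ≤ 1 → ∀ j, ∀ s, 0 < s →
    volume (X.S κ j) = ENNReal.ofReal s → ∀ y ∈ X.S κ (j + 1),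
    ENNReal.ofReal (c * ((1 / 2 : ℝ) ^ j) ^ (X.p + 2) * (κ ^ X.p *
      X.ρ y ^ (X.s₁ * (X.p + 2)) * s ^ (-(X.s₁ * X.p / N)))) ≤
      ∫⁻ x, ENNReal.ofReal (X.co κ j (x, y)) := by
  have hb := X.hb; have hb1 := X.hb1; have hc := X.hc₀
  have hs := X.s₁_pos
  have hp := X.hp
  have hM := X.hM
  have hω := unitBall_pos (N := N)
  have hN : (0:ℝ) < N := by exact_mod_cast X.hN
  set σ := X.s₁ * X.p / N with hσ
  refine ⟨(X.b * X.c₀) ^ (X.p + 2) / (2 * X.M) ^ 2 * (unitBall N / 2) ^ (1 + σ), by positivity,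
    fun κ hκ hκ1 j s hs0 hvol y hy => ?_⟩
  set L : ℝ := (1 / 2) ^ j with hL
  have hL0 : 0 < L := by positivity
  have hρ := ρ_pos_of_mem hκ hy
  set ρ := X.ρ y with hρd
  have hψy := ψ_ge_of_mem_succ hκ hy
  have huy := le_u_of_mem hκ hy
  rw [← hL] at hψy
  rw [← hρd] at huy
  set P := ρ ^ X.s₁ with hP
  have hP0 : 0 < P := by positivity
  set m := X.b * X.c₀ * L * P with hm
  have hm0 : 0 < m := by positivity
  have hψm : m ≤ X.ψ κ j y := by
    refine le_trans (le_of_eq ?_) ((mul_le_mul_of_nonneg_left huy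
      (show 0 ≤ X.b * L by positivity)).trans hψy)
    rw [hm]; ring
  -- the ball of radius `r` has volume `2 * s`
  set r := (2 * s / unitBall N) ^ (1 / (N:ℝ)) with hr
  have hr0 : 0 < r := by positivity
  have hrN : r ^ (N:ℝ) = 2 * s / unitBall N := by
    rw [hr, ← Real.rpow_mul (by positivity), one_div_mul_cancel hN.ne', Real.rpow_one]
  have hball : volume (Metric.ball y r) = ENNReal.ofReal (2 * s) := by
    rw [volume_ball_eq X.hN y hr0.le, hrN]
    congr 1; field_simp
  have hT : ENNReal.ofReal s ≤ volume (Metric.ball y r \ X.S κ j) := by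
    refine le_trans ?_ (le_measure_sdiff)
    rw [hball, hvol, ← ENNReal.ofReal_sub _ hs0.le]
    exact ENNReal.ofReal_le_ofReal (by linarith)
  have key : ∀ x ∈ Metric.ball y r \ X.S κ j, (κ * m) ^ X.p * m ^ 2 /
      ((2 * X.M) ^ 2 * r ^ (N + X.s₁ * X.p)) ≤ X.co κ j (x, y) := by
    rintro x ⟨hx, hxS⟩
    rw [mem_ball_iff_norm] at hx
    have hh : X.h κ j (x, y) = X.ψ κ j y := by
      unfold h; simp only; rw [notMem_S.1 hxS, sub_zero]
    have hψM := ψ_le_M (X := X) (j := j) hκ y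
    have hψ0 := ψ_nonneg (X := X) (κ := κ) (j := j) y
    have ht : |X.t (x, y)| ≤ X.M := by
      unfold t
      refine abs_sub_le_iff.2 ⟨?_, ?_⟩ <;>
        linarith [u_le_M (X := X) x, u_le_M (X := X) y, X.u_nonneg x, X.u_nonneg y]
    have ht0 := abs_nonneg (X.t (x, y))
    refine le_co hm0 (mul_pos hκ hm0) ?_ ?_ ?_ ?_
    · rw [hh, abs_of_nonneg hψ0]
      have : κ * m ≤ κ * X.ψ κ j y := by gcongr
      linarith
    · rw [hh, abs_of_nonneg hψ0]
      have : κ * X.ψ κ j y ≤ 1 * X.ψ κ j y := by gcongr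
      linarith
    · rwa [hh, abs_of_nonneg hψ0]
    · exact Real.rpow_le_rpow (norm_nonneg _) hx.le (by positivity)
  refine le_trans (le_of_eq ?_) (ofReal_mul_volume_le (by positivity)
    (MeasurableSet.diff measurableSet_ball measurableSet_S) hT key)
  congr 1
  have e1 : (κ * m) ^ X.p * m ^ 2 = κ ^ X.p * ((X.b * X.c₀) ^ (X.p + 2) * L ^ (X.p + 2) *
      ρ ^ (X.s₁ * (X.p + 2))) := by
    rw [Real.mul_rpow hκ.le hm0.le, mul_assoc, ← Real.rpow_two m, ← Real.rpow_add hm0, hm,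
      Real.mul_rpow (by positivity) hP0.le, Real.mul_rpow (by positivity) hL0.le, hP,
      ← Real.rpow_mul hρ.le]
  have e2 : r ^ (N + X.s₁ * X.p) = (2 / unitBall N) ^ (1 + σ) * (s * s ^ σ) := by
    rw [show (N:ℝ) + X.s₁ * X.p = N * (1 + σ) by rw [hσ]; field_simp, Real.rpow_mul hr0.le, hrN,
      mul_div_right_comm, Real.mul_rpow (by positivity) hs0.le, Real.rpow_add hs0, Real.rpow_one]
  have e3 : (unitBall N / 2) ^ (1 + σ) = ((2 / unitBall N) ^ (1 + σ))⁻¹ := by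
    rw [← Real.inv_rpow (by positivity), inv_div]
  rw [e1, e2, e3, Real.rpow_neg hs0.le]
  have : 0 < (2 / unitBall N) ^ (1 + σ) := by positivity
  have : 0 < s ^ σ := by positivity
  field_simp

/-- `Q` is the integral of a density in the lower point alone. -/
lemma lintegral_density : ∫⁻ y, ((∫⁻ x, ENNReal.ofReal (X.co κ j (x, y))) +
    ENNReal.ofReal κ⁻¹ * ENNReal.ofReal (X.ψ κ j y)) = X.Q κ j := by
  have hm : Measurable fun z : Eu N × Eu N => ENNReal.ofReal (X.co κ j z) :=
    measurable_co.ennreal_ofReal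
  unfold Q Co
  rw [lintegral_add_left hm.lintegral_prod_left', lintegral_const_mul' _ _ ENNReal.ofReal_ne_top,
    Measure.volume_eq_prod, lintegral_prod_symm' _ hm]

variable (X) in
/-- The measure of the sets, and a weighted measure of them with a small power of the weight, are
controlled by the coercive quantity of the preceding level; the latter with a gain. -/
lemma exists_measure_le {w : ℝ} (hw : 0 < w) (hw1 : (X.p + 2) * w ≤ 1) :
    ∃ C B : ℝ, 0 < C ∧ 1 ≤ B ∧ ∀ κ, 0 < κ → κ ≤ 1 → ∀ j,
      volume (X.S κ (j + 1)) ≤ ENNReal.ofReal (C * B ^ j) * X.Q κ j ∧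
      X.Y (X.s₁ * (2 * X.p + 3) * w) κ (j + 1) ≤ ENNReal.ofReal (C * B ^ j * (κ ^ w *
        (volume (X.S κ j)).toReal ^ (X.s₁ * X.p / N * w))) * X.Q κ j := by
  obtain ⟨c₁, hc₁, H₁⟩ := exists_hardy X
  obtain ⟨c₂, hc₂, H₂⟩ := exists_faberKrahn X
  have hb := X.hb; have hc := X.hc₀; have hp := X.hp; have hs := X.s₁_pos
  set e : ℝ := X.p + 2 + N / X.s₁ with he
  have he0 : 0 ≤ N / X.s₁ := by positivity
  set c := min c₁ (min c₂ (X.b * X.c₀)) with hcd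
  have hc0 : 0 < c := lt_min hc₁ (lt_min hc₂ (by positivity))
  have l1 : c ≤ c₁ := min_le_left _ _
  have l2 : c ≤ c₂ := (min_le_right _ _).trans (min_le_left _ _)
  have l3 : c ≤ X.b * X.c₀ := (min_le_right _ _).trans (min_le_right _ _)
  refine ⟨c⁻¹, 2 ^ e, by positivity, Real.one_le_rpow (by norm_num) (by linarith),
    fun κ hκ hκ1 j => ?_⟩
  set L : ℝ := (1 / 2) ^ j with hL
  have hL0 : 0 < L := by positivity
  have hL1 : L ≤ 1 := pow_le_one₀ (by norm_num) (by norm_num)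
  have hLe : L ^ e = (((2:ℝ) ^ e) ^ j)⁻¹ := by
    rw [hL, ← Real.rpow_natCast, ← Real.rpow_natCast, ← Real.rpow_mul (by norm_num),
      ← Real.rpow_mul (by norm_num), one_div, Real.inv_rpow (by norm_num), mul_comm]
  have hLe0 : 0 < L ^ e := by positivity
  have hCB : c⁻¹ * ((2:ℝ) ^ e) ^ j = (c * L ^ e)⁻¹ := by rw [hLe, mul_inv, inv_inv]
  set G : Eu N → ENNReal := fun y => (∫⁻ x, ENNReal.ofReal (X.co κ j (x, y))) +
    ENNReal.ofReal κ⁻¹ * ENNReal.ofReal (X.ψ κ j y) with hG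
  have hGQ : ∫⁻ y, G y = X.Q κ j := lintegral_density
  have b1 : ∀ y ∈ X.S κ (j + 1), ENNReal.ofReal (c * L ^ e) ≤ G y := fun y hy =>
    le_trans (ENNReal.ofReal_le_ofReal (by gcongr)) ((H₁ κ hκ hκ1 j y hy).trans le_self_add)
  have int_le : ∀ (f : Eu N → ℝ) (A : ℝ), 0 ≤ A →
      (∀ y ∈ X.S κ (j + 1), ENNReal.ofReal (f y) ≤ ENNReal.ofReal A * G y) →
      ∫⁻ y in X.S κ (j + 1), ENNReal.ofReal (f y) ≤ ENNReal.ofReal A * X.Q κ j := by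
    intro f A hA hf
    rw [← hGQ, ← lintegral_const_mul' _ _ ENNReal.ofReal_ne_top]
    exact (setLIntegral_mono' measurableSet_S hf).trans (setLIntegral_le_lintegral _ _)
  rw [hCB]
  have hfin : volume (X.S κ j) ≠ ⊤ := ((measure_mono (S_subset hκ)).trans_lt X.volume_Ω).ne
  set s := (volume (X.S κ j)).toReal with hsd
  have hs0 : 0 ≤ s := ENNReal.toReal_nonneg
  constructor
  · have := int_le (fun _ => 1) (c * L ^ e)⁻¹ (by positivity) fun y hy => by
      refine le_trans (le_of_eq ?_) (mul_le_mul_right (b1 y hy) _)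
      rw [← ENNReal.ofReal_mul (by positivity), inv_mul_cancel₀ (by positivity)]
    simpa using this
  · rcases hs0.eq_or_lt with h0 | h0
    · have : volume (X.S κ (j + 1)) = 0 := by
        have h1 : volume (X.S κ j) = 0 := (ENNReal.toReal_eq_zero_iff _).1 (hsd.symm.trans h0.symm)
          |>.resolve_right hfin
        exact measure_mono_null S_succ_subset h1
      unfold Y
      rw [Measure.restrict_eq_zero.2 this, lintegral_zero_measure]
      exact zero_le
    · refine int_le _ _ (by positivity) fun y hy => ?_
      have hρ := ρ_pos_of_mem hκ hy
      set ρ := X.ρ y with hρd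
      have hvol : volume (X.S κ j) = ENNReal.ofReal s := (ENNReal.ofReal_toReal hfin).symm
      set x₂ := κ ^ X.p * ρ ^ (X.s₁ * (X.p + 2)) * s ^ (-(X.s₁ * X.p / N)) with hx₂
      set x₃ := κ⁻¹ * ρ ^ X.s₁ with hx₃
      have p2 : 0 < x₂ := by positivity
      have p3 : 0 < x₃ := by positivity
      have b2 : ENNReal.ofReal (c * L ^ e * x₂) ≤ G y := by
        refine le_trans (ENNReal.ofReal_le_ofReal ?_)
          ((H₂ κ hκ hκ1 j s h0 hvol y hy).trans le_self_add)
        gcongr ?_ * _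
        refine mul_le_mul l2 ?_ hLe0.le hc₂.le
        · exact Real.rpow_le_rpow_of_exponent_ge hL0 hL1 (by linarith)
      have b3 : ENNReal.ofReal (c * L ^ e * x₃) ≤ G y := by
        refine le_trans ?_ (le_add_self (a := ENNReal.ofReal κ⁻¹ * ENNReal.ofReal (X.ψ κ j y)))
        rw [← ENNReal.ofReal_mul (by positivity)]
        refine ENNReal.ofReal_le_ofReal ?_
        have h1 := ψ_ge_of_mem_succ hκ hy
        have h2 := le_u_of_mem hκ hy
        have h3 : L ^ e ≤ L := by
          have := Real.rpow_le_rpow_of_exponent_ge hL0 hL1 (show 1 ≤ e by linarith)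
          rwa [Real.rpow_one] at this
        calc c * L ^ e * x₃ ≤ X.b * X.c₀ * L * x₃ := by gcongr
          _ = κ⁻¹ * (X.b * L * (X.c₀ * ρ ^ X.s₁)) := by rw [hx₃]; ring
          _ ≤ κ⁻¹ * (X.b * L * X.u y) := by gcongr
          _ ≤ _ := by gcongr
      set m := max 1 (max x₂ x₃) with hm
      have m1 : 1 ≤ m := le_max_left _ _
      have m2 : x₂ ≤ m := (le_max_left _ _).trans (le_max_right _ _)
      have m3 : x₃ ≤ m := (le_max_right _ _).trans (le_max_right _ _)
      have hmG : ENNReal.ofReal (c * L ^ e * m) ≤ G y := by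
        rcases max_choice 1 (max x₂ x₃) with h | h
        · rw [hm, h, mul_one]; exact b1 y hy
        · rcases max_choice x₂ x₃ with h' | h' <;> rw [hm, h, h']
          exacts [b2, b3]
      -- the geometric mean of the three lower bounds
      have hmean : ρ ^ (X.s₁ * (2 * X.p + 3) * w) ≤ κ ^ w * s ^ (X.s₁ * X.p / N * w) * m := by
        have h1 : x₃ ^ ((X.p + 1) * w) * x₂ ^ w ≤ m := by
          calc x₃ ^ ((X.p + 1) * w) * x₂ ^ w ≤ m ^ ((X.p + 1) * w) * m ^ w := by gcongr
            _ = m ^ ((X.p + 2) * w) := by rw [← Real.rpow_add (by linarith)]; ring_nf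
            _ ≤ m ^ (1:ℝ) := Real.rpow_le_rpow_of_exponent_le m1 hw1
            _ = m := Real.rpow_one m
        refine le_trans (le_of_eq ?_) (mul_le_mul_of_nonneg_left h1
          (show 0 ≤ κ ^ w * s ^ (X.s₁ * X.p / N * w) by positivity))
        rw [hx₃, hx₂, Real.mul_rpow (by positivity) (by positivity),
          Real.mul_rpow (by positivity) (by positivity),
          Real.mul_rpow (by positivity) (by positivity), Real.inv_rpow hκ.le,
          ← Real.rpow_neg hκ.le, ← Real.rpow_mul hκ.le, ← Real.rpow_mul hρ.le,
          ← Real.rpow_mul hρ.le, ← Real.rpow_mul h0.le]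
        have f1 : κ ^ w * κ ^ (-((X.p + 1) * w)) * κ ^ (X.p * w) = 1 := by
          rw [← Real.rpow_add hκ, ← Real.rpow_add hκ]
          ring_nf
          exact Real.rpow_zero κ
        have f2 : s ^ (X.s₁ * X.p / N * w) * s ^ (-(X.s₁ * X.p / N) * w) = 1 := by
          rw [← Real.rpow_add h0]
          ring_nf
          exact Real.rpow_zero s
        have f3 : ρ ^ (X.s₁ * ((X.p + 1) * w)) * ρ ^ (X.s₁ * (X.p + 2) * w) =
            ρ ^ (X.s₁ * (2 * X.p + 3) * w) := by
          rw [← Real.rpow_add hρ]; ring_nf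
        rw [← f3]
        linear_combination (-(ρ ^ (X.s₁ * ((X.p + 1) * w)) * ρ ^ (X.s₁ * (X.p + 2) * w))) *
          (f1 * (s ^ (X.s₁ * X.p / N * w) * s ^ (-(X.s₁ * X.p / N) * w)) + f2)
      calc ENNReal.ofReal (ρ ^ (X.s₁ * (2 * X.p + 3) * w))
          ≤ ENNReal.ofReal ((c * L ^ e)⁻¹ * (κ ^ w * s ^ (X.s₁ * X.p / N * w)) *
              (c * L ^ e * m)) := by
            refine ENNReal.ofReal_le_ofReal (hmean.trans (le_of_eq ?_))
            field_simp
        _ = ENNReal.ofReal ((c * L ^ e)⁻¹ * (κ ^ w * s ^ (X.s₁ * X.p / N * w))) *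
              ENNReal.ofReal (c * L ^ e * m) := ENNReal.ofReal_mul (by positivity)
        _ ≤ _ := by gcongr

end Config

/-! ### The iteration -/

/-- The ratio `l` of the geometric decay: so small that the powers of `B` in the superlinear term are
compensated. -/
lemma exists_ratio {B a σ : ℝ} (hB : 1 ≤ B) (ha : 0 < a) (hσ : 0 < σ) :
    ∃ l : ℝ, 0 < l ∧ B * l ≤ 1 / 2 ∧ B ^ (2 * a) * (B * l) ^ σ * B ≤ 1 := by
  have hB0 : 0 < B := by linarith
  set l : ℝ := 1 / 2 * B ^ (-((2 * a + 1 + σ) / σ)) with hl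
  have hl0 : 0 < l := by positivity
  have hBl : B * l ≤ 1 / 2 := by
    have h1 : B ^ (-((2 * a + 1 + σ) / σ)) ≤ B ^ (-1:ℝ) := by
      refine Real.rpow_le_rpow_of_exponent_le hB (neg_le_neg ?_)
      rw [le_div_iff₀ hσ]; linarith
    rw [Real.rpow_neg_one] at h1
    calc B * l ≤ B * (1 / 2 * B⁻¹) := by rw [hl]; gcongr
      _ = 1 / 2 := by field_simp
  refine ⟨l, hl0, hBl, ?_⟩
  have h2 : l ≤ B ^ (-((2 * a + 1 + σ) / σ)) := by
    rw [hl]; linarith [Real.rpow_pos_of_pos hB0 (-((2 * a + 1 + σ) / σ))]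
  have h3 : (B * l) ^ σ ≤ B ^ (-(2 * a + 1)) := by
    calc (B * l) ^ σ ≤ (B * B ^ (-((2 * a + 1 + σ) / σ))) ^ σ := by gcongr
      _ = B ^ (-(2 * a + 1)) := by
        nth_rewrite 1 [← Real.rpow_one B]
        rw [← Real.rpow_add hB0, ← Real.rpow_mul hB0.le]
        congr 1
        field_simp
        ring
  calc B ^ (2 * a) * (B * l) ^ σ * B ≤ B ^ (2 * a) * B ^ (-(2 * a + 1)) * B := by gcongr
    _ = B ^ (2 * a) * B ^ (-(2 * a + 1)) * B ^ (1:ℝ) := by rw [Real.rpow_one]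
    _ = 1 := by
      rw [← Real.rpow_add hB0, ← Real.rpow_add hB0]
      ring_nf
      exact Real.rpow_zero B

/-- The fast geometric convergence lemma. The factor `κ ^ w` makes the superlinear term small, so
that the geometric decay `Q j ≤ A * l ^ j` propagates; the energies `Γ j` and the measures `s j` then
decay like `(B * l) ^ j`. -/
lemma exists_decay {C B a σ w A : ℝ} (hC : 1 ≤ C) (hB : 1 ≤ B) (ha : 0 < a) (hσ : 0 < σ)
    (hw : 0 < w) (hA : 1 ≤ A) : ∃ κ₀ K : ℝ, 0 < κ₀ ∧ ∀ κ, 0 < κ → κ ≤ κ₀ → ∀ Q Γ s : ℕ → ℝ,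
      (∀ i, 0 ≤ Q i) → (∀ i, 0 ≤ Γ i) → (∀ i, 0 ≤ s i) →
      Q 0 ≤ A → Γ 0 ≤ A → Γ 1 ≤ A → s 0 ≤ A →
      (∀ ε, 0 < ε → ε ≤ 1 → ∀ i, Q (i + 1) ≤ C * ε * B ^ i * (Γ i + Q i) +
        C * ε ^ (-a) * κ ^ w * s i ^ σ * B ^ i * Q i) →
      (∀ δ, 0 < δ → δ ≤ 1 → ∀ i, Γ (i + 2) ≤ δ * Γ i + C * δ⁻¹ * B ^ i * (Q (i + 1) + Q i)) →
      (∀ i, s (i + 1) ≤ C * B ^ i * Q i) → ∀ i, s i ≤ K * (1 / 2) ^ i := by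
  have hB0 : 0 < B := by linarith
  obtain ⟨l, hl0, hBl, hBσ⟩ := exists_ratio hB ha hσ
  have hl1 : l ≤ 1 / 2 := by nlinarith
  -- the ansatz is `Q j ≤ A * l ^ j` and `Γ j ≤ A * H * (B * l) ^ j`; it is propagated by taking
  -- `δ = l ^ 2 / 2` and `ε = ε₀ / B ^ (2 * j)`
  set H : ℝ := 8 * C / l ^ 4 with hH
  have hH0 : 0 < H := by positivity
  have hHl : 8 ≤ H * l := by
    have : l ^ 3 ≤ 1 := pow_le_one₀ hl0.le (by linarith)
    have e : H * l = 8 * C / l ^ 3 := by rw [hH]; field_simp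
    rw [e, le_div_iff₀ (by positivity)]
    nlinarith
  have hH1 : 1 ≤ H := by nlinarith
  set ε₀ := l / (4 * C * H) with hε₀
  have hε₀0 : 0 < ε₀ := by positivity
  have hε₀1 : ε₀ ≤ 1 := by
    rw [hε₀, div_le_one (by positivity)]
    nlinarith [mul_le_mul hC hH1 zero_le_one (by linarith)]
  set K' := C * ε₀ ^ (-a) * (C * A / l) ^ σ with hK'
  have hK'0 : 0 < K' := by positivity
  refine ⟨(l / (2 * K')) ^ (1 / w), C * A / l, by positivity, ?_⟩
  intro κ hκ hκ₀ Q Γ s hQ hΓ hs Q0 Γ0 Γ1 s0 H1 H2 H3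
  have hκw : κ ^ w * K' ≤ l / 2 := by
    have : κ ^ w ≤ l / (2 * K') := by
      calc κ ^ w ≤ ((l / (2 * K')) ^ (1 / w)) ^ w := by gcongr
        _ = _ := by
          rw [← Real.rpow_mul (by positivity), one_div_mul_cancel hw.ne', Real.rpow_one]
    calc κ ^ w * K' ≤ l / (2 * K') * K' := by gcongr
      _ = l / 2 := by field_simp
  have main : ∀ j, Q j ≤ A * l ^ j ∧ Γ j ≤ A * H * (B * l) ^ j ∧
      Γ (j + 1) ≤ A * H * (B * l) ^ (j + 1) ∧ s j ≤ C * A / l * (B * l) ^ j := by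
    intro j
    induction j with
    | zero =>
      simp only [pow_zero, mul_one, zero_add, pow_one]
      refine ⟨Q0, Γ0.trans (by nlinarith), Γ1.trans ?_, s0.trans ?_⟩
      · have : 1 ≤ H * (B * l) := by nlinarith
        nlinarith
      · rw [le_div_iff₀ hl0]; nlinarith
    | succ j ih =>
      obtain ⟨q, g, g', t⟩ := ih
      have hBj : (1:ℝ) ≤ B ^ j := one_le_pow₀ hB
      have q' : Q (j + 1) ≤ A * l ^ (j + 1) := by
        have hεj : ε₀ / (B ^ j) ^ 2 ≤ 1 := by
          rw [div_le_one (by positivity)]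
          exact hε₀1.trans (one_le_pow₀ hBj)
        have h1 := H1 (ε₀ / (B ^ j) ^ 2) (by positivity) hεj j
        have h2 : C * (ε₀ / (B ^ j) ^ 2) * B ^ j * (Γ j + Q j) ≤ A * l ^ (j + 1) / 2 := by
          have h3 : Γ j + Q j ≤ 2 * (A * H * (B * l) ^ j) := by
            have : A * l ^ j ≤ A * H * (B * l) ^ j := by
              calc A * l ^ j = A * 1 * (1 * l) ^ j := by ring
                _ ≤ _ := by gcongr
            linarith
          calc C * (ε₀ / (B ^ j) ^ 2) * B ^ j * (Γ j + Q j)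
              ≤ C * (ε₀ / (B ^ j) ^ 2) * B ^ j * (2 * (A * H * (B * l) ^ j)) := by gcongr
            _ = A * l ^ (j + 1) / 2 := by
              rw [hε₀, mul_pow, pow_succ]
              field_simp
              ring
        have h4 : C * (ε₀ / (B ^ j) ^ 2) ^ (-a) * κ ^ w * s j ^ σ * B ^ j * Q j ≤
            A * l ^ (j + 1) / 2 := by
          have e1 : (ε₀ / (B ^ j) ^ 2) ^ (-a) = ε₀ ^ (-a) * (B ^ (2 * a)) ^ j := by
            rw [Real.div_rpow hε₀0.le (by positivity), Real.rpow_neg (by positivity) a,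
              Real.rpow_neg (by positivity) a, div_inv_eq_mul, ← pow_mul, ← Real.rpow_natCast,
              ← Real.rpow_mul hB0.le, ← Real.rpow_natCast, ← Real.rpow_mul hB0.le]
            push_cast
            ring_nf
          have e2 : (C * A / l * (B * l) ^ j) ^ σ = (C * A / l) ^ σ * ((B * l) ^ σ) ^ j := by
            rw [Real.mul_rpow (by positivity) (by positivity), ← Real.rpow_natCast,
              ← Real.rpow_natCast, ← Real.rpow_mul (by positivity), ← Real.rpow_mul (by positivity),
              mul_comm (j:ℝ)]
          have hsj : s j ^ σ ≤ (C * A / l) ^ σ * ((B * l) ^ σ) ^ j := by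
            rw [← e2]
            exact Real.rpow_le_rpow (hs j) t hσ.le
          have hQj := hQ j
          have hsj0 := hs j
          rw [e1]
          calc C * (ε₀ ^ (-a) * (B ^ (2 * a)) ^ j) * κ ^ w * s j ^ σ * B ^ j * Q j
              ≤ C * (ε₀ ^ (-a) * (B ^ (2 * a)) ^ j) * κ ^ w *
                ((C * A / l) ^ σ * ((B * l) ^ σ) ^ j) * B ^ j * (A * l ^ j) := by gcongr
            _ = κ ^ w * K' * (B ^ (2 * a) * (B * l) ^ σ * B) ^ j * (A * l ^ j) := by
              rw [hK', mul_pow, mul_pow]; ring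
            _ ≤ l / 2 * 1 * (A * l ^ j) := by
              gcongr
              exact pow_le_one₀ (by positivity) hBσ
            _ = _ := by rw [pow_succ]; ring
        linarith
      have g'' : Γ (j + 2) ≤ A * H * (B * l) ^ (j + 2) := by
        have h1 := H2 (l ^ 2 / 2) (by positivity) (by nlinarith) j
        have h2 : Q (j + 1) + Q j ≤ 2 * (A * l ^ j) := by
          have : A * l ^ (j + 1) ≤ A * l ^ j := by
            gcongr A * ?_
            exact pow_le_pow_of_le_one hl0.le (by linarith) (Nat.le_succ j)
          linarith
        calc Γ (j + 2) ≤ l ^ 2 / 2 * (A * H * (B * l) ^ j) +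
              C * (l ^ 2 / 2)⁻¹ * B ^ j * (2 * (A * l ^ j)) := h1.trans (by gcongr)
          _ = A * H * ((B * l) ^ j * (1 * l) ^ 2) := by
              rw [hH, mul_pow]; field_simp; ring
          _ ≤ A * H * ((B * l) ^ j * (B * l) ^ 2) := by gcongr
          _ = _ := by rw [← pow_add]
      refine ⟨q', g', g'', (H3 j).trans ?_⟩
      calc C * B ^ j * Q j ≤ C * B ^ j * (A * l ^ j) := by gcongr
        _ = C * A / l * ((B * l) ^ j * (1 * l)) := by rw [mul_pow]; field_simp
        _ ≤ C * A / l * ((B * l) ^ j * (B * l)) := by gcongr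
        _ = _ := by rw [← pow_succ]
  intro i
  refine (main i).2.2.2.trans ?_
  gcongr

namespace Config

variable {N : ℕ} {X : Config N} {κ : ℝ} {i j : ℕ}

lemma energy_lt_top : ∫⁻ z, ENNReal.ofReal (|X.t z| ^ X.p / X.K₁ z + |X.t z| ^ X.q / X.K₂ z) < ⊤ :=
  (X.u_energy.add (nice_u (X := X)).energy_q).lintegral_lt_top

lemma rpow_sub_one_mul_self {r x : ℝ} (hr : 1 < r) (hx : 0 ≤ x) : x ^ (r - 1) * x = x ^ r := by
  have := Real.rpow_add_one' (y := r - 1) hx (by linarith)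
  rw [sub_add_cancel] at this
  exact this.symm

lemma En_le : X.En κ j ≤
    ∫⁻ z, ENNReal.ofReal (|X.t z| ^ X.p / X.K₁ z + |X.t z| ^ X.q / X.K₂ z) := by
  refine lintegral_mono fun z => ENNReal.ofReal_le_ofReal ?_
  have := X.K₁_nonneg z; have := X.K₂_nonneg z
  unfold en
  split_ifs with h
  · refine le_of_eq ?_
    unfold flux
    rw [abs_of_pos h.1, ← rpow_sub_one_mul_self X.hp h.1.le, ← rpow_sub_one_mul_self X.hq h.1.le]
    ring
  · positivity

lemma Er_le {Λ : ℝ} (hΛ : 1 ≤ Λ) : X.Er Λ κ j ≤ ENNReal.ofReal Λ *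
    ∫⁻ z, ENNReal.ofReal (|X.t z| ^ X.p / X.K₁ z + |X.t z| ^ X.q / X.K₂ z) := by
  rw [← lintegral_const_mul' _ _ ENNReal.ofReal_ne_top]
  refine lintegral_mono fun z => ?_
  rw [← ENNReal.ofReal_mul (by linarith)]
  refine ENNReal.ofReal_le_ofReal ?_
  have := X.K₁_nonneg z; have := X.K₂_nonneg z
  unfold err
  split_ifs with h
  · have h0 := h.1
    rw [abs_of_pos h0]
    calc X.t z ^ (X.q - 1) / X.K₂ z * X.h κ j z
        ≤ X.t z ^ (X.q - 1) / X.K₂ z * (Λ * X.t z) := by gcongr; exact h.2.2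
      _ = Λ * (X.t z ^ (X.q - 1) * X.t z / X.K₂ z) := by ring
      _ = Λ * (X.t z ^ X.q / X.K₂ z) := by rw [rpow_sub_one_mul_self X.hq h0.le]
      _ ≤ _ := by
        gcongr
        exact le_add_of_nonneg_left (by positivity)
  · positivity

variable (X) in
/-- The outcome of the iteration: for small `κ`, almost no point stays in all the sets. -/
theorem exists_iInter_null : ∃ κ₀ : ℝ, 0 < κ₀ ∧ ∀ κ, 0 < κ → κ ≤ κ₀ →
    volume (⋂ j, X.S κ j) = 0 := by
  have hp := X.hp; have hs := X.s₁_pos; have hq := X.hq; have hqp := X.hqp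
  have hN : (0:ℝ) < N := by exact_mod_cast X.hN
  set α := (X.s₁ - X.s₂) * X.q with hα
  have hα0 : 0 < α := mul_pos (sub_pos.2 X.hs) (by linarith)
  set γ := gapExp X.s₁ X.s₂ X.p X.q with hγ
  have hγ0 : 0 < γ := gapExp_pos
  -- the exponent of the weight has to lie below all available powers
  set m := min X.s₁ (min α γ) / 2 with hm
  have hm0 : 0 < m := by
    have := lt_min hs (lt_min hα0 hγ0)
    positivity
  have m1 : m ≤ X.s₁ := by
    have := min_le_left X.s₁ (min α γ); linarith
  have m2 : m < α := by
    have := (min_le_right X.s₁ (min α γ)).trans (min_le_left _ _); linarith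
  have m3 : m < γ := by
    have := (min_le_right X.s₁ (min α γ)).trans (min_le_right _ _); linarith
  set D := X.s₁ * (2 * X.p + 3) with hD
  have hD0 : 0 < D := by positivity
  set w := min (1 / (X.p + 2)) (m / D) with hw
  have hw0 : 0 < w := lt_min (by positivity) (by positivity)
  have w1 : (X.p + 2) * w ≤ 1 := by
    have := min_le_left (1 / (X.p + 2)) (m / D)
    rw [← hw, le_div_iff₀ (by positivity)] at this; linarith
  have w2 : D * w ≤ m := by
    have := min_le_right (1 / (X.p + 2)) (m / D)
    rw [← hw, le_div_iff₀ hD0] at this; linarith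
  obtain ⟨C₁, Λ, κ₁, hC₁, hΛ, hκ₁, hκ₁1, I1⟩ := exists_coercivity X
  obtain ⟨C₂, hC₂, I2⟩ := exists_Er_le X hΛ (τ := D * w) (by positivity) (w2.trans m1)
    (w2.trans_lt m2) (w2.trans_lt m3)
  obtain ⟨C₃, B, hC₃, hB, I3⟩ := exists_measure_le X hw0 w1
  obtain ⟨C₄, hC₄, I4⟩ := exists_En_le X
  set a := X.q / (X.p - X.q) with ha
  have ha0 : 0 < a := div_pos (by linarith) (by linarith)
  set σ := X.s₁ * X.p / N * w with hσ
  have hσ0 : 0 < σ := by positivity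
  set E := (∫⁻ z, ENNReal.ofReal (|X.t z| ^ X.p / X.K₁ z + |X.t z| ^ X.q / X.K₂ z)).toReal with hE
  have hE' : ∫⁻ z, ENNReal.ofReal (|X.t z| ^ X.p / X.K₁ z + |X.t z| ^ X.q / X.K₂ z) =
    ENNReal.ofReal E := (ENNReal.ofReal_toReal energy_lt_top.ne).symm
  have hE0 : 0 ≤ E := ENNReal.toReal_nonneg
  set V := (volume X.Ω).toReal with hV
  have hV' : volume X.Ω = ENNReal.ofReal V := (ENNReal.ofReal_toReal X.volume_Ω.ne).symm
  have hV0 : 0 ≤ V := ENNReal.toReal_nonneg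
  set C := 1 + C₁ * C₂ + C₁ * C₂ * C₃ + C₄ + C₄ * C₃ + C₃ with hC
  have c1 : 0 < C₁ * C₂ := by positivity
  have c2 : 0 < C₁ * C₂ * C₃ := by positivity
  have c3 : 0 < C₄ * C₃ := by positivity
  obtain ⟨κ₂, K, hκ₂, hdecay⟩ := exists_decay (C := C) (B := 4 * B) (A := 1 + C₁ * (Λ * E) + E + V)
    (by linarith) (by linarith) ha0 hσ0 hw0 (by
      have : 0 ≤ C₁ * (Λ * E) := by positivity
      linarith)
  have hA1 : 0 ≤ C₁ * (Λ * E) := by positivity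
  refine ⟨min κ₁ κ₂, lt_min hκ₁ hκ₂, fun κ hκ hκle => ?_⟩
  have k1 : κ ≤ κ₁ := hκle.trans (min_le_left _ _)
  have k2 : κ ≤ κ₂ := hκle.trans (min_le_right _ _)
  have hκ1 : κ ≤ 1 := k1.trans hκ₁1
  have Qb : ∀ j, X.Q κ j ≤ ENNReal.ofReal (C₁ * (Λ * E)) := fun j => by
    refine (I1 κ hκ k1 j).trans ?_
    rw [ENNReal.ofReal_mul hC₁.le, ENNReal.ofReal_mul (by linarith), ← hE']
    gcongr
    exact Er_le hΛ
  have Eb : ∀ j, X.En κ j ≤ ENNReal.ofReal E := fun j => hE' ▸ En_le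
  have Sb : ∀ j, volume (X.S κ j) ≤ ENNReal.ofReal V := fun j => hV' ▸ measure_mono (S_subset hκ)
  set Q := fun j => (X.Q κ j).toReal with hQ
  set Γ := fun j => (X.En κ j).toReal with hΓ
  set s := fun j => (volume (X.S κ j)).toReal with hs'
  have Q0 : ∀ j, 0 ≤ Q j := fun j => ENNReal.toReal_nonneg
  have Γ0 : ∀ j, 0 ≤ Γ j := fun j => ENNReal.toReal_nonneg
  have s0 : ∀ j, 0 ≤ s j := fun j => ENNReal.toReal_nonneg
  have Qe : ∀ j, X.Q κ j = ENNReal.ofReal (Q j) := fun j =>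
    (ENNReal.ofReal_toReal ((Qb j).trans_lt ENNReal.ofReal_lt_top).ne).symm
  have Γe : ∀ j, X.En κ j = ENNReal.ofReal (Γ j) := fun j =>
    (ENNReal.ofReal_toReal ((Eb j).trans_lt ENNReal.ofReal_lt_top).ne).symm
  have se : ∀ j, volume (X.S κ j) = ENNReal.ofReal (s j) := fun j =>
    (ENNReal.ofReal_toReal ((Sb j).trans_lt ENNReal.ofReal_lt_top).ne).symm
  have CoQ : ∀ j, X.Co κ j ≤ ENNReal.ofReal (Q j) := fun j => (Qe j) ▸ le_self_add
  have Qm : ∀ j, Q j ≤ C₁ * (Λ * E) := fun j => ENNReal.toReal_le_of_le_ofReal (by positivity) (Qb j)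
  have Γm : ∀ j, Γ j ≤ E := fun j => ENNReal.toReal_le_of_le_ofReal (by positivity) (Eb j)
  have sm : ∀ j, s j ≤ V := fun j => ENNReal.toReal_le_of_le_ofReal (by positivity) (Sb j)
  have hBi : ∀ i : ℕ, (1:ℝ) ≤ B ^ i := fun i => one_le_pow₀ hB
  have J3 : ∀ i, s (i + 1) ≤ C₃ * B ^ i * Q i := fun i => by
    have := (I3 κ hκ hκ1 i).1
    rw [Qe, ← ENNReal.ofReal_mul (by positivity)] at this
    exact ENNReal.toReal_le_of_le_ofReal (mul_nonneg (by positivity) (Q0 i)) this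
  have h4B : ∀ i : ℕ, (4 * B) ^ i = 4 ^ i * B ^ i := fun i => mul_pow _ _ _
  have h4 : ∀ i : ℕ, (1:ℝ) ≤ 4 ^ i := fun i => one_le_pow₀ (by norm_num)
  have dec := hdecay κ hκ k2 Q Γ s Q0 Γ0 s0 (by linarith [Qm 0]) (by linarith [Γm 0])
    (by linarith [Γm 1]) (by linarith [sm 0])
    (fun ε hε hε1 i => by
      have h1 := (I1 κ hκ k1 (i + 1)).trans (mul_le_mul_right (I2 κ ε hκ hκ1 hε hε1 i) _)
      have h2 := (I3 κ hκ hκ1 i).2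
      have n1 := Q0 i; have n2 := Γ0 i; have n3 := s0 i; have n4 := hBi i
      have h3 : X.Q κ (i + 1) ≤ ENNReal.ofReal C₁ * (ENNReal.ofReal (C₂ * ε) * ENNReal.ofReal (Γ i) +
          ENNReal.ofReal (C₂ * ε * 4 ^ i) * ENNReal.ofReal (Q i) +
          ENNReal.ofReal (C₂ * ε ^ (-a)) * (ENNReal.ofReal (C₃ * B ^ i * (κ ^ w * s i ^ σ)) *
            ENNReal.ofReal (Q i))) := by
        refine h1.trans ?_
        rw [← Γe, ← Qe i]
        gcongr
        exact le_self_add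
      rw [← ENNReal.ofReal_mul (by positivity), ← ENNReal.ofReal_mul (by positivity),
        ← ENNReal.ofReal_mul (by positivity), ← ENNReal.ofReal_mul (by positivity),
        ← ENNReal.ofReal_add (by positivity) (by positivity),
        ← ENNReal.ofReal_add (by positivity) (by positivity),
        ← ENNReal.ofReal_mul (by positivity)] at h3
      refine (ENNReal.toReal_le_of_le_ofReal (by positivity) h3).trans ?_
      rw [h4B]
      have e1 : C₁ * (C₂ * ε * Γ i + C₂ * ε * 4 ^ i * Q i) ≤
          C * ε * (4 ^ i * B ^ i) * (Γ i + Q i) := by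
        calc C₁ * (C₂ * ε * Γ i + C₂ * ε * 4 ^ i * Q i)
            = C₁ * C₂ * ε * (1 * 1 * Γ i) + C₁ * C₂ * ε * (4 ^ i * 1 * Q i) := by ring
          _ ≤ C * ε * (4 ^ i * B ^ i * Γ i) + C * ε * (4 ^ i * B ^ i * Q i) := by
              have := h4 i
              have : C₁ * C₂ ≤ C := by linarith
              gcongr
          _ = _ := by ring
      have e2 : C₁ * (C₂ * ε ^ (-a) * (C₃ * B ^ i * (κ ^ w * s i ^ σ) * Q i)) ≤
          C * ε ^ (-a) * κ ^ w * s i ^ σ * (4 ^ i * B ^ i) * Q i := by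
        calc C₁ * (C₂ * ε ^ (-a) * (C₃ * B ^ i * (κ ^ w * s i ^ σ) * Q i))
            = C₁ * C₂ * C₃ * ε ^ (-a) * κ ^ w * s i ^ σ * (1 * B ^ i) * Q i := by ring
          _ ≤ _ := by
              have := h4 i
              have : C₁ * C₂ * C₃ ≤ C := by linarith
              gcongr
      linarith)
    (fun δ hδ hδ1 i => by
      have h1 := I4 κ δ hκ hκ1 hδ hδ1 i
      have n1 := Q0 i; have n1' := Q0 (i + 1); have n2 := Γ0 i; have n3 := s0 (i + 1)
      have n4 := hBi i
      have h3 : X.En κ (i + 2) ≤ ENNReal.ofReal δ * ENNReal.ofReal (Γ i) +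
          ENNReal.ofReal (C₄ * δ⁻¹ * 4 ^ i) * (ENNReal.ofReal (Q (i + 1)) + ENNReal.ofReal (Q i)) +
          ENNReal.ofReal (C₄ * 2 ^ i) * ENNReal.ofReal (s (i + 1)) := by
        refine h1.trans ?_
        rw [← Γe, ← se]
        gcongr
        exacts [CoQ _, CoQ _]
      rw [← ENNReal.ofReal_add n1' n1, ← ENNReal.ofReal_mul (by positivity),
        ← ENNReal.ofReal_mul (by positivity), ← ENNReal.ofReal_mul (by positivity),
        ← ENNReal.ofReal_add (by positivity) (by positivity),
        ← ENNReal.ofReal_add (by positivity) (by positivity)] at h3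
      refine (ENNReal.toReal_le_of_le_ofReal (by positivity) h3).trans ?_
      have hδi : 1 ≤ δ⁻¹ := (one_le_inv₀ hδ).2 hδ1
      have e1 : C₄ * 2 ^ i * s (i + 1) ≤ C₄ * C₃ * δ⁻¹ * (4 * B) ^ i * Q i := by
        calc C₄ * 2 ^ i * s (i + 1) ≤ C₄ * 2 ^ i * (C₃ * B ^ i * Q i) := by
              gcongr; exact J3 i
          _ = C₄ * C₃ * 1 * (2 ^ i * B ^ i) * Q i := by ring
          _ ≤ C₄ * C₃ * δ⁻¹ * (4 ^ i * B ^ i) * Q i := by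
              gcongr; norm_num
          _ = _ := by rw [h4B]
      have e2 : C₄ * δ⁻¹ * 4 ^ i * (Q (i + 1) + Q i) ≤
          C₄ * δ⁻¹ * (4 * B) ^ i * (Q (i + 1) + Q i) := by
        gcongr; linarith
      have e3 : C₄ * C₃ * δ⁻¹ * (4 * B) ^ i * Q i ≤
          C₄ * C₃ * δ⁻¹ * (4 * B) ^ i * (Q (i + 1) + Q i) := by gcongr; linarith
      have e4 : (C₄ + C₄ * C₃) * (δ⁻¹ * (4 * B) ^ i * (Q (i + 1) + Q i)) ≤
          C * (δ⁻¹ * (4 * B) ^ i * (Q (i + 1) + Q i)) := by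
        gcongr; linarith
      linarith)
    (fun i => by
      have n1 := Q0 i; have n4 := hBi i
      refine (J3 i).trans ?_
      rw [h4B]
      have : C₃ ≤ C := by linarith
      calc C₃ * B ^ i * Q i ≤ C * B ^ i * Q i := by gcongr
        _ = C * (1 * B ^ i) * Q i := by ring
        _ ≤ _ := by
          have := h4 i
          gcongr)
  refine le_antisymm (ge_of_tendsto' (x := Filter.atTop)
    (f := fun i : ℕ => ENNReal.ofReal (K * (1 / 2) ^ i)) ?_ fun i => ?_) zero_le
  · have h1 : Filter.Tendsto (fun i : ℕ => K * (1 / 2 : ℝ) ^ i) Filter.atTop (nhds (K * 0)) :=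
      (tendsto_pow_atTop_nhds_zero_of_lt_one (by norm_num) (by norm_num)).const_mul K
    rw [mul_zero] at h1
    simpa using ENNReal.tendsto_ofReal h1
  · refine (measure_mono (iInter_subset _ i)).trans ?_
    rw [se]
    exact ENNReal.ofReal_le_ofReal (dec i)

end Config

/-! ### From the comparison problem to the iteration -/

variable {N : ℕ} {Ω : Set (Eu N)}

lemma A_congr {s r : ℝ} {u w : Eu N → ℝ} (h : u =ᵐ[volume] w) (φ : Eu N → ℝ) :
    A s r u φ = A s r w φ := by
  refine integral_congr_ae ?_
  have h1 := (Measure.quasiMeasurePreserving_fst (μ := (volume : Measure (Eu N)))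
    (ν := (volume : Measure (Eu N)))).ae h
  have h2 := (Measure.quasiMeasurePreserving_snd (μ := (volume : Measure (Eu N)))
    (ν := (volume : Measure (Eu N)))).ae h
  rw [Measure.volume_eq_prod]
  filter_upwards [h1, h2] with z e1 e2
  rw [e1, e2]

lemma gagliardo_congr {s r : ℝ} {u w : Eu N → ℝ} (h : u =ᵐ[volume] w) :
    gagliardo s r u = gagliardo s r w := by
  refine lintegral_congr_ae ?_
  have h1 := (Measure.quasiMeasurePreserving_fst (μ := (volume : Measure (Eu N)))
    (ν := (volume : Measure (Eu N)))).ae h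
  have h2 := (Measure.quasiMeasurePreserving_snd (μ := (volume : Measure (Eu N)))
    (ν := (volume : Measure (Eu N)))).ae h
  rw [Measure.volume_eq_prod]
  filter_upwards [h1, h2] with z e1 e2
  rw [e1, e2]

lemma MemW0.ae_eq_indicator {s p : ℝ} {u : Eu N → ℝ} (hΩ : MeasurableSet Ω) (h : MemW0 Ω s p u) :
    u =ᵐ[volume] Ω.indicator u := by
  have h1 := (ae_restrict_iff' hΩ.compl).1 h.zero_outside
  filter_upwards [h1] with x hx
  by_cases hxΩ : x ∈ Ω
  · rw [indicator_of_mem hxΩ]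
  · rw [indicator_of_notMem hxΩ, hx hxΩ]

lemma measurable_indicator_of_continuousOn {u : Eu N → ℝ} (hΩ : MeasurableSet Ω)
    (h : ContinuousOn u Ω) : Measurable (Ω.indicator u) := by
  classical
  rw [← piecewise_eq_indicator]
  exact h.measurable_piecewise continuousOn_const hΩ

lemma MemW0.integrable_energy {s p : ℝ} {u : Eu N → ℝ} (hΩ : MeasurableSet Ω) (h : MemW0 Ω s p u)
    (hc : ContinuousOn u Ω) : Integrable fun z : Eu N × Eu N =>
      |Ω.indicator u z.1 - Ω.indicator u z.2| ^ p / ‖z.1 - z.2‖ ^ ((N : ℝ) + s * p) := by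
  have hm := measurable_indicator_of_continuousOn hΩ hc
  refine ⟨Measurable.aestronglyMeasurable (by fun_prop), ?_⟩
  rw [hasFiniteIntegral_iff_ofReal (.of_forall fun z => by positivity)]
  have h1 := h.seminorm_lt_top
  rwa [gagliardo_congr (h.ae_eq_indicator hΩ)] at h1

lemma MemW0.integrableOn {s p : ℝ} {φ : Eu N → ℝ} (hp : 1 ≤ p) (hΩ : volume Ω < ⊤)
    (h : MemW0 Ω s p φ) : IntegrableOn φ Ω := by
  have : IsFiniteMeasure (volume.restrict Ω) := ⟨by rwa [Measure.restrict_apply_univ]⟩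
  exact h.memLp.integrable (by simpa using ENNReal.ofReal_le_ofReal hp)

lemma bdist_pos (hΩo : IsOpen Ω) (hfr : (frontier Ω).Nonempty) {x : Eu N} (hx : x ∈ Ω) :
    0 < bdist Ω x := by
  refine (isClosed_frontier.notMem_iff_infDist_pos hfr).1 fun h => ?_
  rw [hΩo.frontier_eq] at h
  exact h.2 hx

lemma MemC0.exists_le {s : ℝ} {u : Eu N → ℝ} (hΩo : IsOpen Ω) (hΩb : Bornology.IsBounded Ω)
    (hfr : (frontier Ω).Nonempty) (h : MemC0 Ω s u) :
    ∃ C : ℝ, 1 ≤ C ∧ ∀ x ∈ Ω, u x ≤ C ∧ u x ≤ C * bdist Ω x ^ s := by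
  obtain ⟨hu, k, hk, hkx⟩ := h
  have hK : IsCompact (closure Ω) := hΩb.isCompact_closure
  obtain ⟨C₁, hC₁⟩ := hK.exists_bound_of_continuousOn hu
  obtain ⟨C₂, hC₂⟩ := hK.exists_bound_of_continuousOn hk
  refine ⟨max 1 (max C₁ C₂), le_max_left _ _, fun x hx => ⟨?_, ?_⟩⟩
  · exact (le_abs_self _).trans ((hC₁ x (subset_closure hx)).trans
      ((le_max_left _ _).trans (le_max_right _ _)))
  · have hpos : 0 < bdist Ω x ^ s :=
      Real.rpow_pos_of_pos (bdist_pos hΩo hfr hx) _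
    have h1 : k x ≤ max 1 (max C₁ C₂) := (le_abs_self _).trans ((hC₂ x (subset_closure hx)).trans
      ((le_max_right _ _).trans (le_max_right _ _)))
    rwa [hkx x hx, div_le_iff₀ hpos] at h1

lemma frontier_nonempty_of_isBounded (hN : 1 ≤ N) (hne : Ω.Nonempty)
    (hΩb : Bornology.IsBounded Ω) : (frontier Ω).Nonempty := by
  have := nontrivial_Eu hN
  by_contra h
  rw [not_nonempty_iff_eq_empty, frontier_eq_empty_iff] at h
  rcases h with h | h
  · exact hne.ne_empty h
  · rw [h] at hΩb
    exact NormedSpace.unbounded_univ ℝ (Eu N) hΩb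

/-- Only the points at which the test function does not vanish matter for the bound on `k`. -/
lemma setIntegral_mul_le {k φ : Eu N → ℝ} {C : ℝ} (hΩ : MeasurableSet Ω)
    (hk : ∀ x ∈ Ω, φ x ≠ 0 → k x ≤ C) (hφ : ∀ x, 0 ≤ φ x)
    (hi : IntegrableOn (fun x => k x * φ x) Ω) (hφi : IntegrableOn φ Ω) :
    ∫ x in Ω, k x * φ x ≤ C * ∫ x in Ω, φ x := by
  rw [← integral_const_mul]
  refine setIntegral_mono_on hi (hφi.const_mul C) hΩ fun x hx => ?_
  by_cases h0 : φ x = 0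
  · simp [h0]
  · exact mul_le_mul_of_nonneg_right (hk x hx h0) (hφ x)

/-- For any admissible sequence of levels and small `κ`, the limit level lies below `(v - u) / κ`
in all of `Ω`. -/
theorem exists_level_le (hN : 1 ≤ N) (hΩo : IsOpen Ω) (hΩb : Bornology.IsBounded Ω)
    {s₁ s₂ p q : ℝ} (hs₂ : 0 < s₂) (hs : s₂ < s₁) (hs₁ : s₁ < 1) (hq : 1 < q) (hqp : q < p)
    {g : ℝ → ℝ} (hgc : Continuous g) {u v : Eu N → ℝ}
    (huW : MemW0 Ω s₁ p u) (huC : MemC0 Ω s₁ u) (hvW : MemW0 Ω s₁ p v) (hvC : MemC0 Ω s₁ v)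
    (hne : ∃ x ∈ Ω, u x ≠ v x) {K : ℝ} (hK : 0 < K)
    (huv : ∀ φ : Eu N → ℝ, MemW0 Ω s₁ p φ → (∀ x, 0 ≤ φ x) →
      weakForm Ω s₁ p s₂ q g u φ ≤ weakForm Ω s₁ p s₂ q g v φ)
    (hvK : ∀ φ : Eu N → ℝ, MemW0 Ω s₁ p φ → (∀ x, 0 ≤ φ x) →
      weakForm Ω s₁ p s₂ q g v φ ≤ K * ∫ x in Ω, φ x)
    (hpos : ∀ x ∈ Ω, 0 < u x) (hle : ∀ x ∈ Ω, u x ≤ v x)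
    {θ τ : ℕ → ℝ} {b c₀ θ' τ' : ℝ} (θ_nonneg : ∀ j, 0 ≤ θ j) (θ_le : ∀ j, θ j ≤ 1)
    (θ_anti : ∀ j, θ (j + 1) ≤ θ j) (τ_nonneg : ∀ j, 0 ≤ τ j) (τ_mono : ∀ j, τ j ≤ τ (j + 1))
    (hb : 0 < b) (hb1 : b ≤ 1)
    (level_gap : ∀ j, ∀ x ∈ Ω,
      b * (1 / 2) ^ j * u x ≤ (θ j * u x - τ j) - (θ (j + 1) * u x - τ (j + 1)))
    (hc₀ : 0 < c₀) (hc₀1 : c₀ ≤ 1)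
    (le_u : ∀ x ∈ Ω, 0 < θ 0 * u x - τ 0 → c₀ * bdist Ω x ^ s₁ ≤ u x)
    (hθ' : ∀ j, θ' ≤ θ j) (hτ' : ∀ j, τ j ≤ τ') :
    ∃ κ : ℝ, 0 < κ ∧ ∀ x ∈ Ω, κ * (θ' * u x - τ') ≤ v x - u x := by
  obtain ⟨x₀, hx₀, hx₀ne⟩ := hne
  have hp : 1 < p := hq.trans hqp
  have hΩm := hΩo.measurableSet
  have hΩv : volume Ω < ⊤ := hΩb.measure_lt_top
  have hfr := frontier_nonempty_of_isBounded hN ⟨x₀, hx₀⟩ hΩb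
  have huc : ContinuousOn u Ω := huC.1.mono subset_closure
  have hvc : ContinuousOn v Ω := hvC.1.mono subset_closure
  obtain ⟨C₀, hC₀, hu⟩ := huC.exists_le hΩo hΩb hfr
  obtain ⟨M, hM, hv⟩ := hvC.exists_le hΩo hΩb hfr
  set U := Ω.indicator u with hU
  set W := Ω.indicator v with hW
  have Uin : ∀ x ∈ Ω, U x = u x := fun x hx => indicator_of_mem hx u
  have Win : ∀ x ∈ Ω, W x = v x := fun x hx => indicator_of_mem hx v
  have Uout : ∀ x ∉ Ω, U x = 0 := fun x hx => indicator_of_notMem hx u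
  have Wout : ∀ x ∉ Ω, W x = 0 := fun x hx => indicator_of_notMem hx v
  have hUm : Measurable U := measurable_indicator_of_continuousOn hΩm huc
  have hWm : Measurable W := measurable_indicator_of_continuousOn hΩm hvc
  have hU0 : ∀ x, 0 ≤ U x := fun x => indicator_nonneg (fun x hx => (hpos x hx).le) x
  have hUW : ∀ x, U x ≤ W x := fun x => by
    by_cases hx : x ∈ Ω
    · rw [Uin x hx, Win x hx]; exact hle x hx
    · rw [Uout x hx, Wout x hx]
  have hWM : ∀ x, W x ≤ M := fun x => by
    by_cases hx : x ∈ Ω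
    · rw [Win x hx]; exact (hv x hx).1
    · rw [Wout x hx]; linarith
  have wfU : ∀ φ, weakForm Ω s₁ p s₂ q g u φ =
      A s₁ p U φ + A s₂ q U φ + ∫ x in Ω, g (U x) * φ x := fun φ => by
    unfold weakForm
    rw [A_congr (huW.ae_eq_indicator hΩm), A_congr (huW.ae_eq_indicator hΩm)]
    congr 1
    exact setIntegral_congr_fun hΩm fun x hx => by simp only [Uin x hx]
  have wfW : ∀ φ, weakForm Ω s₁ p s₂ q g v φ =
      A s₁ p W φ + A s₂ q W φ + ∫ x in Ω, g (W x) * φ x := fun φ => by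
    unfold weakForm
    rw [A_congr (hvW.ae_eq_indicator hΩm), A_congr (hvW.ae_eq_indicator hΩm)]
    congr 1
    exact setIntegral_congr_fun hΩm fun x hx => by simp only [Win x hx]
  obtain ⟨G, hG⟩ := (isCompact_Icc (a := (0:ℝ)) (b := M)).exists_bound_of_continuousOn
    hgc.continuousOn
  have hG0 : 0 ≤ G := (norm_nonneg _).trans (hG 0 ⟨le_rfl, by linarith⟩)
  have Ucc : ∀ x, U x ∈ Icc 0 M := fun x => ⟨hU0 x, (hUW x).trans (hWM x)⟩
  have Wcc : ∀ x, W x ∈ Icc 0 M := fun x => ⟨(hU0 x).trans (hUW x), hWM x⟩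
  have int : ∀ w : Eu N → ℝ, Measurable w → (∀ x, w x ∈ Icc 0 M) → ∀ φ : Eu N → ℝ,
      MemW0 Ω s₁ p φ → IntegrableOn (fun x => g (w x) * φ x) Ω := fun w hw hwM φ hφ =>
    (hφ.integrableOn hp.le hΩv).bdd_mul (hgc.measurable.comp hw).aestronglyMeasurable
      (.of_forall fun x => hG _ (hwM x))
  set R := max 1 (Metric.diam (closure Ω)) with hR
  have hcb : Bornology.IsBounded (closure Ω) := hΩb.closure
  have hdiam : ∀ x ∈ closure Ω, ∀ y ∈ closure Ω, dist x y ≤ R := fun x hx y hy =>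
    (Metric.dist_le_diam_of_mem hcb hx hy).trans (le_max_right _ _)
  have hlt : u x₀ < v x₀ := lt_of_le_of_ne (hle x₀ hx₀) hx₀ne
  obtain ⟨r, hr, hrB⟩ : ∃ r > 0, Metric.ball x₀ r ⊆ Ω ∩ {x | (v x₀ - u x₀) / 2 < v x - u x} := by
    have hcd : ContinuousOn (fun x => v x - u x) Ω := hvc.sub huc
    exact Metric.isOpen_iff.1 (hcd.isOpen_inter_preimage hΩo (isOpen_Ioi (a := (v x₀ - u x₀) / 2)))
      x₀ ⟨hx₀, show (v x₀ - u x₀) / 2 < v x₀ - u x₀ by linarith⟩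
  -- `u` and `v` are replaced by functions vanishing everywhere off `Ω`
  let X : Config N :=
    { s₁ := s₁, s₂ := s₂, p := p, q := q, Ω := Ω, B := Metric.ball x₀ r, ρ := bdist Ω, u := U
      v := W, θ := θ, τ := τ, C₀ := C₀, c₀ := c₀, M := M, R := R, b := b
      ε₀ := (v x₀ - u x₀) / 2, L := K + G
      hN := hN, hs₂ := hs₂, hs := hs, hs₁ := hs₁, hq := hq, hqp := hqp
      measurable_Ω := hΩm, volume_Ω := hΩv
      hR := le_max_left _ _
      diam_le := fun x hx y hy => by
        rw [← dist_eq_norm]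
        exact hdiam x (subset_closure hx) y (subset_closure hy)
      measurable_ρ := (Metric.continuous_infDist_pt _).measurable
      ρ_nonneg := fun _ => Metric.infDist_nonneg
      ρ_lip := fun x y => by
        rw [← dist_eq_norm]
        exact Metric.infDist_le_infDist_add_dist
      ρ_proj := fun y _ => by
        obtain ⟨z, hz, hyz⟩ := isClosed_frontier.exists_infDist_eq_dist hfr y
        refine ⟨z, ?_, Metric.infDist_zero_of_mem hz⟩
        rw [← dist_eq_norm]
        exact hyz.ge
      measurable_u := hUm, measurable_v := hWm
      u_nonneg := hU0, u_le_v := hUW, hM := hM, v_le := hWM, u_zero := Uout, v_zero := Wout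
      hC₀ := hC₀
      u_le := fun x => by
        by_cases hx : x ∈ Ω
        · rw [Uin x hx]; exact (hu x hx).2
        · rw [Uout x hx]
          have : 0 ≤ bdist Ω x := Metric.infDist_nonneg
          positivity
      u_energy := huW.integrable_energy hΩm huc
      v_energy := hvW.integrable_energy hΩm hvc
      hL := by linarith
      u_sub := fun φ hφ hφ0 => by
        have h1 := (huv φ hφ hφ0).trans (hvK φ hφ hφ0)
        rw [wfU] at h1
        have h2 := setIntegral_mul_le (k := fun x => -g (U x)) (C := G) hΩm
          (fun x _ _ => (neg_le_abs _).trans (hG _ (Ucc x))) hφ0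
          (by simpa using (int U hUm Ucc φ hφ).neg) (hφ.integrableOn hp.le hΩv)
        simp only [neg_mul, integral_neg] at h2
        linarith
      u_v := fun ω hω => by
        have huni := (isCompact_Icc (a := (0:ℝ)) (b := M)).uniformContinuousOn_of_continuous
          hgc.continuousOn
        obtain ⟨δ, hδ, hδ'⟩ := Metric.uniformContinuousOn_iff.1 huni ω hω
        refine ⟨δ / 2, by positivity, fun φ hφ hφ0 hsmall => ?_⟩
        have h1 := huv φ hφ hφ0
        rw [wfU, wfW] at h1
        have i1 := int U hUm Ucc φ hφ
        have i2 := int W hWm Wcc φ hφ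
        have h2 := setIntegral_mul_le (k := fun x => g (W x) - g (U x)) (C := ω) hΩm
          (fun x hx hφx => by
            have h3 : W x - U x ≤ δ / 2 := not_lt.1 fun h => hφx (hsmall x hx h)
            have h4 := hδ' (W x) (Wcc x) (U x) (Ucc x) (by
              rw [Real.dist_eq, abs_of_nonneg (sub_nonneg.2 (hUW x))]; linarith)
            rw [Real.dist_eq] at h4
            exact (le_abs_self _).trans h4.le) hφ0
          (by simp only [sub_mul]; exact i2.sub i1) (hφ.integrableOn hp.le hΩv)
        simp only [sub_mul] at h2
        rw [integral_sub i2 i1] at h2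
        linarith
      measurable_B := measurableSet_ball
      B_sub := fun x hx => (hrB hx).1
      volume_B := Metric.measure_ball_pos _ _ hr
      hε₀ := by linarith
      B_gap := fun x hx => by
        obtain ⟨h1, h2⟩ := hrB hx
        rw [Uin x h1, Win x h1]
        exact le_of_lt h2
      θ_nonneg := θ_nonneg, θ_le := θ_le, θ_anti := θ_anti, τ_nonneg := τ_nonneg
      τ_mono := τ_mono, hb := hb, hb1 := hb1
      level_gap := fun j x h => by
        by_cases hx : x ∈ Ω
        · rw [Uin x hx]; exact level_gap j x hx
        · rw [Uout x hx] at h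
          linarith [τ_nonneg (j + 1)]
      hc₀ := hc₀, hc₀1 := hc₀1
      le_u := fun x h => by
        by_cases hx : x ∈ Ω
        · rw [Uin x hx] at h ⊢; exact le_u x hx h
        · rw [Uout x hx] at h
          linarith [τ_nonneg 0] }
  obtain ⟨κ, hκ, H⟩ := X.exists_iInter_null
  refine ⟨κ, hκ, fun x hx => ?_⟩
  have hnull := H κ hκ le_rfl
  have hfc : ContinuousOn (fun x => θ' * u x - τ' - (v x - u x) / κ) Ω :=
    ((huc.const_mul θ').sub continuousOn_const).sub ((hvc.sub huc).div_const κ)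
  have hopen := hfc.isOpen_inter_preimage hΩo (isOpen_Ioi (a := (0:ℝ)))
  have hsub : Ω ∩ (fun x => θ' * u x - τ' - (v x - u x) / κ) ⁻¹' Ioi 0 ⊆ ⋂ j, X.S κ j := by
    rintro y ⟨hy, hy'⟩
    refine mem_iInter.2 fun j => lt_of_lt_of_le ?_ (Config.le_ψ (X := X) (κ := κ) (j := j) y)
    change 0 < θ j * U y - τ j - (W y - U y) / κ
    rw [Uin y hy, Win y hy]
    have h1 : 0 < θ' * u y - τ' - (v y - u y) / κ := hy'
    have h2 := mul_le_mul_of_nonneg_right (hθ' j) (hpos y hy).le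
    linarith [hτ' j]
  have hempty := (hopen.measure_eq_zero_iff volume).1 (measure_mono_null hsub hnull)
  have : ¬ 0 < θ' * u x - τ' - (v x - u x) / κ := fun h => by
    have : x ∈ Ω ∩ (fun x => θ' * u x - τ' - (v x - u x) / κ) ⁻¹' Ioi 0 := ⟨hx, h⟩
    rw [hempty] at this
    exact this
  have h3 : θ' * u x - τ' ≤ (v x - u x) / κ := by linarith
  rw [le_div_iff₀ hκ] at h3
  linarith

end FracPQ

theorem mainTheorem7 (N : ℕ) (hN : 1 ≤ N)
    (Ω : Set (EuclideanSpace ℝ (Fin N))) (hΩo : IsOpen Ω) (hΩc : IsConnected Ω)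
    (hΩb : Bornology.IsBounded Ω)
    (s₁ s₂ p q : ℝ) (hs₂ : 0 < s₂) (hs : s₂ < s₁) (hs₁ : s₁ < 1) (hq : 1 < q) (hqp : q < p)
    (g : ℝ → ℝ) (hgc : Continuous g) (hgBV : LocallyBoundedVariationOn g Set.univ)
    (u v : EuclideanSpace ℝ (Fin N) → ℝ)
    (huW : FracPQ.MemW0 Ω s₁ p u) (huC : FracPQ.MemC0 Ω s₁ u)
    (hvW : FracPQ.MemW0 Ω s₁ p v) (hvC : FracPQ.MemC0 Ω s₁ v)
    (hne : ∃ x ∈ Ω, u x ≠ v x)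
    (K : ℝ) (hK : 0 < K)
    (huv : ∀ φ : EuclideanSpace ℝ (Fin N) → ℝ, FracPQ.MemW0 Ω s₁ p φ → (∀ x, 0 ≤ φ x) →
      FracPQ.weakForm Ω s₁ p s₂ q g u φ ≤ FracPQ.weakForm Ω s₁ p s₂ q g v φ)
    (hvK : ∀ φ : EuclideanSpace ℝ (Fin N) → ℝ, FracPQ.MemW0 Ω s₁ p φ → (∀ x, 0 ≤ φ x) →
      FracPQ.weakForm Ω s₁ p s₂ q g v φ ≤ K * ∫ x in Ω, φ x)
    (hpos : ∀ x ∈ Ω, 0 < u x) (hle : ∀ x ∈ Ω, u x ≤ v x) :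
    (∀ x ∈ Ω, u x < v x) ∧
      (FracPQ.MemIntCone Ω s₁ u → FracPQ.MemIntCone Ω s₁ v →
        (∃ η : ℝ, 1 < η ∧ ∀ x ∈ Ω, η * u x ≤ v x) ∧
          FracPQ.MemIntCone Ω s₁ (fun x => v x - u x)) := by
  have level := @FracPQ.exists_level_le N Ω hN hΩo hΩb s₁ s₂ p q hs₂ hs hs₁ hq hqp g hgc u v huW huC
    hvW hvC hne K hK huv hvK hpos hle
  obtain ⟨x₀, hx₀, -⟩ := id hne
  have hfr := FracPQ.frontier_nonempty_of_isBounded hN ⟨x₀, hx₀⟩ hΩb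
  have hs₁0 : 0 < s₁ := hs₂.trans hs
  have hd0 : ∀ x, 0 ≤ FracPQ.bdist Ω x := fun _ => Metric.infDist_nonneg
  constructor
  · -- the levels `u - τ j` increase from `u - e` to `u - 2 * e`, where `4 * e = u x₁`
    intro x₁ hx₁
    obtain ⟨M, hM, hu⟩ := huC.exists_le hΩo hΩb hfr
    set e := u x₁ / 4 with he
    have he0 : 0 < e := by have := hpos x₁ hx₁; positivity
    obtain ⟨R, hR⟩ := hΩb.isCompact_closure.exists_bound_of_continuousOn
      (f := FracPQ.bdist Ω) (Metric.continuous_infDist_pt _).continuousOn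
    have hR0 : 0 < max 1 R := lt_max_of_lt_left one_pos
    have hRx : ∀ x ∈ Ω, FracPQ.bdist Ω x ≤ max 1 R := fun x hx =>
      (le_abs_self _).trans ((hR x (subset_closure hx)).trans (le_max_right _ _))
    obtain ⟨κ, hκ, H⟩ := level (θ := fun _ => 1) (τ := fun j => e * (2 - (1 / 2) ^ j))
      (b := min 1 (e / (2 * M))) (c₀ := min 1 (e / max 1 R ^ s₁)) (θ' := 1) (τ' := 2 * e)
      (fun _ => zero_le_one) (fun _ => le_rfl) (fun _ => le_rfl)
      (fun j => by
        have : ((1:ℝ) / 2) ^ j ≤ 1 := pow_le_one₀ (by norm_num) (by norm_num)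
        exact mul_nonneg he0.le (by linarith))
      (fun j => by
        have : (0:ℝ) < (1 / 2) ^ j := by positivity
        simp only [pow_succ]
        gcongr e * (2 - ?_)
        linarith)
      (lt_min one_pos (by positivity)) (min_le_left _ _)
      (fun j x hx => by
        have h1 : min 1 (e / (2 * M)) * u x ≤ e / (2 * M) * M := by
          have := (hpos x hx).le
          gcongr
          · exact min_le_right _ _
          · exact (hu x hx).1
        have h2 : e / (2 * M) * M = e / 2 := by field_simp
        have h3 := mul_le_mul_of_nonneg_right (h1.trans h2.le)
          (show (0:ℝ) ≤ (1 / 2) ^ j by positivity)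
        simp only [pow_succ]
        linarith)
      (lt_min one_pos (by positivity)) (min_le_left _ _)
      (fun x hx h => by
        have h1 : e ≤ u x := by
          simp only [pow_zero] at h; linarith
        refine le_trans ?_ h1
        have := hd0 x
        calc min 1 (e / max 1 R ^ s₁) * FracPQ.bdist Ω x ^ s₁
            ≤ e / max 1 R ^ s₁ * max 1 R ^ s₁ := by
              gcongr
              · exact min_le_right _ _
              · exact hRx x hx
          _ = e := by field_simp)
      (fun _ => le_rfl)
      (fun j => by
        have : (0:ℝ) < (1 / 2) ^ j := by positivity
        nlinarith)
    have h1 := H x₁ hx₁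
    have h2 : 0 < κ * (1 * u x₁ - 2 * e) := mul_pos hκ (by linarith)
    linarith
  · -- the levels are the multiples of `u` with factors decreasing from `1` to `1 / 2`
    rintro ⟨-, -, c, hc, hcu⟩ -
    have hdpos : ∀ x ∈ Ω, 0 < FracPQ.bdist Ω x ^ s₁ := fun x hx =>
      Real.rpow_pos_of_pos (FracPQ.bdist_pos hΩo hfr hx) _
    obtain ⟨κ, hκ, H⟩ := level (θ := fun j => (1 + (1 / 2) ^ j) / 2) (τ := fun _ => 0)
      (b := 1 / 4) (c₀ := min 1 c) (θ' := 1 / 2) (τ' := 0)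
      (fun j => by positivity)
      (fun j => by
        have : ((1:ℝ) / 2) ^ j ≤ 1 := pow_le_one₀ (by norm_num) (by norm_num)
        linarith)
      (fun j => by
        have : (0:ℝ) < (1 / 2) ^ j := by positivity
        simp only [pow_succ]
        linarith)
      (fun _ => le_rfl) (fun _ => le_rfl) (by norm_num) (by norm_num)
      (fun j x hx => by
        simp only [pow_succ]
        exact le_of_eq (by ring))
      (lt_min one_pos hc) (min_le_left _ _)
      (fun x hx _ => by
        have h1 := hcu x hx
        rw [le_div_iff₀ (hdpos x hx)] at h1
        refine le_trans ?_ h1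
        gcongr
        · exact (hdpos x hx).le
        · exact min_le_right _ _)
      (fun j => by
        have : (0:ℝ) < (1 / 2) ^ j := by positivity
        linarith)
      (fun _ => le_rfl)
    have hgap : ∀ x ∈ Ω, κ / 2 * u x ≤ v x - u x := fun x hx => by linarith [H x hx]
    refine ⟨⟨1 + κ / 2, by linarith, fun x hx => by linarith [hgap x hx]⟩, ?_, ?_, ?_⟩
    · obtain ⟨hu, k, hk, hkx⟩ := huC
      obtain ⟨hv, l, hl, hlx⟩ := hvC
      exact ⟨hv.sub hu, fun x => l x - k x, hl.sub hk, fun x hx => by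
        simp only [hkx x hx, hlx x hx, sub_div]⟩
    · intro x hx
      have h1 := mul_pos (half_pos hκ) (hpos x hx)
      linarith [hgap x hx]
    · refine ⟨κ / 2 * c, by positivity, fun x hx => ?_⟩
      rw [le_div_iff₀ (hdpos x hx)]
      refine le_trans ?_ (hgap x hx)
      have h1 := hcu x hx
      rw [le_div_iff₀ (hdpos x hx)] at h1
      rw [mul_assoc]
      gcongr
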